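/- **Setting.** Let $\Bbbk$ be a field of characteristic $\neq 2$ and $n\ge 1$. Let $R=\Bbbk[f_1,\dots,f_n]$, on which $S_{n+1}$ acts by the geometric representation: $s_if_i=-f_i$, $s_if_j=f_j+f_i$ if $|i-j|=1$ (*adjacent*), and $s_if_j=f_j$ if $|i-j|\ge 2$ (*distant*). Let $R^i$ be the subring of $s_i$-invariants and $\partial_i(p)=(p-s_ip)/f_i$. Put $B_i=R\otimes_{R^i}R$, and for a word $x=i_1\cdots i_d$ put $B_x=B_{i_1}\otimes_R\cdots\otimes_RB_{i_d}$, an $R$-bimodule (grading shifts are ignored). * For distant $i,j$ the *four-valent vertex* $B_iB_j\to B_jB_i$ is the bimodule map with $1\otimes1\otimes1\mapsto1\otimes1\otimes1$. * For adjacent $i,j$ and $J'=\{i,j\}$ the *six-valent vertex* $B_iB_jB_i\to B_jB_iB_j$ is the projection to $R\otimes_{R^{J'}}R$ followed by the inclusion of $R\otimes_{R^{J'}}R$ in $B_jB_iB_j$; it preserves degree and sends $1\otimes1\otimes1\otimes1$ to $1\otimes1\otimes1\otimes1$. Explicitly, with $\delta=1\otimes\frac{f_i}{2}\otimes1\otimes1-1\otimes1\otimes\frac{f_i}{2}\otimes1$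 and $\gamma=1\otimes1\otimes1\otimes(f_i+f_j)$ in the commutative ring $B_jB_iB_j$, and writing $p_0$, $p_3$ for $p\in R$ placed in the first or last factor, it is $$1\otimes b\otimes c\otimes 1\;\mapsto\;(\partial_ib)_0\big[(\delta+\gamma)\,c_3+\delta(\delta+\gamma)(\partial_ic)_3\big]+(s_ib)_0\big[c_3+(2\delta-(f_i)_0+\gamma)(\partial_ic)_3\big].$$ **Expression graphs.** Let $J=\{a,a+1,\dots,b\}\subseteq\{1,\dots,n\}$ be non-empty and let $w_J$ be the longest element of the parabolic subgroup $W_J$. The *expanded expression graph* has the reduced expressions of $w_J$ as vertices; its edges are the *distant* edges (replace $ij$ by $ji$, $i,j$ distant) and the *adjacent* edges (replace $iji$ by $jij$, $i,j$ adjacent). The *expression graph* $\Gamma$ is obtained by contracting the distant edges. Adjacent edges are oriented from $i\,(i{+}1)\,i$ to $(i{+}1)\,i\,(i{+}1)$; a path is *oriented* if it follows every adjacent edge in this direction (distant edges may be followed freely). Write $x\searrow y$ for an oriented path from $x$ to $y$, and $y\nearrow x$ for such a path followed backwards. The *path morphism* of a path composes the four-valent vertices of its distant edges and the six-valent vertices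 of its adjacent edges, tensored with identities on the left and right. **Source, sink and $V_J$.** The word $a\cdot(a{+}1)\,a\cdot(a{+}2)(a{+}1)\,a\cdots b\cdots(a{+}1)\,a$ represents a source of $\Gamma$, and $b\cdot(b{-}1)\,b\cdot(b{-}2)(b{-}1)\,b\cdots a(a{+}1)\cdots b$ represents a sink. The path $V_J$ is the following oriented path from the first to the second. If $a=b$ it is constant. Otherwise it first follows $V_{J\setminus\{b\}}$ with $b(b-1)\cdots a$ appended on the right, and then performs, for $i=a,a+1,\dots,b-1$ in turn, the flip $$i\cdots(b{-}1)\,b\,(b{-}1)\cdots i\;\searrow\;b\cdots(i{+}1)\,i\,(i{+}1)\cdots b,$$ whose $m$-th vertex ($0\le m\le b-i$) is $$b(b{-}1)\cdots(b{-}m{+}1)\cdot i\cdots(b{-}m{-}1)(b{-}m)(b{-}m{-}1)\cdots i\cdot(b{-}m{+}1)\cdots(b{-}1)\,b .$$ **Theorem.** Let $s_J$ and $t_J$ be any reduced expressions of $w_J$ that represent a source and a sink of $\Gamma$. For reduced expressions $x,y$ of $w_J$ there are oriented paths $s_J\searrow x\searrow t_J$. Let $$z_J:B_{s_J}\to B_{t_J},\quad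 \overline{z_J}:B_{t_J}\to B_{s_J},\quad \varphi_{x,y}:B_x\to B_y,\quad \psi_{x,y}:B_x\to B_y$$ be the path morphisms of $s_J\searrow t_J$, of $t_J\nearrow s_J$, of $x\searrow t_J\nearrow s_J\searrow y$, and of $x\nearrow s_J\searrow t_J\nearrow y$. They do not depend on the choice of the oriented paths, $z_J=\psi_{s_J,t_J}$ and $\overline{z_J}=\varphi_{t_J,s_J}$. Moreover: 1. $z_J\,\overline{z_J}\,z_J=z_J$; 2. $\varphi_{x,y}=\psi_{x,y}$ for all $x,y$ that represent vertices of $\Gamma$ on the path $V_J$; 3. $\varphi_{y,z}\,\varphi_{x,y}=\varphi_{x,z}$ for all reduced expressions $x,y,z$ of $w_J$. Hence the $\varphi_{x,y}$ form a consistent family of projectors that picks out a common direct summand of all the $B_x$: there are an $R$-bimodule $C$ and bimodule maps $\iota_x:C\to B_x$ and $\pi_x:B_x\to C$, one pair for every reduced expression $x$ of $w_J$, with $\pi_x\iota_x=\mathrm{id}_C$ and $\iota_y\pi_x=\varphi_{x,y}$ for all $x,y$. -/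

import Mathlib

set_option linter.unusedSimpArgs false

noncomputable section

namespace Soergel

open MvPolynomial TensorProduct

universe u

/-! ### The polynomial ring and the Demazure operators -/

/-- Indices are the elements of `Fin n`; two of them are adjacent if they are neighbours in the
Dynkin diagram of type `A_n`. -/
def Adjacent {n : ℕ} (i j : Fin n) : Prop := i.val + 1 = j.val ∨ j.val + 1 = i.val

instance {n : ℕ} (i j : Fin n) : Decidable (Adjacent i j) :=
  inferInstanceAs (Decidable (_ ∨ _))

/-- Two indices are distant if they are different and not adjacent. -/
def Distant {n : ℕ} (i j : Fin n) : Prop := i.val + 1 < j.val ∨ j.val + 1 < i.val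

/-- The ring `R = k[f_1, ..., f_n]`; the variable `X i` is the simple root `f_i`. -/
abbrev PolyRing (k : Type u) [Field k] (n : ℕ) : Type u := MvPolynomial (Fin n) k

/-- The action of the simple reflection `s_i` on `R` (geometric representation). -/
def refl (k : Type u) [Field k] {n : ℕ} (i : Fin n) : PolyRing k n →ₐ[k] PolyRing k n :=
  aeval fun j => if j = i then -X i else if Adjacent i j then X j + X i else X j

/-- The ring `R^i` of polynomials invariant under `s_i`. -/
def invariants (k : Type u) [Field k] {n : ℕ} (i : Fin n) : Subalgebra k (PolyRing k n) :=
  AlgHom.equalizer (refl k i) (AlgHom.id k (PolyRing k n))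

section basic

variable {k : Type u} [Field k] {n : ℕ}

/-- The Demazure operator `p ↦ (p - s_i p) / f_i`; the division is exact, see `X_mul_demazure`. -/
def demazure (i : Fin n) (p : PolyRing k n) : PolyRing k n :=
  (p - refl k i p).divMonomial (Finsupp.single i 1)

theorem X_mul_demazure (i : Fin n) (p : PolyRing k n) :
    X i * demazure i p = p - refl k i p := by
  have h : (X i : PolyRing k n) ∣ p - refl k i p := by
    induction p using MvPolynomial.induction_on with
    | C a => simp [refl]
    | add p q hp hq =>
      have : p + q - refl k i (p + q) = (p - refl k i p) + (q - refl k i q) := by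
        rw [map_add]; ring
      rw [this]; exact dvd_add hp hq
    | mul_X p j hp =>
      have hj : (X i : PolyRing k n) ∣ X j - refl k i (X j) := by
        simp only [refl, aeval_X]
        split_ifs with h1 h2
        · subst h1; exact ⟨2, by ring⟩
        · exact ⟨-1, by ring⟩
        · simp
      have : p * X j - refl k i (p * X j)
          = (p - refl k i p) * X j + refl k i p * (X j - refl k i (X j)) := by
        rw [map_mul]; ring
      rw [this]; exact dvd_add (hp.mul_right _) (hj.mul_left _)
  obtain ⟨q, hq⟩ := h
  rw [demazure, hq, X_mul_divMonomial]

theorem demazure_unique (i : Fin n) (p q : PolyRing k n) (h : X i * q = p - refl k i p) :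
    demazure i p = q := by
  have := (X_mul_demazure i p).trans h.symm
  exact mul_left_cancel₀ (X_ne_zero i) this

theorem refl_eq (i : Fin n) (p : PolyRing k n) : refl k i p = p - X i * demazure i p := by
  rw [X_mul_demazure]; ring

theorem demazure_add (i : Fin n) (p q : PolyRing k n) :
    demazure i (p + q) = demazure i p + demazure i q := by
  apply demazure_unique; rw [mul_add, X_mul_demazure, X_mul_demazure, map_add]; ring

theorem demazure_mul (i : Fin n) (p q : PolyRing k n) :
    demazure i (p * q) = demazure i p * refl k i q + p * demazure i q := by
  apply demazure_unique
  rw [mul_add, ← mul_assoc, X_mul_demazure, mul_left_comm, X_mul_demazure, map_mul]; ring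

theorem refl_of_mem {i : Fin n} {p : PolyRing k n} (h : p ∈ invariants k i) : refl k i p = p := h

theorem demazure_of_mem {i : Fin n} {p : PolyRing k n} (h : p ∈ invariants k i) :
    demazure i p = 0 := by
  apply demazure_unique; rw [refl_of_mem h]; ring

theorem refl_X_self (i : Fin n) : refl k i (X i) = -X i := by simp [refl]

theorem refl_X_adjacent {i j : Fin n} (h : Adjacent i j) : refl k i (X j) = X j + X i := by
  have : j ≠ i := by rintro rfl; rcases h with h | h <;> omega
  simp [refl, this, h]

theorem refl_X_distant {i j : Fin n} (h : Distant i j) : refl k i (X j) = X j := by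
  have h1 : j ≠ i := by rintro rfl; rcases h with h | h <;> omega
  have h2 : ¬ Adjacent i j := by rintro (h' | h') <;> rcases h with h | h <;> omega
  simp [refl, h1, h2]

theorem refl_refl (i : Fin n) (p : PolyRing k n) : refl k i (refl k i p) = p := by
  suffices h : (refl k i).comp (refl k i) = AlgHom.id k _ from congrArg (fun f => f p) h
  apply MvPolynomial.algHom_ext
  intro j
  rw [AlgHom.comp_apply, AlgHom.id_apply]
  by_cases h1 : j = i
  · subst h1; rw [refl_X_self, map_neg, refl_X_self, neg_neg]
  by_cases h2 : Adjacent i j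
  · rw [refl_X_adjacent h2, map_add, refl_X_self, refl_X_adjacent h2]; ring
  · have : refl k i (X j) = X j := by simp [refl, h1, h2]
    rw [this, this]

theorem demazure_mem (i : Fin n) (p : PolyRing k n) : demazure i p ∈ invariants k i := by
  change refl k i (demazure i p) = demazure i p
  have h := congrArg (refl k i) (X_mul_demazure i p)
  rw [map_mul, refl_X_self, map_sub, refl_refl] at h
  apply mul_left_cancel₀ (X_ne_zero (R := k) i)
  linear_combination -h - X_mul_demazure i p

theorem half_spec [NeZero (2 : k)] : (2 : PolyRing k n) * C (2⁻¹ : k) = 1 := by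
  have h : (2 : PolyRing k n) = C (2 : k) := (map_ofNat _ 2).symm
  rw [h, ← C_mul, mul_inv_cancel₀ (NeZero.ne _), C_1]

/-- The element `f_i / 2`. -/
def halfRoot (k : Type u) [Field k] {n : ℕ} (i : Fin n) : PolyRing k n := C (2⁻¹ : k) * X i

/-- The projection `p ↦ (p + s_i p) / 2` from `R` to `R^i`; the polynomial `p` is recovered as
`average i p + halfRoot k i * demazure i p`. -/
def average (i : Fin n) (p : PolyRing k n) : PolyRing k n := C (2⁻¹ : k) * (p + refl k i p)

theorem average_mem (i : Fin n) (p : PolyRing k n) : average i p ∈ invariants k i := by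
  change refl k i (average i p) = average i p
  rw [average, map_mul, map_add, refl_refl, ← algebraMap_eq, AlgHom.commutes, add_comm]

theorem average_add_demazure [NeZero (2 : k)] (i : Fin n) (p : PolyRing k n) :
    average i p + halfRoot k i * demazure i p = p := by
  rw [average, halfRoot, refl_eq]
  linear_combination p * half_spec (k := k) (n := n)

theorem X_eq [NeZero (2 : k)] (i : Fin n) : (X i : PolyRing k n) = 2 * halfRoot k i := by
  rw [halfRoot]
  linear_combination -X i * half_spec (k := k) (n := n)

theorem average_eq [NeZero (2 : k)] (i : Fin n) (p : PolyRing k n) :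
    average i p = p - halfRoot k i * demazure i p := by
  linear_combination average_add_demazure i p

theorem average_add (i : Fin n) (p q : PolyRing k n) :
    average i (p + q) = average i p + average i q := by
  simp only [average, map_add]; ring

theorem halfRoot_sq_mem (i : Fin n) : halfRoot k i ^ 2 ∈ invariants k i := by
  change refl k i (halfRoot k i ^ 2) = halfRoot k i ^ 2
  rw [halfRoot, map_pow, map_mul, refl_X_self, ← algebraMap_eq, AlgHom.commutes]; ring

theorem halfRoot_adjacent_mem {i j : Fin n} [NeZero (2 : k)] (h : Adjacent i j) :
    2 * halfRoot k j + halfRoot k i ∈ invariants k i := by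
  change refl k i (2 * halfRoot k j + halfRoot k i) = 2 * halfRoot k j + halfRoot k i
  rw [map_add, map_mul, map_ofNat]
  simp only [halfRoot, map_mul, refl_X_self, refl_X_adjacent h]
  rw [← algebraMap_eq, AlgHom.commutes]; ring

theorem halfRoot_distant_mem {i j : Fin n} (h : Distant i j) :
    halfRoot k j ∈ invariants k i := by
  change refl k i (halfRoot k j) = halfRoot k j
  rw [halfRoot, map_mul, refl_X_distant h, ← algebraMap_eq, AlgHom.commutes]

theorem refl_X (i l : Fin n) : refl k i (X l : PolyRing k n) =
    if l = i then -X i else if Adjacent i l then X l + X i else X l := by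
  rw [refl, aeval_X]

theorem refl_comm {i j : Fin n} (h : Distant i j) (p : PolyRing k n) :
    refl k i (refl k j p) = refl k j (refl k i p) := by
  suffices h : (refl k i).comp (refl k j) = (refl k j).comp (refl k i) from
    congrArg (fun f => f p) h
  have hi := refl_X_self (k := k) i
  have hj := refl_X_self (k := k) j
  have hij : refl k i (X j : PolyRing k n) = X j := refl_X_distant h
  have hji : refl k j (X i : PolyRing k n) = X i := refl_X_distant h.symm
  have key (a b : Fin n) : refl k a (X b) = X b ∨ refl k a (X b) = X b + X a ∨ b = a := by
    rw [refl_X]; split_ifs <;> simp_all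
  apply MvPolynomial.algHom_ext
  intro l
  rw [AlgHom.comp_apply, AlgHom.comp_apply]
  rcases key i l with h1 | h1 | h1 <;> rcases key j l with h2 | h2 | h2 <;>
    first
    | (subst h1; simp only [hi, hj, hij, hji, map_neg])
    | (subst h2; simp only [hi, hj, hij, hji, map_neg])
    | (simp only [h1, h2, hij, hji, map_add]; try ring)

theorem refl_braid {i j : Fin n} (h : Adjacent i j) (p : PolyRing k n) :
    refl k i (refl k j (refl k i p)) = refl k j (refl k i (refl k j p)) := by
  suffices h : (refl k i).comp ((refl k j).comp (refl k i)) =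
      (refl k j).comp ((refl k i).comp (refl k j)) from congrArg (fun f => f p) h
  have hi := refl_X_self (k := k) i
  have hj := refl_X_self (k := k) j
  have hij : refl k i (X j : PolyRing k n) = X j + X i := refl_X_adjacent h
  have hji : refl k j (X i : PolyRing k n) = X i + X j := refl_X_adjacent h.symm
  apply MvPolynomial.algHom_ext
  intro l
  simp only [AlgHom.comp_apply]
  by_cases h1 : l = i
  · subst h1; simp only [hi, hj, hij, hji, map_add, map_neg]; ring
  by_cases h2 : l = j
  · subst h2; simp only [hi, hj, hij, hji, map_add, map_neg]; ring
  by_cases h3 : Adjacent i l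
  · have hl : refl k i (X l : PolyRing k n) = X l + X i := refl_X_adjacent h3
    have hl' : refl k j (X l : PolyRing k n) = X l := by
      apply refl_X_distant
      simp only [Adjacent, Distant, Fin.ext_iff] at *; omega
    simp only [hi, hj, hij, hji, hl, hl', map_add, map_neg]; ring
  · have hl : refl k i (X l : PolyRing k n) = X l := by rw [refl_X]; simp [h1, h3]
    by_cases h4 : Adjacent j l
    · have hl' : refl k j (X l : PolyRing k n) = X l + X j := refl_X_adjacent h4
      simp only [hi, hj, hij, hji, hl, hl', map_add, map_neg]; ring
    · have hl' : refl k j (X l : PolyRing k n) = X l := by rw [refl_X]; simp [h2, h4]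
      simp only [hl, hl']

theorem demazure_mem_of_distant {i j : Fin n} (h : Distant i j) {q : PolyRing k n}
    (hq : q ∈ invariants k j) : demazure i q ∈ invariants k j := by
  change refl k j (demazure i q) = demazure i q
  symm
  apply demazure_unique
  have := congrArg (refl k j) (X_mul_demazure i q)
  rw [map_mul, refl_X_distant h.symm, map_sub, ← refl_comm h, refl_of_mem hq] at this
  exact this

theorem demazure_demazure_mem {i j : Fin n} (h : Adjacent i j) {q : PolyRing k n}
    (hq : q ∈ invariants k j) : demazure j (demazure i q) ∈ invariants k i := by
  have hi := refl_X_self (k := k) i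
  have hj := refl_X_self (k := k) j
  have hij : refl k i (X j : PolyRing k n) = X j + X i := refl_X_adjacent h
  have hji : refl k j (X i : PolyRing k n) = X i + X j := refl_X_adjacent h.symm
  have h1 := X_mul_demazure i q
  have h2 := X_mul_demazure j (demazure i q)
  have h3 := congrArg (refl k j) h1
  rw [map_mul, hji, map_sub, refl_of_mem hq] at h3
  have hne : (X i + X j : PolyRing k n) ≠ 0 := by
    intro h0
    have := congrArg (refl k i) h0
    rw [map_add, hi, hij, map_zero] at this
    exact X_ne_zero j (by linear_combination this)
  have key : X i * (X i + X j) * X j * demazure j (demazure i q)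
      = X j * q - (X i + X j) * refl k i q + X i * refl k j (refl k i q) := by
    linear_combination X i * (X i + X j) * h2 + (X i + X j) * h1 - X i * h3
  have key2 := congrArg (refl k i) key
  have hb : refl k i (refl k j (refl k i q)) = refl k j (refl k i q) := by
    rw [refl_braid h, refl_of_mem hq]
  simp only [map_add, map_sub, map_mul, hi, hij, hb, refl_refl] at key2
  change refl k i (demazure j (demazure i q)) = demazure j (demazure i q)
  have hne' : (X i * (X i + X j) * X j : PolyRing k n) ≠ 0 :=
    mul_ne_zero (mul_ne_zero (X_ne_zero i) hne) (X_ne_zero j)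
  apply mul_left_cancel₀ hne'
  linear_combination -key2 - key

end basic

/-! ### Induction and restriction -/

/-- For an `R`-module `M`, the `R`-module `B_i ⊗_R M = R ⊗_{R^i} M` (without the grading shift).
All the modules `M` used below are commutative `R`-algebras. -/
def Ind (k : Type u) [Field k] {n : ℕ} (i : Fin n) (M : Type u) [CommRing M]
    [Algebra (PolyRing k n) M] : Type u :=
  PolyRing k n ⊗[invariants k i] M

section induction

variable {k : Type u} [Field k] {n : ℕ}
variable (i j : Fin n) (M : Type u) [CommRing M] [Algebra (PolyRing k n) M]

instance : CommRing (Ind k i M) :=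
  inferInstanceAs (CommRing (PolyRing k n ⊗[invariants k i] M))

instance : Algebra (PolyRing k n) (Ind k i M) :=
  inferInstanceAs (Algebra (PolyRing k n) (PolyRing k n ⊗[invariants k i] M))

variable {M} in
/-- The pure tensor `p ⊗ m`. -/
def Ind.tmul (p : PolyRing k n) (m : M) : Ind k i M := p ⊗ₜ[invariants k i] m

/-- The map `p ↦ p ⊗ 1`. -/
def outer : PolyRing k n →+* Ind k i M := algebraMap (PolyRing k n) (Ind k i M)

variable (k) in
/-- The map `m ↦ 1 ⊗ m`. -/
def inner : M →+* Ind k i M := (Algebra.TensorProduct.includeRight (R := invariants k i)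
  (A := PolyRing k n) (B := M)).toRingHom

variable {M} in
theorem Ind.tmul_eq (p : PolyRing k n) (m : M) : Ind.tmul i p m = outer i M p * inner k i M m := by
  have := Algebra.TensorProduct.tmul_mul_tmul (R := invariants k i) p (1 : PolyRing k n) (1 : M) m
  rw [mul_one, one_mul] at this
  exact this.symm

variable {M} in
theorem Ind.induction {P : Ind k i M → Prop} (zero : P 0)
    (tmul : ∀ p m, P (Ind.tmul i p m)) (add : ∀ x y, P x → P y → P (x + y)) (x : Ind k i M) : P x :=
  TensorProduct.induction_on (R := invariants k i) (M := PolyRing k n) (N := M)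
    (motive := fun x => P x) x zero tmul add

theorem outer_mem {p : PolyRing k n} (h : p ∈ invariants k i) :
    outer i M p = inner k i M (algebraMap _ M p) := by
  have h1 : p = (⟨p, h⟩ : invariants k i) • (1 : PolyRing k n) := (mul_one p).symm
  have h2 : algebraMap (PolyRing k n) M p = (⟨p, h⟩ : invariants k i) • (1 : M) := by
    change _ = p • (1 : M)
    rw [Algebra.smul_def, mul_one]
  change p ⊗ₜ[invariants k i] (1 : M) = (1 : PolyRing k n) ⊗ₜ[invariants k i] _
  rw [h2, ← TensorProduct.smul_tmul, ← h1]

theorem outer_sub_inner [NeZero (2 : k)] (p : PolyRing k n) :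
    outer i M p - inner k i M (algebraMap _ M p) =
      (outer i M (halfRoot k i) - inner k i M (algebraMap _ M (halfRoot k i)))
        * inner k i M (algebraMap _ M (demazure i p)) := by
  have h := average_add_demazure i p
  have h1 := outer_mem i M (average_mem i p)
  have h2 := outer_mem i M (demazure_mem i p)
  conv_lhs => rw [← h]
  simp only [map_add, map_mul, h1, h2]
  ring

/-- The map `c ⊗ m ↦ c m`. -/
def mulInd : Ind k i M →+ M :=
  TensorProduct.liftAddHom (R := invariants k i)
    (AddMonoidHom.mk' (fun c : PolyRing k n => DistribSMul.toAddMonoidHom M c)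
      fun _ _ => AddMonoidHom.ext fun _ => add_smul _ _ _)
    (fun q c m => by
      change (q.1 * c) • m = c • q.1 • m
      rw [mul_comm, mul_smul])

/-- The map `c ⊗ m ↦ (∂_i c) m`. -/
def demInd : Ind k i M →+ M :=
  TensorProduct.liftAddHom (R := invariants k i)
    (AddMonoidHom.mk' (fun c : PolyRing k n => DistribSMul.toAddMonoidHom M (demazure i c))
      fun c c' => AddMonoidHom.ext fun m => by
        change demazure i (c + c') • m = demazure i c • m + demazure i c' • m
        rw [demazure_add, add_smul])
    (fun q c m => by
      change demazure i (q.1 * c) • m = demazure i c • q.1 • m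
      rw [demazure_mul, demazure_of_mem q.2, zero_mul, zero_add, mul_comm, mul_smul])

theorem mulInd_tmul (c : PolyRing k n) (m : M) : mulInd i M (Ind.tmul i c m) = c • m := rfl

theorem demInd_tmul (c : PolyRing k n) (m : M) :
    demInd i M (Ind.tmul i c m) = demazure i c • m := rfl

variable {M} in
/-- A map `b, z ↦ F b z` that is `R^i`-linear in `b` and balanced over `R^j` gives an `R`-linear map
`a ⊗ (b ⊗ z) ↦ a F b z` on `R ⊗_{R^i} (R ⊗_{R^j} M)`. -/
def liftTwo {N : Type u} [CommRing N] [Algebra (PolyRing k n) N] (F : PolyRing k n → M → N)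
    (add_left : ∀ b b' z, F (b + b') z = F b z + F b' z)
    (add_right : ∀ b z z', F b (z + z') = F b z + F b z')
    (smul_left : ∀ p ∈ invariants k i, ∀ b z, F (p * b) z = algebraMap _ N p * F b z)
    (balanced : ∀ q ∈ invariants k j, ∀ b z, F (q * b) z = F b (q • z)) :
    Ind k i (Ind k j M) →ₗ[PolyRing k n] N :=
  let G : Ind k j M →+ N := TensorProduct.liftAddHom (R := invariants k j)
    (AddMonoidHom.mk' (fun b : PolyRing k n => AddMonoidHom.mk' (F b) (add_right b))
      fun b b' => AddMonoidHom.ext fun z => add_left b b' z)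
      (fun q b z => balanced q.1 q.2 b z)
  LinearMap.liftBaseChange (R := invariants k i) (PolyRing k n)
    { toFun := G
      map_add' := G.map_add
      map_smul' := fun p y => by
        induction y using Ind.induction with
        | zero => simp
        | add x y hx hy => rw [smul_add, map_add, map_add, hx, hy, smul_add]
        | tmul b z =>
          change F (p.1 * b) z = p.1 • F b z
          rw [smul_left p.1 p.2, Algebra.smul_def] }

variable {M} in
theorem liftTwo_tmul {N : Type u} [CommRing N] [Algebra (PolyRing k n) N] (F : PolyRing k n → M → N)
    (h1 : ∀ b b' z, F (b + b') z = F b z + F b' z)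
    (h2 : ∀ b z z', F b (z + z') = F b z + F b z')
    (h3 : ∀ p ∈ invariants k i, ∀ b z, F (p * b) z = algebraMap _ N p * F b z)
    (h4 : ∀ q ∈ invariants k j, ∀ b z, F (q * b) z = F b (q • z))
    (a b : PolyRing k n) (z : M) :
    liftTwo i j F h1 h2 h3 h4 (Ind.tmul i a (Ind.tmul j b z)) = a • F b z := rfl

variable {M} in
/-- The map `a ⊗ m ↦ a ⊗ f m`. -/
def Ind.map {N : Type u} [CommRing N] [Algebra (PolyRing k n) N] (f : M →ₗ[PolyRing k n] N) :
    Ind k i M →ₗ[PolyRing k n] Ind k i N :=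
  TensorProduct.AlgebraTensorModule.lTensor (R := invariants k i) (PolyRing k n) (PolyRing k n)
    (f.restrictScalars (invariants k i))

variable {M} in
theorem Ind.map_tmul {N : Type u} [CommRing N] [Algebra (PolyRing k n) N]
    (f : M →ₗ[PolyRing k n] N) (a : PolyRing k n) (m : M) :
    Ind.map i f (Ind.tmul i a m) = Ind.tmul i a (f m) := rfl

end induction

/-! ### The four-valent vertex -/

section fourValent

variable {k : Type u} [Field k] {n : ℕ}
variable (i j : Fin n) (M : Type u) [CommRing M] [Algebra (PolyRing k n) M]

/-- The image of `1 ⊗ b ⊗ m` under the four-valent vertex: write `b` as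
`average i b + (f_i / 2) * demazure i b`, move the invariants `average i b` and `demazure i b` to
the left, and move the factor `f_i / 2`, which is invariant under `s_j`, to the right. -/
def fourTerm (b : PolyRing k n) (m : M) : Ind k j (Ind k i M) :=
  Ind.tmul j (average i b) (Ind.tmul i 1 m) +
    Ind.tmul j (demazure i b) (Ind.tmul i 1 (halfRoot k i • m))

theorem fourTerm_eq (b : PolyRing k n) (m : M) : fourTerm i j M b m =
    outer j _ (average i b) * inner k j _ (inner k i M m) +
    outer j _ (demazure i b) * inner k j _ (inner k i M (algebraMap _ M (halfRoot k i) * m)) := by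
  simp only [fourTerm, Ind.tmul_eq, map_one, one_mul, Algebra.smul_def]

variable {i j}

theorem fourTerm_balanced [NeZero (2 : k)] (h : Distant i j) {q : PolyRing k n}
    (hq : q ∈ invariants k j) (b : PolyRing k n) (m : M) :
    fourTerm i j M (q * b) m = fourTerm i j M b (q • m) := by
  have hh : halfRoot k i ∈ invariants k j := halfRoot_distant_mem h.symm
  have hD := demazure_mem_of_distant h hq
  have hA : average i q ∈ invariants k j := by
    rw [average_eq]; exact sub_mem hq (mul_mem hh hD)
  have A0 := outer_mem j (Ind k i M) hA
  have D0 := outer_mem j (Ind k i M) hD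
  have H0 := outer_mem j (Ind k i M) (pow_mem hh 2)
  have A1 := outer_mem i M (average_mem i q)
  have D1 := outer_mem i M (demazure_mem i q)
  have H1 := outer_mem i M (halfRoot_sq_mem (k := k) i)
  have hq1 := average_add_demazure i q
  have e1 : average i (q * b) = average i q * average i b
      + halfRoot k i ^ 2 * demazure i q * demazure i b := by
    rw [average_eq i (q * b), demazure_mul, refl_eq, X_eq, average_eq i b, average_eq i q]; ring
  have e2 : demazure i (q * b) = average i q * demazure i b + demazure i q * average i b := by
    rw [demazure_mul, refl_eq, X_eq, average_eq i b, average_eq i q]; ring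
  have hmap (p : PolyRing k n) : algebraMap (PolyRing k n) (Ind k i M) p = outer i M p := rfl
  rw [hmap] at A0 D0 H0
  rw [A1] at A0
  rw [D1] at D0
  rw [H1] at H0
  rw [fourTerm_eq, fourTerm_eq, Algebra.smul_def, e1, e2]
  conv_rhs => rw [← hq1]
  simp only [map_add, map_mul, A0, D0, map_pow] at H0 ⊢
  rw [H0]
  ring

/-- The four-valent vertex `B_i ⊗ B_j → B_j ⊗ B_i` for distant `i` and `j`, tensored on the right
with `M`. It sends `1 ⊗ 1 ⊗ m` to `1 ⊗ 1 ⊗ m`. -/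
def fourValent [NeZero (2 : k)] (h : Distant i j) :
    Ind k i (Ind k j M) →ₗ[PolyRing k n] Ind k j (Ind k i M) :=
  liftTwo i j (fourTerm i j M)
    (fun b b' z => by simp only [fourTerm_eq, average_add, demazure_add, map_add]; ring)
    (fun b z z' => by simp only [fourTerm_eq, mul_add, map_add]; ring)
    (fun p hp b z => by
      have h1 : demazure i (p * b) = p * demazure i b := by
        rw [demazure_mul, demazure_of_mem hp]; ring
      have h2 : average i (p * b) = p * average i b := by
        rw [average_eq, average_eq, h1]; ring
      have h3 : algebraMap (PolyRing k n) (Ind k j (Ind k i M)) p = outer j _ p := rfl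
      rw [fourTerm_eq, fourTerm_eq, h1, h2, map_mul, map_mul, h3]; ring)
    (fun _ hq => fourTerm_balanced M h hq)

theorem fourValent_tmul [NeZero (2 : k)] (h : Distant i j) (a b : PolyRing k n) (m : M) :
    fourValent M h (Ind.tmul i a (Ind.tmul j b m)) = a • fourTerm i j M b m := by
  rw [fourValent, liftTwo_tmul]

theorem fourValent_one [NeZero (2 : k)] (h : Distant i j) (m : M) :
    fourValent (k := k) M h (Ind.tmul i 1 (Ind.tmul j 1 m)) = Ind.tmul j 1 (Ind.tmul i 1 m) := by
  have h1 : demazure i (1 : PolyRing k n) = 0 := demazure_of_mem (one_mem _)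
  have h2 : average i (1 : PolyRing k n) = 1 := by rw [average_eq, h1]; ring
  rw [fourValent_tmul, fourTerm_eq, h1, h2, one_smul]
  simp only [Ind.tmul_eq, map_one, map_zero, one_mul, zero_mul, add_zero]

end fourValent

/-! ### The six-valent vertex -/

theorem slot_identities {N : Type*} [CommRing N] (a0 a1 a2 a3 b0 b1 b2 b3 q0 q3 p0 p1 p3 D δ g : N)
    (hδ : δ = a1 - a2) (hg : g = 2 * a3 + 2 * b3)
    (h1 : 2*a0+b0=2*a1+b1) (h2 : b0^2=b1^2) (h3 : 2*b1+a1=2*b2+a2) (h4 : a1^2=a2^2)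
    (h5 : 2*a2+b2=2*a3+b3) (h6: b2^2=b3^2)
    (hq : q0 - q3 = (a1-a2)*p1) (hp : p0-p1=(b0-b1)*D) (hp' : p1-p3=(b2-b3)*D) :
    q0 * (δ + g) = (δ + g) * q3 + δ * (δ + g) * p3 ∧
    q0 * (δ * (δ + g)) = δ * (δ + g) * (q3 - 2 * a3 * p3) ∧
    p0 * (δ + g) + (q0 - 2 * a0 * p0) = q3 + (2 * δ - 2 * a0 + g) * p3 ∧
    p0 * (δ * (δ + g)) + (q0 - 2 * a0 * p0) * (2 * δ - 2 * a0 + g)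
      = (2 * δ - 2 * a0 + g) * (q3 - 2 * a3 * p3) := by
  subst hδ hg
  have k1 : (a1-a2)*(a1-a2+(2*a3+2*b3))*(b2-b3) = 0 := by
    linear_combination (b2-b3)*h4 + (a1-a2)*h6 - (a1-a2)*(b2-b3)*h5
  have k2 : (a1-a2)*(a1-a2+(2*a3+2*b3))*(a1-a2+2*a3) = 0 := by
    linear_combination (a1+a2+2*b2)*h4 + (a1-a2)*h6
      - (a1-a2)*(a1-a2+(2*a3+2*b3) + a1+a2+b2-b3)*h5
  have k3 : (b0-b1+b2-b3)*(2*(a1-a2)-2*a0+(2*a3+2*b3)) = (a1-a2)*(b0-b1) := by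
    linear_combination h6 + h2 - (b0-b1+b2-b3)*h5 - (b0-b1+b2-b3)*h1 - (b0-b1)*h3
  have k4 : (a1-a2)*(a1-a2+(2*a3+2*b3)) + (2*(a1-a2)-2*a0+(2*a3+2*b3))*(a1-a2-2*a0+2*a3) = 0 := by
    linear_combination k3 + h4 + (a1-a2)*h1 + (2*(a1-a2)-2*a0+(2*a3+2*b3))*(-h1-h5)
  have k5 : (a1-a2)*(a1-a2+(2*a3+2*b3))*(b0-b1+b2-b3)
      + (2*(a1-a2)-2*a0+(2*a3+2*b3))*((a1-a2)*(b2-b3)-2*a0*(b0-b1+b2-b3)) = 0 := by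
    linear_combination k1 - 2*a0*k3 + (a1-a2)*h6 + (a1-a2)*h2 - (a1-a2)*(b0-b1)*h5
      - (a1-a2)*(b2-b3)*(h5+h1) - (a1-a2)*(b0-b1)*h1 - (a1-a2)*(b0-b1)*h3
  refine ⟨?_, ?_, ?_, ?_⟩
  · linear_combination (a1-a2+(2*a3+2*b3))*hq + (a1-a2+(2*a3+2*b3))*(a1-a2)*hp' + D*k1
  · linear_combination (a1-a2)*(a1-a2+(2*a3+2*b3))*(hq+(a1-a2)*hp') + p3*k2 + (a1-a2)*D*k1
  · linear_combination hq + D*k3 + (2*(a1-a2)-2*a0+(2*a3+2*b3))*(hp+hp') - (a1-a2)*hp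
  · linear_combination (2*(a1-a2)-2*a0+(2*a3+2*b3))*hq + p3*k4 + D*k5
      + (2*(a1-a2)-2*a0+(2*a3+2*b3))*((a1-a2)*hp' - 2*a0*(hp+hp'))
      + (a1-a2)*(a1-a2+(2*a3+2*b3))*(hp+hp')

section sixValent

variable {k : Type u} [Field k] {n : ℕ}
variable (i j : Fin n) (M : Type u) [CommRing M] [Algebra (PolyRing k n) M]

/-- The first slot of `B_j ⊗ B_i ⊗ B_j ⊗_R M = R ⊗_{R^j} R ⊗_{R^i} R ⊗_{R^j} M`. -/
def slot₀ : PolyRing k n →+* Ind k j (Ind k i (Ind k j M)) := outer j _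

/-- The second slot of `R ⊗_{R^j} R ⊗_{R^i} R ⊗_{R^j} M`. -/
def slot₁ : PolyRing k n →+* Ind k j (Ind k i (Ind k j M)) := (inner k j _).comp (outer i _)

/-- The third slot of `R ⊗_{R^j} R ⊗_{R^i} R ⊗_{R^j} M`. -/
def slot₂ : PolyRing k n →+* Ind k j (Ind k i (Ind k j M)) :=
  (inner k j _).comp ((inner k i _).comp (outer j _))

/-- The last slot of `R ⊗_{R^j} R ⊗_{R^i} R ⊗_{R^j} M`. -/
def slot₃ : M →+* Ind k j (Ind k i (Ind k j M)) :=
  (inner k j _).comp ((inner k i _).comp (inner k j _))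

/-- The element `δ = 1 ⊗ (f_i / 2) ⊗ 1 ⊗ 1 - 1 ⊗ 1 ⊗ (f_i / 2) ⊗ 1`. For `i = 1` and `j = 2`, with
`f_1 = x_1 - x_2` and `f_2 = x_2 - x_3`, it is the difference of the elements `x_1` in the first and
in the last slot. -/
def sixDelta : Ind k j (Ind k i (Ind k j M)) :=
  slot₁ i j M (halfRoot k i) - slot₂ i j M (halfRoot k i)

/-- The element `γ = 1 ⊗ 1 ⊗ 1 ⊗ (f_i + f_j)`. -/
def sixGamma : Ind k j (Ind k i (Ind k j M)) := slot₃ i j M (algebraMap (PolyRing k n) M (X i + X j))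

/-- The image of `1 ⊗ b ⊗ c ⊗ m`, where `z = c ⊗ m`, under the six-valent vertex.

In the coordinates `x` of the first and `y` of the last slot (for `i = 1` and `j = 2`) this is
`m * ∂_i^x ∂_i^y (b(x) c(y) (x_1 - y_2) (x_1 - y_3))`, where `∂_i^x` and `∂_i^y` are the Demazure
operators in the two sets of coordinates, `(x_1 - y_2) (x_1 - y_3)` is the comultiplication element
of `R^j ⊗_{R^J} R^j` for `J = {i, j}`, and the result is mapped from `B_J = R ⊗_{R^J} R` to
`B_j ⊗ B_i ⊗ B_j`. The formula below is the expansion by the Leibniz rule, where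
`δ = x_1 - y_1` and `δ + γ = x_1 - y_3`. -/
def sixTerm (b : PolyRing k n) (z : Ind k i M) : Ind k j (Ind k i (Ind k j M)) :=
  slot₀ i j M (demazure i b) *
      ((sixDelta i j M + sixGamma i j M) * slot₃ i j M (mulInd i M z) +
        sixDelta i j M * (sixDelta i j M + sixGamma i j M) * slot₃ i j M (demInd i M z)) +
    slot₀ i j M (refl k i b) *
      (slot₃ i j M (mulInd i M z) +
        (2 * sixDelta i j M - slot₀ i j M (X i : PolyRing k n) + sixGamma i j M) * slot₃ i j M (demInd i M z))

theorem sixTerm_add_right (b : PolyRing k n) (z z' : Ind k i M) :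
    sixTerm i j M b (z + z') = sixTerm i j M b z + sixTerm i j M b z' := by
  simp only [sixTerm, map_add]; ring

variable {i j}

theorem sixTerm_balanced [NeZero (2 : k)] (h : Adjacent i j) {q : PolyRing k n}
    (hq : q ∈ invariants k j) (b : PolyRing k n) (z : Ind k i M) :
    sixTerm i j M (q * b) z = sixTerm i j M b (q • z) := by
  induction z using Ind.induction with
  | zero => rw [smul_zero]; simp [sixTerm]
  | add x y hx hy => rw [smul_add, sixTerm_add_right, sixTerm_add_right, hx, hy]
  | tmul c m =>
    have e2 : q • Ind.tmul i c m = Ind.tmul i (q * c) m := by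
      rw [Algebra.smul_def, Ind.tmul_eq, Ind.tmul_eq, map_mul, mul_assoc]; rfl
    rw [e2]
    have c01 {p : PolyRing k n} (hp : p ∈ invariants k j) : slot₀ i j M p = slot₁ i j M p :=
      outer_mem j (Ind k i (Ind k j M)) hp
    have c12 {p : PolyRing k n} (hp : p ∈ invariants k i) : slot₁ i j M p = slot₂ i j M p :=
      congrArg (inner k j _) (outer_mem i (Ind k j M) hp)
    have c23 {p : PolyRing k n} (hp : p ∈ invariants k j) :
        slot₂ i j M p = slot₃ i j M (algebraMap _ M p) :=
      congrArg (fun x => inner k j _ (inner k i _ x)) (outer_mem j M hp)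
    have d01 (p : PolyRing k n) : slot₀ i j M p - slot₁ i j M p =
        (slot₀ i j M (halfRoot k j) - slot₁ i j M (halfRoot k j)) * slot₁ i j M (demazure j p) :=
      outer_sub_inner j (Ind k i (Ind k j M)) p
    have d12 (p : PolyRing k n) : slot₁ i j M p - slot₂ i j M p =
        (slot₁ i j M (halfRoot k i) - slot₂ i j M (halfRoot k i)) * slot₂ i j M (demazure i p) := by
      have := congrArg (inner k j _) (outer_sub_inner i (Ind k j M) p)
      rw [map_sub, map_mul, map_sub] at this
      exact this
    have d23 (p : PolyRing k n) : slot₂ i j M p - slot₃ i j M (algebraMap _ M p) =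
        (slot₂ i j M (halfRoot k j) - slot₃ i j M (algebraMap _ M (halfRoot k j))) *
          slot₃ i j M (algebraMap _ M (demazure j p)) := by
      have := congrArg (fun x => inner k j _ (inner k i _ x)) (outer_sub_inner j M p)
      simp only [map_sub, map_mul] at this
      exact this
    have hD := demazure_demazure_mem h hq
    have hDj := demazure_mem j (demazure i q)
    have r1 := c01 (halfRoot_adjacent_mem (k := k) h.symm)
    have r2 := c01 (halfRoot_sq_mem (k := k) j)
    have r3 := c12 (halfRoot_adjacent_mem (k := k) h)
    have r4 := c12 (halfRoot_sq_mem (k := k) i)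
    have r5 := c23 (halfRoot_adjacent_mem (k := k) h.symm)
    have r6 := c23 (halfRoot_sq_mem (k := k) j)
    have r7 := d12 q
    rw [← c01 hq, c23 hq, ← c12 (demazure_mem i q)] at r7
    have r8 := d01 (demazure i q)
    have r9 := d23 (demazure i q)
    rw [← c23 hDj, ← c12 hD, ← c12 (demazure_mem i q)] at r9
    simp only [map_add, map_mul, map_pow, map_ofNat] at r1 r2 r3 r4 r5 r6
    obtain ⟨k1, k2, k3, k4⟩ := slot_identities _ _ _ _ _ _ _ _ _ _ _ _ _ _
      (sixDelta i j M) (sixGamma i j M) rfl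
      (by rw [sixGamma, X_eq i, X_eq j]; simp only [map_add, map_mul, map_ofNat])
      r1 r2 r3 r4 r5 r6 r7 r8 r9
    simp only [sixTerm, mulInd_tmul, demInd_tmul, Algebra.smul_def]
    rw [demazure_mul, demazure_mul, refl_eq i (q * b), refl_eq i b, refl_eq i c,
      demazure_mul, refl_eq i b, X_eq i]
    simp only [map_add, map_sub, map_mul, map_ofNat]
    generalize sixDelta (k := k) i j M = δ at *
    generalize sixGamma (k := k) i j M = g at *
    generalize slot₀ (k := k) i j M (demazure i b) = B' at *
    generalize slot₀ (k := k) i j M b = B at *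
    generalize slot₃ (k := k) i j M (algebraMap (PolyRing k n) M (demazure i c)) = c' at *
    generalize slot₃ (k := k) i j M (algebraMap (PolyRing k n) M c) = c at *
    generalize slot₃ (k := k) i j M m = m at *
    linear_combination B' * c * m * k1 + B' * c' * m * k2
      + (B - 2 * slot₀ i j M (halfRoot k i) * B') * m * (c * k3 + c' * k4)

/-- The six-valent vertex `B_i ⊗ B_j ⊗ B_i → B_j ⊗ B_i ⊗ B_j` for adjacent `i` and `j`, tensored
on the right with `M`: the projection of `B_i ⊗ B_j ⊗ B_i` to `B_J`, where `J = {i, j}`, followed by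
the inclusion of `B_J` in `B_j ⊗ B_i ⊗ B_j`. -/
def sixValent [NeZero (2 : k)] (h : Adjacent i j) :
    Ind k i (Ind k j (Ind k i M)) →ₗ[PolyRing k n] Ind k j (Ind k i (Ind k j M)) :=
  liftTwo i j (sixTerm i j M)
    (fun b b' z => by simp only [sixTerm, demazure_add, map_add]; ring)
    (sixTerm_add_right i j M)
    (fun p hp b z => by
      have h1 : demazure i (p * b) = p * demazure i b := by
        rw [demazure_mul, demazure_of_mem hp]; ring
      have h2 : algebraMap (PolyRing k n) (Ind k j (Ind k i (Ind k j M))) p = slot₀ i j M p := rfl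
      rw [sixTerm, sixTerm, h1, map_mul (refl k i), refl_of_mem hp, map_mul, map_mul, h2]; ring)
    (fun _ hq => sixTerm_balanced M h hq)

theorem sixValent_tmul [NeZero (2 : k)] (h : Adjacent i j) (a b c : PolyRing k n) (m : M) :
    sixValent M h (Ind.tmul i a (Ind.tmul j b (Ind.tmul i c m))) =
      a • sixTerm i j M b (Ind.tmul i c m) := by
  rw [sixValent, liftTwo_tmul]

theorem sixValent_one [NeZero (2 : k)] (h : Adjacent i j) (m : M) :
    sixValent (k := k) M h (Ind.tmul i 1 (Ind.tmul j 1 (Ind.tmul i 1 m))) =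
      Ind.tmul j 1 (Ind.tmul i 1 (Ind.tmul j 1 m)) := by
  have h1 : demazure i (1 : PolyRing k n) = 0 := demazure_of_mem (one_mem _)
  rw [sixValent_tmul, sixTerm, mulInd_tmul, demInd_tmul, h1]
  simp only [map_zero, map_one, one_smul, zero_smul, zero_mul, mul_zero, add_zero, zero_add,
    one_mul, Ind.tmul_eq]
  rfl

end sixValent

/-! ### Bott-Samelson bimodules and path morphisms -/

section bottSamelson

variable (k : Type u) [Field k] {n : ℕ}

/-- The Bott-Samelson bimodule `B_{i_1} ⊗_R ⋯ ⊗_R B_{i_d} = R ⊗_{R^{i_1}} R ⊗ ⋯ ⊗_{R^{i_d}} R`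
(without the grading shift) of a word `i_1 ⋯ i_d`. It is a commutative algebra over its first
factor `R`, which gives the left action of `R`. -/
def BS : List (Fin n) → CommAlgCat.{u} (PolyRing k n)
  | [] => CommAlgCat.of _ (PolyRing k n)
  | i :: w => CommAlgCat.of _ (Ind k i (BS w))

/-- The inclusion of `R` in `BS k w` as the last tensor factor. The right action of `R` on `BS k w`
is the multiplication by these elements. -/
def BS.right : (w : List (Fin n)) → PolyRing k n →+* BS k w
  | [] => RingHom.id (PolyRing k n)
  | i :: w => (inner k i (BS k w)).comp (BS.right w)

variable {k}

/-- Tensoring a map with the identity of `B_{i_1} ⊗ ⋯ ⊗ B_{i_d}` on the left. -/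
def whiskerLeft {x y : List (Fin n)} (f : BS k x →ₗ[PolyRing k n] BS k y) :
    (u : List (Fin n)) → BS k (u ++ x) →ₗ[PolyRing k n] BS k (u ++ y)
  | [] => f
  | i :: u =>
    (Ind.map i (whiskerLeft f u) :
      Ind k i (BS k (u ++ x)) →ₗ[PolyRing k n] Ind k i (BS k (u ++ y)))

end bottSamelson

/-- An edge of the expanded expression graph: the application of a relation `s_i s_j = s_j s_i` for
distant `i` and `j`, or of a relation `s_i s_j s_i = s_j s_i s_j` for adjacent `i` and `j`. -/
inductive Edge {n : ℕ} : List (Fin n) → List (Fin n) → Type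
  | distant (u v : List (Fin n)) (i j : Fin n) (h : Distant i j) :
      Edge (u ++ i :: j :: v) (u ++ j :: i :: v)
  | adjacent (u v : List (Fin n)) (i j : Fin n) (h : Adjacent i j) :
      Edge (u ++ i :: j :: i :: v) (u ++ j :: i :: j :: v)

namespace Edge

variable {n : ℕ}

/-- The same edge, followed backwards. -/
def reverse {x y : List (Fin n)} : Edge x y → Edge y x
  | distant u v i j h => distant u v j i h.symm
  | adjacent u v i j h => adjacent u v j i h.symm

/-- Adjacent edges are oriented from `i, i+1, i` to `i+1, i, i+1`; distant edges may be followed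
freely. -/
def IsOriented {x y : List (Fin n)} : Edge x y → Prop
  | distant _ _ _ _ _ => True
  | adjacent _ _ i j _ => i < j

/-- The four-valent vertex of a distant edge, and the six-valent vertex of an adjacent edge. -/
def mor (k : Type u) [Field k] [NeZero (2 : k)] {x y : List (Fin n)} :
    Edge x y → (BS k x →ₗ[PolyRing k n] BS k y)
  | distant u v i j h =>
    whiskerLeft (x := i :: j :: v) (y := j :: i :: v) (fourValent (BS k v) h) u
  | adjacent u v i j h =>
    whiskerLeft (x := i :: j :: i :: v) (y := j :: i :: j :: v) (sixValent (BS k v) h) u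

end Edge

/-- Paths in the expanded expression graph. -/
inductive Path {n : ℕ} : List (Fin n) → List (Fin n) → Type
  | nil (x : List (Fin n)) : Path x x
  | cons {x y z : List (Fin n)} (e : Edge x y) (p : Path y z) : Path x z

namespace Path

variable {n : ℕ}

/-- Concatenation of paths, `p` first. -/
def append {x y z : List (Fin n)} : Path x y → Path y z → Path x z
  | nil _, q => q
  | cons e p, q => cons e (p.append q)

/-- The path followed backwards. -/
def reverse {x y : List (Fin n)} : Path x y → Path y x
  | nil x => nil x
  | cons e p => p.reverse.append (cons e.reverse (nil _))

/-- Oriented paths. -/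
def IsOriented {x y : List (Fin n)} : Path x y → Prop
  | nil _ => True
  | cons e p => e.IsOriented ∧ p.IsOriented

/-- The path morphism. -/
def mor (k : Type u) [Field k] [NeZero (2 : k)] {x y : List (Fin n)} :
    Path x y → (BS k x →ₗ[PolyRing k n] BS k y)
  | nil _ => LinearMap.id
  | cons e p => p.mor k ∘ₗ e.mor k

end Path

/-! ### Reduced expressions of the longest element -/

section reduced

variable {n : ℕ}

/-- The simple reflection `s_i` in the symmetric group `S_{n+1}`. -/
def simple (i : Fin n) : Equiv.Perm (Fin (n + 1)) := Equiv.swap i.castSucc i.succ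

/-- The product of the simple reflections of a word. -/
def wordProd (x : List (Fin n)) : Equiv.Perm (Fin (n + 1)) := (x.map simple).prod

/-- The length of an element of `S_{n+1}`. -/
def len (w : Equiv.Perm (Fin (n + 1))) : ℕ :=
  sInf {l | ∃ x : List (Fin n), wordProd x = w ∧ x.length = l}

/-- `x` is a reduced expression of `w`, that is, a vertex of the expanded expression graph. -/
def IsReducedExpr (w : Equiv.Perm (Fin (n + 1))) (x : List (Fin n)) : Prop :=
  wordProd x = w ∧ x.length = len w

/-- `w` is the longest element of the parabolic subgroup `W_J`. -/
def IsLongest (J : Set (Fin n)) (w : Equiv.Perm (Fin (n + 1))) : Prop :=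
  w ∈ Subgroup.closure (simple '' J) ∧ ∀ v ∈ Subgroup.closure (simple '' J), len v ≤ len w

/-- Two words are related if they are connected by distant edges. The vertices of the conflated
expression graph are the classes of reduced expressions for this relation. -/
def DistantRel : List (Fin n) → List (Fin n) → Prop :=
  Relation.ReflTransGen fun x y =>
    ∃ (u v : List (Fin n)) (i j : Fin n), Distant i j ∧
      x = u ++ i :: j :: v ∧ y = u ++ j :: i :: v

/-- There is an oriented adjacent edge from `x` to `y`. -/
def Up (x y : List (Fin n)) : Prop :=
  ∃ (u v : List (Fin n)) (i j : Fin n), i.val + 1 = j.val ∧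
    x = u ++ i :: j :: i :: v ∧ y = u ++ j :: i :: j :: v

/-- `s` represents a source of the conflated expression graph of `w`. -/
def IsSource (w : Equiv.Perm (Fin (n + 1))) (s : List (Fin n)) : Prop :=
  IsReducedExpr w s ∧ ∀ y, DistantRel s y → ∀ z, ¬ Up z y

/-- `t` represents a sink of the conflated expression graph of `w`. -/
def IsSink (w : Equiv.Perm (Fin (n + 1))) (t : List (Fin n)) : Prop :=
  IsReducedExpr w t ∧ ∀ y, DistantRel t y → ∀ z, ¬ Up y z

end reduced

/-! ### The path `V_J` -/

/-- The word `a, a+1, ..., e-1`. -/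
def asc (a e : ℕ) : List ℕ := List.range' a (e - a)

/-- The word `e-1, ..., a+1, a`. -/
def desc (a e : ℕ) : List ℕ := (asc a e).reverse

/-- The default representative of the source for `J = {a, ..., e-1}`; for example `1 21 321 4321`. -/
def sourceWord (a e : ℕ) : List ℕ := (asc a e).flatMap fun c => desc a (c + 1)

/-- The default representative of the sink for `J = {a, ..., e-1}`; for example `4 34 234 1234`. -/
def sinkWord (a e : ℕ) : List ℕ := (desc a e).flatMap fun c => asc c e

/-- The vertex reached after `m` adjacent edges, `m ≤ j - i`, on the flip path
`i ⋯ (j-1) j (j-1) ⋯ i ↘ j ⋯ (i+1) i (i+1) ⋯ j`; for example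
`1234321`, `4 12321 4`, `43 121 34`, `432 1 234`. -/
def flipVertex (i j m : ℕ) : List ℕ :=
  desc (j - m + 1) (j + 1) ++ asc i (j - m + 1) ++ desc i (j - m) ++ asc (j - m + 1) (j + 1)

/-- The vertices on the path `V_J` from the source to the sink for `J = {a, ..., e-1}`, one word for
each vertex of the conflated expression graph. For `J = {a, ..., e}` the path first follows the path
for `K = {a, ..., e-1}`, with `e ⋯ (a+1) a` appended on the right, and then a sequence of flips of
decreasing size, from `i ⋯ e ⋯ i` to `e ⋯ i ⋯ e` for `i = a, a+1, ..., e-1`. For example, for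
`J = {1, 2, 3, 4}` the flips are `323 1234321 ↘ 323 4321234 = 3 23432 1234 ↘ 3 43234 1234`, which is
`343 234 1234 ↘ 434 234 1234`. -/
inductive VVertex (a : ℕ) : ℕ → List ℕ → Prop
  | single : VVertex a (a + 1) [a]
  | extend {e : ℕ} {x : List ℕ} (h : VVertex a e x) : VVertex a (e + 1) (x ++ desc a (e + 1))
  | flip {e : ℕ} (i m : ℕ) (hai : a ≤ i) (hie : i < e) (hm : m ≤ e - i) :
      VVertex a (e + 1)
        ((desc (i + 1) e).flatMap (fun c => asc c e) ++ flipVertex i e m ++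
          (desc a i).flatMap (fun c => asc c (e + 1)))

/-- `x` represents a vertex of the conflated expression graph on the path `V_J` for
`J = {a, ..., b}`. -/
def OnV {n : ℕ} (a b : Fin n) (x : List (Fin n)) : Prop :=
  ∃ y : List (Fin n), DistantRel x y ∧ VVertex a.val (b.val + 1) (y.map Fin.val)

/-! ### The projectors -/

section projectors

variable (k : Type u) [Field k] [NeZero (2 : k)] {n : ℕ}

open Classical in
/-- The path morphism `B_x → B_y` of an oriented path `x ↘ y` (zero if there is no such path). -/
def downMor (x y : List (Fin n)) : BS k x →ₗ[PolyRing k n] BS k y :=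
  if h : ∃ p : Path x y, p.IsOriented then h.choose.mor k else 0

open Classical in
/-- The path morphism `B_y → B_x` of a reverse oriented path `y ↗ x`, that is, of an oriented path
`x ↘ y` followed backwards (zero if there is no such path). -/
def upMor (y x : List (Fin n)) : BS k y →ₗ[PolyRing k n] BS k x :=
  if h : ∃ p : Path x y, p.IsOriented then h.choose.reverse.mor k else 0

/-- The path morphism `φ_{x,y}` of the path `x ↘ t ↗ s ↘ y`. -/
def phi (s t x y : List (Fin n)) : BS k x →ₗ[PolyRing k n] BS k y :=
  downMor k s y ∘ₗ upMor k t s ∘ₗ downMor k x t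

/-- The path morphism `ψ_{x,y}` of the path `x ↗ s ↘ t ↗ y`. -/
def psi (s t x y : List (Fin n)) : BS k x →ₗ[PolyRing k n] BS k y :=
  upMor k t y ∘ₗ downMor k s t ∘ₗ upMor k x s

/-- The path morphism `z_J` of an oriented path from the source to the sink. -/
def zMor (s t : List (Fin n)) : BS k s →ₗ[PolyRing k n] BS k t := downMor k s t

/-- The path morphism of the same path, followed backwards. -/
def zBar (s t : List (Fin n)) : BS k t →ₗ[PolyRing k n] BS k s := upMor k t s

/-- The maps `φ x y : B_x → B_y`, for `x` and `y` in `S`, pick out a common direct summand of all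
the bimodules `B_x`: there are an `R`-bimodule `C`, whose right action is given by `ρ`, and maps of
bimodules `inc x : C → B_x` and `pr x : B_x → C` such that `pr x ∘ inc x` is the identity and
`inc y ∘ pr x = φ x y`. -/
def IsCommonSummand {k : Type u} [Field k] (S : Set (List (Fin n)))
    (φ : ∀ x y : List (Fin n), BS k x →ₗ[PolyRing k n] BS k y) : Prop :=
  ∃ (C : Type u) (_ : AddCommGroup C) (_ : Module (PolyRing k n) C)
    (ρ : PolyRing k n →+* Module.End (PolyRing k n) C)
    (inc : ∀ x, C →ₗ[PolyRing k n] BS k x) (pr : ∀ x, BS k x →ₗ[PolyRing k n] C),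
    (∀ x ∈ S, ∀ r c, inc x (ρ r c) = inc x c * BS.right k x r) ∧
    (∀ x ∈ S, ∀ r m, pr x (m * BS.right k x r) = ρ r (pr x m)) ∧
    (∀ x ∈ S, pr x ∘ₗ inc x = LinearMap.id) ∧
    ∀ x ∈ S, ∀ y ∈ S, inc y ∘ₗ pr x = φ x y

end projectors

end Soergel

end

set_option linter.unusedSimpArgs false
set_option linter.unusedSectionVars false

noncomputable section

namespace Soergel

open MvPolynomial TensorProduct

universe u

/-! Each `B_x` is a commutative ring, and iterating `a ⊗ m ↦ a ∂_i(t m)` gives an `R`-linear trace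
on it whose form is nondegenerate (`IsNondegenerate.traceInd`). All vertices are bimodule maps that
send 1 to 1, and the vertices of an edge and of the reversed edge are adjoint for these forms, by
the commutation and braid relations of the Demazure operators (`isAdjoint_fourValent`,
`isAdjoint_sixValent`). So a path and its reverse always give an adjoint pair (`Path.adjointPair`).
For the six-valent vertex the explicit formula is replaced by two facts: `B_i B_j B_i` is generated
as a bimodule by 1 and an element κ (`Ind.ext_adjacent`), and the vertex sends 1 to 1 and κ to 0
(`sixValent_kappa`).

Call a path morphism thin if its image lies in the subbimodule generated by 1. Two thin morphisms
with the same ends are equal (`IsAdjointPair.ext`): their difference pairs to zero with all right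
multiples of 1, because the adjoints agree there, and `f ∘ g = id` on the thin part reduces every
other pairing to this one. Thinness passes to the adjoint (`IsAdjointPair.adjoint_mem`) and to every
path with a thin segment. Hence the whole theorem follows once the oriented paths from a source to a
sink are thin: φ, ψ, `z`, `z̄`, `z z̄ z` and the products of the φ all belong to paths that contain
such a segment or its reverse.

Thinness of `z` comes from an insertion algorithm. A letter meets a list of descending blocks that
end at `c`, `c + 1`, and so on. It is absorbed if it extends the block; otherwise it crosses the
block, unchanged or raised by one, and goes on to the next block. Inserting all letters of `x` is an
oriented path from `x` to a normal form, and its morphism factors through every oriented path out of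
`x` (`Can.path`). The local verification (`Cross.adj`, `Cross.dist`, `Ins.adj`, `Ins.dist`) rests on
naturality, the hexagon of three distant strands and the Zamolodchikov relation
(`zamLeft_eq_zamRight`), which is itself an instance of the uniqueness of thin maps. From a sink,
the insertion path has only distant edges and is invertible, so `z` inherits thinness from the
insertion of the source. For the standard source, thinness is propagated letter by letter
(`IsUnitalRight.map_ind_mem`): the coordinate that generates the slot of the new letter follows its
strand to the far right (`Cross.coord`, `exists_ins_stage`).

Coordinates permuted by the reflections need not exist in `R`, for instance in characteristic 3 with
`n = 2`. The argument therefore runs over a polynomial ring with one more variable, and the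
equalities descend along an injective semilinear map (`BS.adjoin_injective`, `Path.adjoin_mor`).

On the combinatorial side, a list of blocks is determined by its product (`IsBlocks.ext`), so
insertion joins every reduced expression to one and the same sink (`IsLongest.exists_path_sink`).
The diagram automorphism reverses orientations and yields the paths out of the source. -/

theorem Distant.swap {N : ℕ} {i j : Fin N} (h : Distant i j) : Distant j i := Or.symm h

theorem Adjacent.swap {N : ℕ} {i j : Fin N} (h : Adjacent i j) : Adjacent j i := Or.symm h

/-! ### Generators of induced modules -/

section generators

variable {k : Type u} [Field k] {N : ℕ}
variable {M : Type u} [CommRing M] [Algebra (PolyRing k N) M]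
variable {P : Type u} [AddCommGroup P] [Module (PolyRing k N) P]

namespace Ind

theorem smul_tmul (i : Fin N) (r p : PolyRing k N) (m : M) :
    r • tmul i p m = tmul i (r * p) m := by
  rw [Algebra.smul_def, tmul_eq, tmul_eq, map_mul, mul_assoc]; rfl

theorem tmul_add (i : Fin N) (p : PolyRing k N) (m m' : M) :
    tmul i p (m + m') = tmul i p m + tmul i p m' := TensorProduct.tmul_add _ _ _

theorem add_tmul (i : Fin N) (p q : PolyRing k N) (m : M) :
    tmul i (p + q) m = tmul i p m + tmul i q m := TensorProduct.add_tmul _ _ _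

theorem sub_tmul (i : Fin N) (p q : PolyRing k N) (m : M) :
    tmul i (p - q) m = tmul i p m - tmul i q m := TensorProduct.sub_tmul _ _ _

theorem tmul_sub (i : Fin N) (p : PolyRing k N) (m m' : M) :
    tmul i p (m - m') = tmul i p m - tmul i p m' := TensorProduct.tmul_sub _ _ _

theorem tmul_zero (i : Fin N) (p : PolyRing k N) : tmul i p (0 : M) = 0 :=
  TensorProduct.tmul_zero _ _

theorem tmul_eq_smul (i : Fin N) (p : PolyRing k N) (m : M) : tmul i p m = p • tmul i 1 m := by
  rw [smul_tmul, mul_one]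

theorem tmul_mul (i : Fin N) (p : PolyRing k N) {q : PolyRing k N} (hq : q ∈ invariants k i)
    (m : M) : tmul i (p * q) m = tmul i p (q • m) := by
  rw [tmul_eq, tmul_eq, Algebra.smul_def, map_mul, map_mul, outer_mem i M hq, mul_assoc]

theorem tmul_one_smul (i : Fin N) {q : PolyRing k N} (hq : q ∈ invariants k i) (m : M) :
    tmul (k := k) i 1 (q • m) = q • tmul (k := k) i 1 m := by
  rw [← tmul_mul i 1 hq, smul_tmul, mul_comm]

theorem tmul_mul_tmul (i : Fin N) (p q : PolyRing k N) (m m' : M) :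
    tmul i p m * tmul i q m' = tmul i (p * q) (m * m') := by
  simp only [tmul_eq, map_mul]; ring

theorem one_eq (i : Fin N) : (1 : Ind k i M) = tmul i 1 1 := by
  rw [tmul_eq, map_one, map_one, mul_one]

theorem ext {i : Fin N} {f g : Ind k i M →ₗ[PolyRing k N] P}
    (h : ∀ m, f (tmul i 1 m) = g (tmul i 1 m)) : f = g := by
  refine LinearMap.ext fun x => ?_
  induction x using Ind.induction with
  | zero => rw [LinearMap.map_zero, LinearMap.map_zero]
  | tmul p m => rw [tmul_eq_smul, LinearMap.map_smul, LinearMap.map_smul, h]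
  | add x y hx hy => rw [LinearMap.map_add, LinearMap.map_add, hx, hy]

theorem map_id (i : Fin N) : Ind.map i (LinearMap.id : M →ₗ[PolyRing k N] M) = LinearMap.id :=
  ext fun m => map_tmul i _ 1 m

theorem map_comp (i : Fin N) {M' M'' : Type u} [CommRing M'] [Algebra (PolyRing k N) M']
    [CommRing M''] [Algebra (PolyRing k N) M'']
    (f : M →ₗ[PolyRing k N] M') (g : M' →ₗ[PolyRing k N] M'') :
    Ind.map i (g ∘ₗ f) = Ind.map i g ∘ₗ Ind.map i f :=
  ext fun _ => rfl

/-- If `x` is a polynomial with `∂_i x = -1`, then `R` is generated by `1` and `x` over `R^i`. -/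
theorem sub_mem_of_refl {i : Fin N} {x : PolyRing k N} (hx : refl k i x = x + X i)
    (p : PolyRing k N) : p + x * demazure i p ∈ invariants k i := by
  change refl k i (p + x * demazure i p) = p + x * demazure i p
  rw [map_add, map_mul, hx, refl_of_mem (demazure_mem i p), refl_eq]; ring

/-- Every element of `R ⊗_{R^i} M` has the form `1 ⊗ m + x ⊗ m'`. -/
theorem tmul_generators {i : Fin N} {x : PolyRing k N} (hx : refl k i x = x + X i)
    (p : PolyRing k N) (m : M) : tmul i p m =
      tmul i 1 ((p + x * demazure i p) • m) - tmul i x (demazure i p • m) := by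
  rw [← tmul_mul i 1 (sub_mem_of_refl hx p), ← tmul_mul i x (demazure_mem i p), ← sub_tmul]
  congr 1; ring

/-- The splitting with generator `f_i / 2`; it needs no weight, only that 2 is invertible. -/
theorem tmul_generators_half [NeZero (2 : k)] (i : Fin N) (p : PolyRing k N) (m : M) :
    tmul i p m = tmul i 1 (average i p • m) + tmul i (halfRoot k i) (demazure i p • m) := by
  rw [← tmul_mul i 1 (average_mem i p), ← tmul_mul i _ (demazure_mem i p), ← add_tmul, one_mul,
    average_add_demazure]

/-- A version of the generation for the left factor of a pair `1 ⊗ p ⊗ m`. -/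
theorem tmul_tmul_half [NeZero (2 : k)] (i j : Fin N) (p : PolyRing k N) (m : M) :
    tmul (k := k) i 1 (tmul j p m) = average i p • tmul i 1 (tmul j 1 m) +
      demazure i p • tmul i 1 (tmul j (halfRoot k i) m) := by
  rw [← tmul_one_smul i (average_mem i p), ← tmul_one_smul i (demazure_mem i p), ← tmul_add,
    smul_tmul, smul_tmul, ← add_tmul, mul_one, mul_comm (demazure i p), average_add_demazure]

theorem tmul_tmul_generators {i : Fin N} {x : PolyRing k N} (hx : refl k i x = x + X i) (j : Fin N)
    (p : PolyRing k N) (m : M) : tmul (k := k) i 1 (tmul j p m) =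
      (p + x * demazure i p) • tmul i 1 (tmul j 1 m) -
        demazure i p • tmul i 1 (tmul j x m) := by
  rw [← tmul_one_smul i (sub_mem_of_refl hx p), ← tmul_one_smul i (demazure_mem i p), ← tmul_sub,
    smul_tmul, smul_tmul, ← sub_tmul]
  congr 2; ring

/-- The generator `f_i / 2` of `R` over `R^i` is invariant under `s_j`. So the middle slot can be
emptied completely: the `R^i`-part moves to the left and `f_i / 2` to the right. -/
theorem ext_distant [NeZero (2 : k)] {i j : Fin N} (h : Distant i j)
    {f g : Ind k i (Ind k j M) →ₗ[PolyRing k N] P}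
    (hfg : ∀ m, f (tmul i 1 (tmul j 1 m)) = g (tmul i 1 (tmul j 1 m))) : f = g := by
  refine ext fun x => ?_
  induction x using Ind.induction with
  | zero => rw [tmul_zero, LinearMap.map_zero, LinearMap.map_zero]
  | tmul p m =>
    have hj : halfRoot k i ∈ invariants k j := halfRoot_distant_mem h.symm
    have e := tmul_mul j 1 hj m
    rw [one_mul] at e
    rw [tmul_tmul_half, e, LinearMap.map_add, LinearMap.map_add]
    simp only [LinearMap.map_smul, hfg]
  | add x y hx hy => rw [tmul_add, LinearMap.map_add, LinearMap.map_add, hx, hy]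

/-- The generator of the kernel of the six-valent vertex. -/
def kappa (i j : Fin N) (m : M) : Ind k i (Ind k j (Ind k i M)) :=
  tmul (k := k) i 1 (tmul j (halfRoot k j) (tmul i 1 m)) + tmul i 1 (tmul j 1 (tmul i (halfRoot k j) m))

/-- An element `y` that is invariant under `s_i` with `∂_j y = -1`. -/
def IsWeight (i j : Fin N) (y : PolyRing k N) : Prop :=
  refl k i y = y ∧ refl k j y = y + X j

theorem IsWeight.add_mem {i j : Fin N} {y : PolyRing k N} (h : IsWeight i j y) :
    y + (y + X j) ∈ invariants k j := by
  change refl k j (y + (y + X j)) = _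
  rw [map_add, map_add, h.2, refl_X_self, AlgHom.id_apply]; ring

theorem IsWeight.refl_add {i j : Fin N} {y : PolyRing k N} (h : IsWeight i j y)
    (hij : Adjacent i j) : refl k i (y + X j) = (y + X j) + X i := by
  rw [map_add, h.1, refl_X_adjacent hij]; ring

theorem IsWeight.two_add_mem {i j : Fin N} {y : PolyRing k N} (h : IsWeight i j y) :
    2 * y + X j ∈ invariants k j := by
  have := h.add_mem
  rwa [show 2 * y + X j = y + (y + X j) by ring]

/-- Write `y + f_j = (2y + f_j)/2 + f_j/2`. The first summand is invariant under `s_j` and moves to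
the third slot as `y + f_j/2`; the two copies of `f_j/2` form κ, and the `s_i`-invariant `y` moves
on to the last slot. Modulo κ, a coordinate crosses the word. -/
theorem tmul_of_weight_left [NeZero (2 : k)] {i j : Fin N} {y : PolyRing k N} (h : IsWeight i j y)
    (m : M) : tmul (k := k) i 1 (tmul j (y + X j) (tmul i 1 m)) =
      kappa i j m + tmul i 1 (tmul j 1 (tmul i 1 (y • m))) := by
  have hC : C (2⁻¹ : k) * (2 * y + X j) ∈ invariants k j :=
    mul_mem (Subalgebra.algebraMap_mem _ _) h.two_add_mem
  have e : y + X j = 1 * (C (2⁻¹ : k) * (2 * y + X j)) + halfRoot k j := by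
    rw [halfRoot]; linear_combination (-y - X j) * half_spec (k := k) (n := N)
  have e' : C (2⁻¹ : k) * (2 * y + X j) = y + halfRoot k j := by
    rw [halfRoot]; linear_combination y * half_spec (k := k) (n := N)
  rw [e, add_tmul, tmul_mul j 1 hC, e', smul_tmul, mul_one, add_tmul, tmul_add, tmul_add, tmul_add,
    kappa]
  have := tmul_mul i 1 (q := y) h.1 m
  rw [one_mul] at this
  rw [this]
  abel

theorem tmul_of_weight_right [NeZero (2 : k)] {i j : Fin N} {y : PolyRing k N} (h : IsWeight i j y)
    (m : M) : tmul (k := k) i 1 (tmul j 1 (tmul i (y + X j) m)) =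
      kappa i j m + y • tmul i 1 (tmul j 1 (tmul i 1 m)) := by
  have hC : C (2⁻¹ : k) * (2 * y + X j) ∈ invariants k j :=
    mul_mem (Subalgebra.algebraMap_mem _ _) h.two_add_mem
  have e : y + X j = C (2⁻¹ : k) * (2 * y + X j) * 1 + halfRoot k j := by
    rw [halfRoot]; linear_combination (-y - X j) * half_spec (k := k) (n := N)
  have e' : C (2⁻¹ : k) * (2 * y + X j) = y + halfRoot k j := by
    rw [halfRoot]; linear_combination y * half_spec (k := k) (n := N)
  rw [e, add_tmul, ← smul_tmul, tmul_add, ← tmul_mul j 1 hC, one_mul, e', add_tmul, tmul_add,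
    tmul_add, kappa]
  have := tmul_one_smul i (q := y) h.1 (tmul (k := k) j 1 (tmul (k := k) i 1 m))
  rw [smul_tmul, mul_one] at this
  rw [this]
  abel

/-- Since `2y + f_j` is invariant under `s_j` and `y` under `s_i`, one of the two occurrences of `y
+ f_j` can be removed from its slot. This disposes of the only quadratic monomial in the two inner
slots. -/
theorem tmul_of_weight_both {i j : Fin N} {y : PolyRing k N}
    (h : IsWeight i j y) (m : M) : tmul (k := k) i 1 (tmul j (y + X j) (tmul i (y + X j) m)) =
      tmul i 1 (tmul j 1 (tmul i ((y + (y + X j)) * (y + X j)) m)) -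
        y • tmul i 1 (tmul j 1 (tmul i (y + X j) m)) := by
  have e : y + X j = 1 * (y + (y + X j)) - y * 1 := by ring
  conv_lhs =>
    rw [e, sub_tmul, tmul_mul j 1 h.add_mem, tmul_sub, smul_tmul, ← smul_tmul j y,
      tmul_one_smul i h.1, ← e]

/-- Over `R^i` the ring `R` is generated by 1 and `y + f_j`, so the two inner slots need only the
four products of these. The weight relations reduce each product to 1 and κ. -/
theorem ext_adjacent [NeZero (2 : k)] {i j : Fin N} (hij : Adjacent i j) {y : PolyRing k N}
    (h : IsWeight i j y) {f g : Ind k i (Ind k j (Ind k i M)) →ₗ[PolyRing k N] P}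
    (h1 : ∀ m, f (tmul i 1 (tmul j 1 (tmul i 1 m))) = g (tmul i 1 (tmul j 1 (tmul i 1 m))))
    (h2 : ∀ m, f (kappa i j m) = g (kappa i j m)) : f = g := by
  have hx := h.refl_add hij
  have E1 (c : PolyRing k N) (m : M) :
      f (tmul i 1 (tmul j 1 (tmul i c m))) = g (tmul i 1 (tmul j 1 (tmul i c m))) := by
    rw [tmul_generators hx c m, tmul_sub, tmul_sub, tmul_of_weight_right h]
    simp only [LinearMap.map_sub, LinearMap.map_add, LinearMap.map_smul, h1, h2]
  have E2 (c : PolyRing k N) (m : M) :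
      f (tmul i 1 (tmul j (y + X j) (tmul i c m))) =
        g (tmul i 1 (tmul j (y + X j) (tmul i c m))) := by
    rw [tmul_generators hx c m, tmul_sub, tmul_sub, tmul_of_weight_left h, tmul_of_weight_both h]
    simp only [LinearMap.map_sub, LinearMap.map_add, LinearMap.map_smul, h1, h2, E1]
  refine ext fun x => ?_
  induction x using Ind.induction with
  | zero => rw [tmul_zero, LinearMap.map_zero, LinearMap.map_zero]
  | add x y hx hy => rw [tmul_add, LinearMap.map_add, LinearMap.map_add, hx, hy]
  | tmul b x =>
    induction x using Ind.induction with
    | zero => rw [tmul_zero, tmul_zero, LinearMap.map_zero, LinearMap.map_zero]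
    | add x y hx hy =>
      rw [tmul_add, tmul_add, LinearMap.map_add, LinearMap.map_add, hx, hy]
    | tmul c m =>
      rw [tmul_tmul_generators hx, LinearMap.map_sub, LinearMap.map_sub]
      simp only [LinearMap.map_smul, E1, E2]

end Ind

end generators

/-! ### Characterization of the vertices -/

section vertices

open Ind (tmul kappa)

variable {k : Type u} [Field k] [NeZero (2 : k)] {N : ℕ}
variable {M : Type u} [CommRing M] [Algebra (PolyRing k N) M]
variable {M' : Type u} [CommRing M'] [Algebra (PolyRing k N) M']

/-- Together with `sixValent_one` and `Ind.ext_adjacent` this pins down the vertex whenever a weight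
exists, so that relations between vertices can be checked on generators instead of with the explicit
formula. -/
theorem sixValent_kappa {i j : Fin N} (h : Adjacent i j) (m : M) :
    sixValent (k := k) M h (kappa i j m) = 0 := by
  have hd1 : demazure i (1 : PolyRing k N) = 0 := demazure_of_mem (one_mem _)
  have hdj : demazure i (halfRoot k j) = -C (2⁻¹ : k) := by
    apply demazure_unique
    rw [halfRoot, map_mul, refl_X_adjacent h, ← algebraMap_eq, AlgHom.commutes]; ring
  have hsj : refl k i (halfRoot k j) = halfRoot k j + halfRoot k i := by
    rw [refl_eq, hdj, halfRoot, halfRoot]; ring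
  have c01 {p : PolyRing k N} (hp : p ∈ invariants k j) : slot₀ i j M p = slot₁ i j M p :=
    outer_mem j (Ind k i (Ind k j M)) hp
  have c12 {p : PolyRing k N} (hp : p ∈ invariants k i) : slot₁ i j M p = slot₂ i j M p :=
    congrArg (inner k j _) (outer_mem i (Ind k j M) hp)
  have c23 {p : PolyRing k N} (hp : p ∈ invariants k j) :
      slot₂ i j M p = slot₃ i j M (algebraMap _ M p) :=
    congrArg (fun x => inner k j _ (inner k i _ x)) (outer_mem j M hp)
  -- `f_i + f_j/2` is invariant under `s_j`, and `f_j + f_i/2` under `s_i`. These linear relations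
  -- between neighbouring slots suffice here; no quadratic ones are needed.
  have r1 := c01 (halfRoot_adjacent_mem (k := k) h.symm)
  have r3 := c12 (halfRoot_adjacent_mem (k := k) h)
  have r5 := c23 (halfRoot_adjacent_mem (k := k) h.symm)
  simp only [map_add, map_mul, map_ofNat] at r1 r3 r5
  have hC0 : slot₀ i j M (C (2⁻¹ : k)) * 2 = 1 := by
    rw [← map_ofNat (slot₀ i j M) 2, ← map_mul, mul_comm, half_spec, map_one]
  have hC3 : slot₀ i j M (C (2⁻¹ : k)) = slot₃ i j M (algebraMap (PolyRing k N) M (C (2⁻¹ : k))) := by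
    have hm (l : Fin N) : C (2⁻¹ : k) ∈ invariants k l := Subalgebra.algebraMap_mem _ _
    rw [c01 (hm j), c12 (hm i), c23 (hm j)]
  rw [kappa, LinearMap.map_add, sixValent_tmul, sixValent_tmul, sixTerm, sixTerm]
  simp only [mulInd_tmul, demInd_tmul, Algebra.smul_def, hd1, hdj, hsj, sixDelta, sixGamma, X_eq,
    map_add, map_mul, map_neg, map_one, map_zero, map_ofNat, ← hC3]
  generalize slot₀ (k := k) i j M (C (2⁻¹ : k)) = c at *
  generalize slot₃ (k := k) i j M m = m at *
  generalize slot₀ (k := k) i j M (halfRoot k i) = a0 at *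
  generalize slot₀ (k := k) i j M (halfRoot k j) = b0 at *
  generalize slot₁ (k := k) i j M (halfRoot k i) = a1 at *
  generalize slot₁ (k := k) i j M (halfRoot k j) = b1 at *
  generalize slot₂ (k := k) i j M (halfRoot k i) = a2 at *
  generalize slot₂ (k := k) i j M (halfRoot k j) = b2 at *
  generalize slot₃ (k := k) i j M (algebraMap (PolyRing k N) M (halfRoot k i)) = a3 at *
  generalize slot₃ (k := k) i j M (algebraMap (PolyRing k N) M (halfRoot k j)) = b3 at *
  linear_combination m * (r1 + r5 + c * r3 -
    (2 * (a1 - a2) + (2 * a3 + 2 * b3) - a0 + b1 - b2) * hC0)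

variable {P : Type u} [AddCommGroup P] [Module (PolyRing k N) P]

theorem Ind.map_kappa (i j : Fin N) (φ : M →ₗ[PolyRing k N] M') (m : M) :
    Ind.map i (Ind.map j (Ind.map i φ)) (kappa i j m) = kappa i j (φ m) := by
  rw [kappa, LinearMap.map_add]; rfl

theorem Ind.kappa_add (i j : Fin N) (m m' : M) :
    kappa (k := k) i j (m + m') = kappa i j m + kappa i j m' := by
  simp only [kappa, Ind.tmul_add]; abel

theorem Ind.kappa_smul {i j : Fin N} {r : PolyRing k N} (hi : r ∈ invariants k i)
    (hj : r ∈ invariants k j) (m : M) : kappa (k := k) i j (r • m) = r • kappa (k := k) i j m := by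
  simp only [kappa, smul_add, ← Ind.tmul_one_smul i hi, ← Ind.tmul_one_smul j hj]
  rw [Ind.smul_tmul j, mul_comm r, Ind.tmul_mul j _ hj, ← Ind.tmul_one_smul i hi,
    Ind.smul_tmul i r, mul_comm r, Ind.tmul_mul i _ hi]

theorem fourValent_map {i j : Fin N} (h : Distant i j) (φ : M →ₗ[PolyRing k N] M') :
    fourValent M' h ∘ₗ Ind.map i (Ind.map j φ) = Ind.map j (Ind.map i φ) ∘ₗ fourValent M h := by
  refine Ind.ext_distant h fun m => ?_
  simp only [LinearMap.comp_apply, Ind.map_tmul, fourValent_one]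

theorem fourValent_fourValent {i j : Fin N} (h : Distant i j) (h' : Distant j i) :
    fourValent (k := k) M h' ∘ₗ fourValent M h = LinearMap.id := by
  refine Ind.ext_distant h fun m => ?_
  simp only [LinearMap.comp_apply, fourValent_one, LinearMap.id_apply]

theorem fourValent_fourValent_apply {i j : Fin N} (h : Distant i j) (h' : Distant j i)
    (x : Ind k i (Ind k j M)) : fourValent M h' (fourValent M h x) = x :=
  LinearMap.congr_fun (fourValent_fourValent h h') x

/-- For pairwise distant letters `f_c / 2` passes the slots of `a` and `b`, so the triple product is
generated by 1 over the left action and the last factor, and both composites send 1 to 1. -/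
theorem fourValent_hexagon {a b c : Fin N} (hab : Distant a b) (hac : Distant a c)
    (hbc : Distant b c) :
    fourValent (Ind k a M) hbc ∘ₗ Ind.map b (fourValent M hac) ∘ₗ fourValent (Ind k c M) hab =
      Ind.map c (fourValent M hab) ∘ₗ fourValent (Ind k b M) hac ∘ₗ Ind.map a (fourValent M hbc) := by
  have hca : halfRoot k c ∈ invariants k a := halfRoot_distant_mem hac
  have hcb : halfRoot k c ∈ invariants k b := halfRoot_distant_mem hbc
  refine Ind.ext_distant hab fun x => ?_
  induction x using Ind.induction with
  | zero => simp only [Ind.tmul_zero, LinearMap.map_zero]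
  | add x y hx hy => simp only [Ind.tmul_add, LinearMap.map_add, hx, hy]
  | tmul p m =>
    rw [Ind.tmul_generators_half c p m, Ind.tmul_eq_smul c (halfRoot k c)]
    simp only [Ind.tmul_add, Ind.tmul_one_smul b hcb, Ind.tmul_one_smul a hca, LinearMap.map_add,
      LinearMap.map_smul]
    simp only [LinearMap.comp_apply, Ind.map_tmul, fourValent_one]

/-- A map on the right factor preserves both kinds of generators, which the vertex treats uniformly
in `M`. -/
theorem sixValent_map {i j : Fin N} (h : Adjacent i j) {y : PolyRing k N}
    (hy : Ind.IsWeight i j y) (φ : M →ₗ[PolyRing k N] M') :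
    sixValent M' h ∘ₗ Ind.map i (Ind.map j (Ind.map i φ)) =
      Ind.map j (Ind.map i (Ind.map j φ)) ∘ₗ sixValent M h := by
  refine Ind.ext_adjacent h hy (fun m => ?_) fun m => ?_
  · simp only [LinearMap.comp_apply, Ind.map_tmul, sixValent_one]
  · rw [LinearMap.comp_apply, LinearMap.comp_apply, Ind.map_kappa, sixValent_kappa, sixValent_kappa,
      LinearMap.map_zero]

/-- The slot of the distant letter is generated by 1 and `f_a / 2`, which is invariant under `s_i`
and `s_j` and leaves to the left. No generators besides 1 and κ are added. -/
theorem Ind.ext_adjacent_distant {i j a : Fin N} (hij : Adjacent i j) (hi : Distant i a)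
    (hj : Distant j a) {y : PolyRing k N} (h : Ind.IsWeight i j y)
    {f g : Ind k i (Ind k j (Ind k i (Ind k a M))) →ₗ[PolyRing k N] P}
    (h1 : ∀ m, f (tmul i 1 (tmul j 1 (tmul i 1 (tmul a 1 m)))) =
      g (tmul i 1 (tmul j 1 (tmul i 1 (tmul a 1 m)))))
    (h2 : ∀ m, f (kappa i j (tmul a 1 m)) = g (kappa i j (tmul a 1 m))) : f = g := by
  have hai : halfRoot k a ∈ invariants k i := halfRoot_distant_mem hi
  have haj : halfRoot k a ∈ invariants k j := halfRoot_distant_mem hj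
  refine Ind.ext_adjacent hij h (fun m => ?_) fun m => ?_
  · induction m using Ind.induction with
    | zero => simp only [Ind.tmul_zero, LinearMap.map_zero]
    | add x y hx hy => simp only [Ind.tmul_add, LinearMap.map_add, hx, hy]
    | tmul p m =>
      rw [Ind.tmul_generators_half a p m, Ind.tmul_eq_smul a (halfRoot k a)]
      simp only [Ind.tmul_add, Ind.tmul_one_smul i hai, Ind.tmul_one_smul j haj, LinearMap.map_add,
        LinearMap.map_smul, h1]
  · induction m using Ind.induction with
    | zero => simp only [kappa, Ind.tmul_zero, add_zero, LinearMap.map_zero]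
    | add x y hx hy => simp only [Ind.kappa_add, LinearMap.map_add, hx, hy]
    | tmul p m =>
      rw [Ind.tmul_generators_half a p m, Ind.tmul_eq_smul a (halfRoot k a)]
      simp only [Ind.kappa_add, Ind.kappa_smul hai haj, LinearMap.map_add, LinearMap.map_smul, h2]

/-- Moving a strand to the left past three strands. -/
def passLeft {i j a : Fin N} (hi : Distant i a) (hj : Distant j a) :
    Ind k i (Ind k j (Ind k i (Ind k a M))) →ₗ[PolyRing k N]
      Ind k a (Ind k i (Ind k j (Ind k i M))) :=
  fourValent _ hi ∘ₗ Ind.map i (fourValent _ hj) ∘ₗ Ind.map i (Ind.map j (fourValent (k := k) M hi))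

/-- Moving a strand to the right past three strands. -/
def passRight {i j a : Fin N} (hi : Distant a i) (hj : Distant a j) :
    Ind k a (Ind k i (Ind k j (Ind k i M))) →ₗ[PolyRing k N]
      Ind k i (Ind k j (Ind k i (Ind k a M))) :=
  Ind.map i (Ind.map j (fourValent (k := k) M hi)) ∘ₗ Ind.map i (fourValent _ hj) ∘ₗ fourValent _ hi

theorem passLeft_one {i j a : Fin N} (hi : Distant i a) (hj : Distant j a) (m : M) :
    passLeft (k := k) hi hj (tmul i 1 (tmul j 1 (tmul i 1 (tmul a 1 m)))) =
      tmul a 1 (tmul i 1 (tmul j 1 (tmul i 1 m))) := by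
  simp only [passLeft, LinearMap.comp_apply, Ind.map_tmul, fourValent_one]

theorem passLeft_kappa {i j a : Fin N} (hi : Distant i a) (hj : Distant j a) (m : M) :
    passLeft (k := k) hi hj (kappa i j (tmul a 1 m)) = tmul a 1 (kappa i j m) := by
  have hji : halfRoot k j ∈ invariants k a := halfRoot_distant_mem hj.symm
  have e (l : Fin N) (n : M) (hl : Distant l a) : fourValent M hl
      (tmul l (halfRoot k j) (tmul a 1 n)) = tmul a 1 (tmul l (halfRoot k j) n) := by
    rw [Ind.tmul_eq_smul, LinearMap.map_smul, fourValent_one, ← Ind.tmul_one_smul a hji,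
      Ind.smul_tmul, mul_one]
  have e' (n : Ind k i M) : fourValent _ hj
      (tmul j (halfRoot k j) (tmul a 1 n)) = tmul a 1 (tmul j (halfRoot k j) n) := by
    rw [Ind.tmul_eq_smul, LinearMap.map_smul, fourValent_one, ← Ind.tmul_one_smul a hji,
      Ind.smul_tmul, mul_one]
  simp only [passLeft, kappa, LinearMap.map_add, LinearMap.comp_apply, Ind.map_tmul,
    fourValent_one, e, e', Ind.tmul_add]

theorem passRight_passLeft {i j a : Fin N} (hi : Distant i a) (hj : Distant j a) (hi' : Distant a i)
    (hj' : Distant a j) (x : Ind k i (Ind k j (Ind k i (Ind k a M)))) :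
    passRight hi' hj' (passLeft hi hj x) = x := by
  have e1 : Ind.map i (fourValent (k := k) (Ind k i M) hj') ∘ₗ Ind.map i (fourValent (Ind k i M) hj) =
      LinearMap.id := by
    rw [← Ind.map_comp, fourValent_fourValent, Ind.map_id]
  have e2 : Ind.map i (Ind.map j (fourValent (k := k) M hi')) ∘ₗ Ind.map i (Ind.map j (fourValent (k := k) M hi)) =
      LinearMap.id := by
    rw [← Ind.map_comp, ← Ind.map_comp, fourValent_fourValent, Ind.map_id, Ind.map_id]
  have e1' := LinearMap.congr_fun e1
  have e2' := LinearMap.congr_fun e2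
  simp only [LinearMap.comp_apply, LinearMap.id_apply] at e1' e2'
  simp only [passLeft, passRight, LinearMap.comp_apply]
  rw [fourValent_fourValent_apply, e1', e2']

theorem passLeft_passRight {i j a : Fin N} (hi : Distant i a) (hj : Distant j a) (hi' : Distant a i)
    (hj' : Distant a j) (x : Ind k a (Ind k i (Ind k j (Ind k i M)))) :
    passLeft hi hj (passRight hi' hj' x) = x := by
  have e1 : Ind.map i (fourValent (k := k) (Ind k i M) hj) ∘ₗ Ind.map i (fourValent (Ind k i M) hj') =
      LinearMap.id := by
    rw [← Ind.map_comp, fourValent_fourValent, Ind.map_id]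
  have e2 : Ind.map i (Ind.map j (fourValent (k := k) M hi)) ∘ₗ Ind.map i (Ind.map j (fourValent (k := k) M hi')) =
      LinearMap.id := by
    rw [← Ind.map_comp, ← Ind.map_comp, fourValent_fourValent, Ind.map_id, Ind.map_id]
  have e1' := LinearMap.congr_fun e1
  have e2' := LinearMap.congr_fun e2
  simp only [LinearMap.comp_apply, LinearMap.id_apply] at e1' e2'
  simp only [passLeft, passRight, LinearMap.comp_apply]
  rw [e2', e1', fourValent_fourValent_apply]

theorem sixValent_passLeft {i j a : Fin N} (h : Adjacent i j) (hi : Distant i a) (hj : Distant j a)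
    {y : PolyRing k N} (hy : Ind.IsWeight i j y) :
    passLeft hj hi ∘ₗ sixValent (Ind k a M) h = Ind.map a (sixValent M h) ∘ₗ passLeft hi hj := by
  refine Ind.ext_adjacent_distant h hi hj hy (fun m => ?_) fun m => ?_
  · rw [LinearMap.comp_apply, LinearMap.comp_apply, sixValent_one, passLeft_one, passLeft_one,
      Ind.map_tmul, sixValent_one]
  · rw [LinearMap.comp_apply, LinearMap.comp_apply, sixValent_kappa, passLeft_kappa, Ind.map_tmul,
      sixValent_kappa, LinearMap.map_zero, Ind.tmul_zero]

theorem sixValent_passRight {i j a : Fin N} (h : Adjacent i j) (hi : Distant a i) (hj : Distant a j)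
    {y : PolyRing k N} (hy : Ind.IsWeight i j y) :
    passRight hj hi ∘ₗ Ind.map a (sixValent M h) = sixValent (Ind k a M) h ∘ₗ passRight hi hj := by
  refine LinearMap.ext fun x => ?_
  have := LinearMap.congr_fun (sixValent_passLeft h hi.swap hj.swap hy) (passRight (M := M) hi hj x)
  rw [LinearMap.comp_apply, LinearMap.comp_apply, passLeft_passRight] at this
  rw [LinearMap.comp_apply, LinearMap.comp_apply, ← this, passRight_passLeft]

end vertices

/-! ### Relations of the Demazure operators -/

section demazure

variable {k : Type u} [Field k] {N : ℕ}

theorem demazure_demazure (i : Fin N) (p : PolyRing k N) : demazure i (demazure i p) = 0 :=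
  demazure_of_mem (demazure_mem i p)

theorem demazure_comm {i j : Fin N} (h : Distant i j) (p : PolyRing k N) :
    demazure i (demazure j p) = demazure j (demazure i p) := by
  -- Cleared of denominators, the composite is an expression in the reflections that is symmetric in
  -- `i` and `j`.
  have key {i j : Fin N} (h : Distant i j) : X i * X j * demazure i (demazure j p) =
      p - refl k i p - refl k j p + refl k i (refl k j p) := by
    have h1 := X_mul_demazure i (demazure j p)
    have h2 := X_mul_demazure j p
    have h3 := congrArg (refl k i) h2
    rw [map_mul, map_sub, refl_X_distant h] at h3
    linear_combination X j * h1 + h2 - h3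
  have hne : (X i * X j : PolyRing k N) ≠ 0 := mul_ne_zero (X_ne_zero i) (X_ne_zero j)
  apply mul_left_cancel₀ hne
  rw [key h, mul_comm (X i), key h.swap, refl_comm h]; ring

theorem X_add_X_ne_zero {i j : Fin N} (h : Adjacent i j) : (X i + X j : PolyRing k N) ≠ 0 := by
  intro h0
  have := congrArg (refl k i) h0
  rw [map_add, refl_X_self, refl_X_adjacent h, map_zero] at this
  exact X_ne_zero j (by linear_combination this)

/-- Multiplied by the product `f_i f_j (f_i + f_j)` of the three positive roots, either side becomes
the alternating sum of `p` over the symmetric group generated by `s_i` and `s_j`. -/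
theorem demazure_braid {i j : Fin N} (h : Adjacent i j) (p : PolyRing k N) :
    demazure i (demazure j (demazure i p)) = demazure j (demazure i (demazure j p)) := by
  have key {i j : Fin N} (h : Adjacent i j) :
      X i * X j * (X i + X j) * demazure i (demazure j (demazure i p)) =
        p - refl k i p - refl k j p + refl k i (refl k j p) + refl k j (refl k i p) -
          refl k i (refl k j (refl k i p)) := by
    have h1 := X_mul_demazure i p
    have h2 := X_mul_demazure j (demazure i p)
    have h3 := X_mul_demazure i (demazure j (demazure i p))
    have h4 := congrArg (refl k j) h1
    rw [map_mul, map_sub, refl_X_adjacent h.swap] at h4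
    have e1 : X i * (X i + X j) * X j * demazure j (demazure i p) =
        (X i + X j) * (p - refl k i p) - X i * (refl k j p - refl k j (refl k i p)) := by
      linear_combination X i * (X i + X j) * h2 + (X i + X j) * h1 - X i * h4
    have e2 := congrArg (refl k i) e1
    simp only [map_add, map_sub, map_mul, refl_X_self, refl_X_adjacent h, refl_refl] at e2
    apply mul_left_cancel₀ (X_ne_zero (R := k) i)
    linear_combination X i * X j * (X i + X j) * h3 + e1 + e2
  have hne : (X i * X j * (X i + X j) : PolyRing k N) ≠ 0 :=
    mul_ne_zero (mul_ne_zero (X_ne_zero i) (X_ne_zero j)) (X_add_X_ne_zero h)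
  apply mul_left_cancel₀ hne
  rw [key h, show (X i * X j * (X i + X j) : PolyRing k N) = X j * X i * (X j + X i) by ring,
    key h.swap, refl_braid h]
  ring

theorem demazure_neg (i : Fin N) (p : PolyRing k N) : demazure i (-p) = -demazure i p := by
  apply demazure_unique; rw [mul_neg, X_mul_demazure, map_neg]; ring

theorem demazure_halfRoot [NeZero (2 : k)] (i : Fin N) : demazure i (halfRoot k i) = 1 := by
  apply demazure_unique
  rw [halfRoot, map_mul, refl_X_self, ← algebraMap_eq, AlgHom.commutes, algebraMap_eq]
  linear_combination -X i * half_spec (k := k) (n := N)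

end demazure

/-! ### Traces and adjoint maps -/

section trace

open Ind (tmul kappa)

variable {k : Type u} [Field k] {N : ℕ}
variable {M : Type u} [CommRing M] [Algebra (PolyRing k N) M]
variable {M' : Type u} [CommRing M'] [Algebra (PolyRing k N) M']

/-- The trace `a ⊗ m ↦ a ∂_i (t m)`. -/
def traceInd (i : Fin N) (t : M →ₗ[PolyRing k N] PolyRing k N) :
    Ind k i M →ₗ[PolyRing k N] PolyRing k N :=
  LinearMap.liftBaseChange (R := invariants k i) (PolyRing k N)
    { toFun := fun m => demazure i (t m)
      map_add' := fun m m' => by rw [map_add, demazure_add]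
      map_smul' := fun p m => by
        change demazure i (t (p.1 • m)) = p.1 * demazure i (t m)
        rw [map_smul, smul_eq_mul, demazure_mul, demazure_of_mem p.2]; ring }

theorem traceInd_tmul (i : Fin N) (t : M →ₗ[PolyRing k N] PolyRing k N) (p : PolyRing k N) (m : M) :
    traceInd i t (tmul i p m) = p * demazure i (t m) := rfl

/-- `g` is the adjoint of `f` for the forms `(m, m') ↦ t (m m')`. -/
def IsAdjoint (t : M →ₗ[PolyRing k N] PolyRing k N) (t' : M' →ₗ[PolyRing k N] PolyRing k N)
    (f : M →ₗ[PolyRing k N] M') (g : M' →ₗ[PolyRing k N] M) : Prop :=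
  ∀ m m', t' (f m * m') = t (m * g m')

/-- The form `(m, m') ↦ t (m m')` is nondegenerate. -/
def IsNondegenerate (t : M →ₗ[PolyRing k N] PolyRing k N) : Prop :=
  ∀ m, (∀ m', t (m * m') = 0) → m = 0

theorem isAdjoint_of_linearMap {t : M →ₗ[PolyRing k N] PolyRing k N}
    {t' : M' →ₗ[PolyRing k N] PolyRing k N}
    {f : M →ₗ[PolyRing k N] M'} {g : M' →ₗ[PolyRing k N] M}
    (h : (LinearMap.mul (PolyRing k N) M').compr₂ t' ∘ₗ f =
      ((LinearMap.mul (PolyRing k N) M).compr₂ t).compl₂ g) : IsAdjoint t t' f g := fun m m' =>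
  LinearMap.congr_fun (LinearMap.congr_fun h m) m'

variable {t : M →ₗ[PolyRing k N] PolyRing k N} {t' : M' →ₗ[PolyRing k N] PolyRing k N}

theorem IsAdjoint.map {f : M →ₗ[PolyRing k N] M'} {g : M' →ₗ[PolyRing k N] M}
    (h : IsAdjoint t t' f g) (i : Fin N) :
    IsAdjoint (traceInd i t) (traceInd i t') (Ind.map i f) (Ind.map i g) := by
  apply isAdjoint_of_linearMap
  refine Ind.ext fun m => Ind.ext fun m' => ?_
  change traceInd i t' (tmul i 1 (f m) * tmul i 1 m') = traceInd i t (tmul i 1 m * tmul i 1 (g m'))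
  rw [Ind.tmul_mul_tmul, Ind.tmul_mul_tmul, traceInd_tmul, traceInd_tmul, h]

variable [NeZero (2 : k)]

theorem isAdjoint_fourValent {i j : Fin N} (h : Distant i j) (h' : Distant j i) :
    IsAdjoint (traceInd i (traceInd j t)) (traceInd j (traceInd i t)) (fourValent M h)
      (fourValent M h') := by
  apply isAdjoint_of_linearMap
  refine Ind.ext_distant h fun m => Ind.ext_distant h' fun m' => ?_
  change traceInd j (traceInd i t) (fourValent M h (tmul i 1 (tmul j 1 m)) * tmul j 1 (tmul i 1 m'))
    = traceInd i (traceInd j t) (tmul i 1 (tmul j 1 m) * fourValent M h' (tmul j 1 (tmul i 1 m')))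
  rw [fourValent_one, fourValent_one]
  simp only [Ind.tmul_mul_tmul, traceInd_tmul, one_mul]
  exact demazure_comm h' _

/-- For `P = ∂_i(t m)` the twisted Leibniz rule gives `(f_j/2) ∂_j P + ∂_j((f_j/2) P) = P`, and `∂_i
P = 0`. -/
theorem traceInd_kappa {i j : Fin N} (m : M) :
    traceInd i (traceInd j (traceInd i t)) (kappa i j m) = 0 := by
  rw [kappa, map_add]
  simp only [traceInd_tmul, one_mul]
  rw [← demazure_add, ← demazure_demazure i (t m)]
  congr 1
  rw [demazure_mul, demazure_halfRoot, refl_eq, X_eq]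
  ring

theorem Ind.kappa_mul (i j : Fin N) (m m' : M) :
    kappa (k := k) i j m * tmul i 1 (tmul j 1 (tmul i 1 m')) = kappa i j (m * m') := by
  simp only [kappa, add_mul, Ind.tmul_mul_tmul, one_mul, mul_one]

/-- On the pair of generators 1 and 1 this is the braid relation of the Demazure operators. If a κ
occurs, both sides vanish: either the vertex kills it, or it is multiplied by an element of the last
factor, and the result is again a κ, which has trace zero. -/
theorem isAdjoint_sixValent {i j : Fin N} (h : Adjacent i j) (h' : Adjacent j i)
    {y y' : PolyRing k N} (hy : Ind.IsWeight i j y) (hy' : Ind.IsWeight j i y') :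
    IsAdjoint (traceInd i (traceInd j (traceInd i t))) (traceInd j (traceInd i (traceInd j t)))
      (sixValent M h) (sixValent M h') := by
  apply isAdjoint_of_linearMap
  refine Ind.ext_adjacent h hy (fun m => ?_) fun m => ?_
  · refine Ind.ext_adjacent h' hy' (fun m' => ?_) fun m' => ?_
    · change traceInd j (traceInd i (traceInd j t)) (sixValent M h (tmul i 1 (tmul j 1 (tmul i 1 m)))
        * tmul j 1 (tmul i 1 (tmul j 1 m'))) = traceInd i (traceInd j (traceInd i t))
        (tmul i 1 (tmul j 1 (tmul i 1 m)) * sixValent M h' (tmul j 1 (tmul i 1 (tmul j 1 m'))))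
      rw [sixValent_one, sixValent_one]
      simp only [Ind.tmul_mul_tmul, traceInd_tmul, one_mul]
      exact demazure_braid h' _
    · change traceInd j (traceInd i (traceInd j t)) (sixValent M h (tmul i 1 (tmul j 1 (tmul i 1 m)))
        * kappa j i m') = traceInd i (traceInd j (traceInd i t))
        (tmul i 1 (tmul j 1 (tmul i 1 m)) * sixValent M h' (kappa j i m'))
      rw [sixValent_one, sixValent_kappa, mul_comm, Ind.kappa_mul, traceInd_kappa, mul_zero, map_zero]
  · refine Ind.ext_adjacent h' hy' (fun m' => ?_) fun m' => ?_
    · change traceInd j (traceInd i (traceInd j t)) (sixValent M h (kappa i j m)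
        * tmul j 1 (tmul i 1 (tmul j 1 m'))) = traceInd i (traceInd j (traceInd i t))
        (kappa i j m * sixValent M h' (tmul j 1 (tmul i 1 (tmul j 1 m'))))
      rw [sixValent_kappa, sixValent_one, Ind.kappa_mul, traceInd_kappa, zero_mul, map_zero]
    · change traceInd j (traceInd i (traceInd j t)) (sixValent M h (kappa i j m)
        * kappa j i m') = traceInd i (traceInd j (traceInd i t))
        (kappa i j m * sixValent M h' (kappa j i m'))
      rw [sixValent_kappa, sixValent_kappa, zero_mul, mul_zero, map_zero, map_zero]

theorem Ind.exists_eq_half (i : Fin N) (x : Ind k i M) :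
    ∃ m m', x = tmul i 1 m + tmul i (halfRoot k i) m' := by
  induction x using Ind.induction with
  | zero => exact ⟨0, 0, by simp only [Ind.tmul_zero, add_zero]⟩
  | tmul p m => exact ⟨_, _, Ind.tmul_generators_half i p m⟩
  | add x y hx hy =>
    obtain ⟨a, b, rfl⟩ := hx
    obtain ⟨c, d, rfl⟩ := hy
    exact ⟨a + c, b + d, by simp only [Ind.tmul_add]; abel⟩

theorem IsNondegenerate.traceInd (h : IsNondegenerate t) (i : Fin N) :
    IsNondegenerate (traceInd i t) := by
  intro x hx
  obtain ⟨m, m', rfl⟩ := Ind.exists_eq_half i x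
  suffices hmm : ∀ n, t (m * n) = 0 ∧ t (m' * n) = 0 by
    rw [h m fun n => (hmm n).1, h m' fun n => (hmm n).2, Ind.tmul_zero, Ind.tmul_zero, add_zero]
  intro n
  have key (r : PolyRing k N) :
      demazure i (r * t (m * n)) + halfRoot k i * demazure i (r * t (m' * n)) = 0 := by
    have := hx (tmul i 1 (r • n))
    rwa [add_mul, Ind.tmul_mul_tmul, Ind.tmul_mul_tmul, map_add, traceInd_tmul, traceInd_tmul,
      mul_one, mul_one, one_mul, mul_smul_comm, mul_smul_comm, map_smul, map_smul, smul_eq_mul,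
      smul_eq_mul] at this
  generalize t (m * n) = A at *
  generalize t (m' * n) = B at *
  -- The values 1 and `f_i / 2` generate `R` over `R^i`; testing against both gives first `A =
  -- -(f_i/2) B` and then `s_i B = 0`.
  have h1 := key 1
  have h2 := key (halfRoot k i)
  rw [one_mul, one_mul] at h1
  rw [demazure_mul, demazure_mul, demazure_halfRoot, refl_eq, refl_eq, X_eq] at h2
  have hA : A = -(halfRoot k i * B) := by linear_combination h2 + halfRoot k i * h1
  have h3 := h1
  rw [hA, demazure_neg, demazure_mul, demazure_halfRoot] at h3
  have hB : refl k i B = 0 := by linear_combination -h3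
  have hB' : B = 0 := by rw [← refl_refl i B, hB, map_zero]
  rw [hA, hB', mul_zero, neg_zero]
  exact ⟨rfl, rfl⟩

end trace

/-! ### Adjoint pairs of bimodule maps -/

section adjointPair

open Ind (tmul kappa)

variable {k : Type u} [Field k] {N : ℕ}
variable {M : Type u} [CommRing M] [Algebra (PolyRing k N) M]
variable {M' : Type u} [CommRing M'] [Algebra (PolyRing k N) M']
variable {M'' : Type u} [CommRing M''] [Algebra (PolyRing k N) M'']

/-- The subbimodule generated by `1`; the right action of `R` is given by `ρ`. -/
def oneSpan (ρ : PolyRing k N →+* M) : Submodule (PolyRing k N) M :=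
  Submodule.span (PolyRing k N) (Set.range ρ)

theorem mem_oneSpan (ρ : PolyRing k N →+* M) (r : PolyRing k N) : ρ r ∈ oneSpan ρ :=
  Submodule.subset_span ⟨r, rfl⟩

theorem oneSpan_induction {ρ : PolyRing k N →+* M} {f g : M →ₗ[PolyRing k N] M'}
    (h : ∀ r, f (ρ r) = g (ρ r)) {m : M} (hm : m ∈ oneSpan ρ) : f m = g m := by
  have : oneSpan ρ ≤ LinearMap.eqLocus f g := by
    rw [oneSpan, Submodule.span_le]
    rintro _ ⟨r, rfl⟩
    exact h r
  exact this hm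

/-- A map of bimodules that sends `1` to `1`. -/
structure IsUnitalRight (ρ : PolyRing k N →+* M) (ρ' : PolyRing k N →+* M')
    (f : M →ₗ[PolyRing k N] M') : Prop where
  map_mul : ∀ m r, f (m * ρ r) = f m * ρ' r
  map_one : f 1 = 1

variable {ρ : PolyRing k N →+* M} {ρ' : PolyRing k N →+* M'} {ρ'' : PolyRing k N →+* M''}

theorem IsUnitalRight.map_right {f : M →ₗ[PolyRing k N] M'} (h : IsUnitalRight ρ ρ' f)
    (r : PolyRing k N) : f (ρ r) = ρ' r := by
  rw [← one_mul (ρ r), h.map_mul, h.map_one, one_mul]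

theorem IsUnitalRight.map_mem {f : M →ₗ[PolyRing k N] M'} (h : IsUnitalRight ρ ρ' f)
    {m : M} (hm : m ∈ oneSpan ρ) : f m ∈ oneSpan ρ' := by
  have : oneSpan ρ ≤ (oneSpan ρ').comap f := by
    rw [oneSpan, Submodule.span_le]
    rintro _ ⟨r, rfl⟩
    rw [SetLike.mem_coe, Submodule.mem_comap, h.map_right]
    exact mem_oneSpan ρ' r
  exact this hm

theorem IsUnitalRight.comp {f : M →ₗ[PolyRing k N] M'} {g : M' →ₗ[PolyRing k N] M''}
    (hg : IsUnitalRight ρ' ρ'' g) (hf : IsUnitalRight ρ ρ' f) : IsUnitalRight ρ ρ'' (g ∘ₗ f) where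
  map_mul m r := by rw [LinearMap.comp_apply, hf.map_mul, hg.map_mul]; rfl
  map_one := by rw [LinearMap.comp_apply, hf.map_one, hg.map_one]

theorem IsUnitalRight.id : IsUnitalRight ρ ρ (LinearMap.id : M →ₗ[PolyRing k N] M) :=
  ⟨fun _ _ => rfl, rfl⟩

/-- Multiplication by `1 ⊗ m`. -/
theorem Ind.mul_inner (i : Fin N) (x : Ind k i M) (m : M) :
    x * inner k i M m = Ind.map i (LinearMap.mulRight (PolyRing k N) m) x := by
  have : LinearMap.mulRight (PolyRing k N) (inner k i M m) =
      Ind.map i (LinearMap.mulRight (PolyRing k N) m) :=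
    Ind.ext fun m' => by
      change tmul i 1 m' * tmul i 1 m = tmul i 1 (m' * m)
      rw [Ind.tmul_mul_tmul, one_mul]
  exact LinearMap.congr_fun this x

theorem IsUnitalRight.map {f : M →ₗ[PolyRing k N] M'} (h : IsUnitalRight ρ ρ' f) (i : Fin N) :
    IsUnitalRight ((inner k i M).comp ρ) ((inner k i M').comp ρ') (Ind.map i f) where
  map_mul x r := by
    rw [RingHom.comp_apply, RingHom.comp_apply, Ind.mul_inner, Ind.mul_inner]
    refine LinearMap.congr_fun (f := Ind.map i f ∘ₗ Ind.map i _) (g := Ind.map i _ ∘ₗ Ind.map i f)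
      ?_ x
    rw [← Ind.map_comp, ← Ind.map_comp]
    congr 1
    exact LinearMap.ext fun m => h.map_mul m r
  map_one := by rw [Ind.one_eq, Ind.map_tmul, h.map_one, Ind.one_eq]

/-- An adjoint pair of maps of bimodules that send `1` to `1`. -/
structure IsAdjointPair (t : M →ₗ[PolyRing k N] PolyRing k N) (ρ : PolyRing k N →+* M)
    (t' : M' →ₗ[PolyRing k N] PolyRing k N) (ρ' : PolyRing k N →+* M')
    (f : M →ₗ[PolyRing k N] M') (g : M' →ₗ[PolyRing k N] M) : Prop where
  adj : IsAdjoint t t' f g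
  left : IsUnitalRight ρ ρ' f
  right : IsUnitalRight ρ' ρ g

variable {t : M →ₗ[PolyRing k N] PolyRing k N} {t' : M' →ₗ[PolyRing k N] PolyRing k N}
variable {t'' : M'' →ₗ[PolyRing k N] PolyRing k N}

namespace IsAdjointPair

variable {f : M →ₗ[PolyRing k N] M'} {g : M' →ₗ[PolyRing k N] M}

theorem id : IsAdjointPair t ρ t ρ LinearMap.id LinearMap.id :=
  ⟨fun _ _ => rfl, .id, .id⟩

theorem comp {f' : M' →ₗ[PolyRing k N] M''} {g' : M'' →ₗ[PolyRing k N] M'}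
    (h' : IsAdjointPair t' ρ' t'' ρ'' f' g') (h : IsAdjointPair t ρ t' ρ' f g) :
    IsAdjointPair t ρ t'' ρ'' (f' ∘ₗ f) (g ∘ₗ g') :=
  ⟨fun m m' => by
    rw [LinearMap.comp_apply, LinearMap.comp_apply, h'.adj, h.adj],
    h'.left.comp h.left, h.right.comp h'.right⟩

theorem map (h : IsAdjointPair t ρ t' ρ' f g) (i : Fin N) :
    IsAdjointPair (traceInd i t) ((inner k i M).comp ρ) (traceInd i t') ((inner k i M').comp ρ')
      (Ind.map i f) (Ind.map i g) :=
  ⟨h.adj.map i, h.left.map i, h.right.map i⟩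

/-- The composite is a bimodule map that fixes 1, so it fixes everything that 1 generates. -/
theorem comp_apply_of_mem (h : IsAdjointPair t ρ t' ρ' f g) {m : M'} (hm : m ∈ oneSpan ρ') :
    f (g m) = m :=
  oneSpan_induction (f := f ∘ₗ g) (g := LinearMap.id) (h.left.comp h.right).map_right hm

/-- Adjoint pairs of maps into the subbimodule generated by `1` are unique. -/
theorem ext (ht' : IsNondegenerate t') (h : IsAdjointPair t ρ t' ρ' f g)
    {f' : M →ₗ[PolyRing k N] M'} {g' : M' →ₗ[PolyRing k N] M} (h' : IsAdjointPair t ρ t' ρ' f' g')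
    (hf : ∀ m, f m ∈ oneSpan ρ') (hf' : ∀ m, f' m ∈ oneSpan ρ') : f = f' := by
  refine LinearMap.ext fun m => sub_eq_zero.1 (ht' _ fun m' => ?_)
  have hc : f m - f' m ∈ oneSpan ρ' := sub_mem (hf m) (hf' m)
  have h0 (r : PolyRing k N) : t' ((f m - f' m) * ρ' r) = 0 := by
    rw [sub_mul, map_sub, h.adj, h'.adj, h.right.map_right, h'.right.map_right, sub_self]
  -- The difference `c` equals `f (g c)`. Moving `f` to the other side and back replaces `m'` by `f
  -- (g m')`, which lies in the span of the right multiples of 1, where `h0` applies.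
  rw [← h.comp_apply_of_mem hc, h.adj, mul_comm, ← h.adj, mul_comm]
  exact oneSpan_induction (f := t' ∘ₗ LinearMap.mulLeft (PolyRing k N) (f m - f' m)) (g := 0) h0
    (hf (g m'))

/-- If `f` maps to the subbimodule generated by `1`, then so does its adjoint. -/
theorem adjoint_mem (ht : IsNondegenerate t) (h : IsAdjointPair t ρ t' ρ' f g)
    (hf : ∀ m, f m ∈ oneSpan ρ') (m' : M') : g m' ∈ oneSpan ρ := by
  -- By nondegeneracy it suffices to pair with `n`. After taking adjoints, `f ∘ g` acts on `f n`,
  -- which it fixes.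
  have key : g m' = g (f (g m')) := by
    refine sub_eq_zero.1 (ht _ fun n => ?_)
    have e (m' : M') : t (g m' * n) = t' (f n * m') := by rw [mul_comm, h.adj]
    have e2 : t' (f n * f (g m')) = t' (f n * m') := by
      rw [mul_comm, h.adj, mul_comm, ← h.adj, h.comp_apply_of_mem (hf n)]
    rw [sub_mul, map_sub, e, e, e2, sub_self]
  rw [key]
  exact h.right.map_mem (hf _)

end IsAdjointPair

variable [NeZero (2 : k)]

/-- The right action is multiplication on the factor `M`, so compatibility with it is an instance of
naturality. -/
theorem isUnitalRight_fourValent {i j : Fin N} (h : Distant i j) :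
    IsUnitalRight ((inner k i _).comp ((inner k j M).comp ρ))
      ((inner k j _).comp ((inner k i M).comp ρ)) (fourValent M h) where
  map_mul x r := by
    simp only [RingHom.comp_apply, Ind.mul_inner]
    have e (a b : Fin N) : LinearMap.mulRight (PolyRing k N) (inner k b M (ρ r)) =
      Ind.map b (LinearMap.mulRight (PolyRing k N) (ρ r)) :=
        LinearMap.ext fun x => Ind.mul_inner _ _ _
    rw [e i, e j]
    exact LinearMap.congr_fun (fourValent_map h _) x
  map_one := by simp only [Ind.one_eq, fourValent_one]

theorem isUnitalRight_sixValent {i j : Fin N} (h : Adjacent i j) {y : PolyRing k N}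
    (hy : Ind.IsWeight i j y) :
    IsUnitalRight ((inner k i _).comp ((inner k j _).comp ((inner k i M).comp ρ)))
      ((inner k j _).comp ((inner k i _).comp ((inner k j M).comp ρ))) (sixValent M h) where
  map_mul x r := by
    simp only [RingHom.comp_apply, Ind.mul_inner]
    have e (b : Fin N) (M : Type u) [CommRing M] [Algebra (PolyRing k N) M] (m : M) :
      LinearMap.mulRight (PolyRing k N) (inner k b M m) =
        Ind.map b (LinearMap.mulRight (PolyRing k N) m) :=
        LinearMap.ext fun x => Ind.mul_inner _ _ _
    simp only [e]
    exact LinearMap.congr_fun (sixValent_map h hy _) x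
  map_one := by simp only [Ind.one_eq, sixValent_one]

theorem isAdjointPair_fourValent {i j : Fin N} (h : Distant i j) (h' : Distant j i) :
    IsAdjointPair (traceInd i (traceInd j t)) ((inner k i _).comp ((inner k j M).comp ρ))
      (traceInd j (traceInd i t)) ((inner k j _).comp ((inner k i M).comp ρ))
      (fourValent M h) (fourValent M h') :=
  ⟨isAdjoint_fourValent h h', isUnitalRight_fourValent h, isUnitalRight_fourValent h'⟩

theorem isAdjointPair_sixValent {i j : Fin N} (h : Adjacent i j) (h' : Adjacent j i)
    {y y' : PolyRing k N} (hy : Ind.IsWeight i j y) (hy' : Ind.IsWeight j i y') :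
    IsAdjointPair (traceInd i (traceInd j (traceInd i t)))
      ((inner k i _).comp ((inner k j _).comp ((inner k i M).comp ρ)))
      (traceInd j (traceInd i (traceInd j t)))
      ((inner k j _).comp ((inner k i _).comp ((inner k j M).comp ρ)))
      (sixValent M h) (sixValent M h') :=
  ⟨isAdjoint_sixValent h h' hy hy', isUnitalRight_sixValent h hy, isUnitalRight_sixValent h' hy'⟩

/-- If `1 ⊗ x` is mapped to an element of the right factor, where `R` is generated by `1` and `x`
over `R^i`, then the image of the subbimodule generated by `1` in the last factor is contained in
the subbimodule generated by `1`. -/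
theorem IsUnitalRight.map_ind_mem {i : Fin N} {f : Ind k i M →ₗ[PolyRing k N] M'}
    (h : IsUnitalRight ((inner k i M).comp ρ) ρ' f) {x x' : PolyRing k N}
    (hx : refl k i x = x + X i) (hf : f (tmul i 1 (x • 1)) = ρ' x')
    {φ : M'' →ₗ[PolyRing k N] M} (hφ : ∀ m, φ m ∈ oneSpan ρ) (m : Ind k i M'') :
    f (Ind.map i φ m) ∈ oneSpan ρ' := by
  induction m using Ind.induction with
  | zero => rw [map_zero, map_zero]; exact zero_mem _
  | add x y hx hy => rw [map_add, map_add]; exact add_mem hx hy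
  | tmul p m =>
    rw [Ind.map_tmul, Ind.tmul_eq_smul, map_smul]
    refine Submodule.smul_mem _ _ ?_
    suffices H : ∀ n ∈ oneSpan ρ, ∀ p : PolyRing k N, f (tmul i 1 (p • n)) ∈ oneSpan ρ' by
      simpa only [one_smul] using H _ (hφ m) 1
    intro n hn
    rw [oneSpan] at hn
    induction hn using Submodule.span_induction with
    | zero => intro p; rw [smul_zero, Ind.tmul_zero, map_zero]; exact zero_mem _
    | add x y _ _ hx hy =>
      intro p; rw [smul_add, Ind.tmul_add, map_add]; exact add_mem (hx p) (hy p)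
    | smul q y _ hy => intro p; rw [← mul_smul]; exact hy _
    | mem y hy =>
      obtain ⟨r, rfl⟩ := hy
      intro p
      have h1 : (tmul i 1 (ρ r) : Ind k i M) = (inner k i M).comp ρ r := rfl
      have h2 : tmul (k := k) i 1 (x • ρ r) = tmul i 1 (x • 1) * (inner k i M).comp ρ r := by
        rw [← h1, Ind.tmul_mul_tmul, one_mul, smul_mul_assoc, one_mul]
      -- Both coefficients are invariant under `s_i` and leave to the left, so only the values 1 and
      -- `x` remain in the slot, and their images are known.
      have e : p = (p + x * demazure i p) - demazure i p * x := by ring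
      rw [e, sub_smul, mul_smul, Ind.tmul_sub, Ind.tmul_one_smul i (Ind.sub_mem_of_refl hx p),
        Ind.tmul_one_smul i (demazure_mem i p), map_sub, map_smul, map_smul, h1, h.map_right, h2,
        h.map_mul, hf, ← RingHom.map_mul]
      exact sub_mem (Submodule.smul_mem _ _ (mem_oneSpan _ _))
        (Submodule.smul_mem _ _ (mem_oneSpan _ _))

end adjointPair

/-! ### Permutation coordinates -/

section coord

variable {k : Type u} [Field k] {N : ℕ}

variable (k N) in
/-- The sum of the variables with index at least `c`. The reflection `s_i` exchanges the coordinates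
with index `i` and `i + 1`, if `i` is not the last index. -/
def coord (c : ℕ) : PolyRing k N := ∑ l : Fin N with c ≤ l.val, X l

theorem coord_eq (i : Fin N) : coord k N i.val = X i + coord k N (i.val + 1) := by
  rw [coord, coord, ← Finset.sum_insert (a := i) (by simp)]
  congr 1
  ext l
  simp only [Finset.mem_filter, Finset.mem_insert, Finset.mem_univ, true_and, Fin.ext_iff]
  omega

theorem refl_coord_of_lt {i : Fin N} {c : ℕ} (h : i.val + 1 < c) :
    refl k i (coord k N c) = coord k N c := by
  rw [coord, map_sum]
  refine Finset.sum_congr rfl fun l hl => refl_X_distant (Or.inl ?_)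
  have := (Finset.mem_filter.1 hl).2
  omega

theorem refl_coord_succ {i : Fin N} (hi : i.val + 1 < N) :
    refl k i (coord k N (i.val + 1)) = coord k N (i.val + 1) + X i := by
  have h := coord_eq (k := k) (⟨i.val + 1, hi⟩ : Fin N)
  dsimp only at h
  rw [h, map_add, refl_coord_of_lt (by omega), refl_X_adjacent (Or.inl rfl)]
  ring

theorem refl_coord_self {i : Fin N} (hi : i.val + 1 < N) :
    refl k i (coord k N i.val) = coord k N (i.val + 1) := by
  rw [coord_eq, map_add, refl_coord_succ hi, refl_X_self]
  ring

/-- Descending induction on `c`. For `c = i - 1` the root `f_c` gains `f_i` and the coordinate with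
index `i` loses it; for smaller `c` the new root is distant from `i`. -/
theorem refl_coord_of_gt {i : Fin N} (hi : i.val + 1 < N) {c : ℕ} (h : c < i.val) :
    refl k i (coord k N c) = coord k N c := by
  obtain ⟨d, hd⟩ : ∃ d, i.val = c + d + 1 := ⟨i.val - c - 1, by omega⟩
  induction d generalizing c with
  | zero =>
    have h := coord_eq (k := k) (⟨c, by omega⟩ : Fin N)
    dsimp only at h
    rw [h, map_add, refl_X_adjacent (Or.inr (by dsimp only; omega)), show c + 1 = i.val by omega,
      refl_coord_self hi, coord_eq]
    ring
  | succ d ih =>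
    have h := coord_eq (k := k) (⟨c, by omega⟩ : Fin N)
    dsimp only at h
    rw [h, map_add, refl_X_distant (Or.inr (by dsimp only; omega)), ih (by omega) (by omega)]

theorem refl_coord {i : Fin N} (hi : i.val + 1 < N) {c : ℕ} (h : c ≠ i.val) (h' : c ≠ i.val + 1) :
    refl k i (coord k N c) = coord k N c := by
  rcases lt_or_gt_of_ne h with h | h
  · exact refl_coord_of_gt hi h
  · exact refl_coord_of_lt (by omega)

/-- Of the two coordinates exchanged by `s_j`, exactly one is untouched by `s_i`: the one with index
`j + 1` if `j = i + 1`, and the one with index `j`, which enters with a sign, if `j = i - 1`. -/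
theorem isWeight_coord {i j : Fin N} (h : i.val + 1 = j.val) (hj : j.val + 1 < N) :
    Ind.IsWeight (k := k) i j (coord k N (j.val + 1)) :=
  ⟨refl_coord_of_lt (by omega), refl_coord_succ hj⟩

theorem isWeight_neg_coord {i j : Fin N} (h : j.val + 1 = i.val) (hi : i.val + 1 < N) :
    Ind.IsWeight (k := k) i j (-coord k N j.val) := by
  refine ⟨?_, ?_⟩
  · rw [map_neg, refl_coord_of_gt hi (by omega)]
  · rw [map_neg, refl_coord_self (by omega), coord_eq]; ring

theorem exists_isWeight {i j : Fin N} (h : Adjacent i j) (hi : i.val + 1 < N)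
    (hj : j.val + 1 < N) : ∃ y, Ind.IsWeight (k := k) i j y := by
  rcases h with h | h
  · exact ⟨_, isWeight_coord h hj⟩
  · exact ⟨_, isWeight_neg_coord h hi⟩

end coord

/-! ### Strands that cross a word -/

section tracking

open Ind (tmul kappa)

variable {k : Type u} [Field k] [NeZero (2 : k)] {N : ℕ}
variable {M : Type u} [CommRing M] [Algebra (PolyRing k N) M]

theorem fourValent_coord {i a : Fin N} (h : Distant i a) (ha : a.val + 1 < N) (m : M) :
    fourValent (k := k) M h (tmul i 1 (coord k N (i.val + 1) • tmul a 1 m)) =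
      tmul a 1 (tmul i 1 (coord k N (i.val + 1) • m)) := by
  rw [← Ind.tmul_one_smul a, fourValent_one]
  apply refl_coord ha <;> rcases h with h | h <;> omega

/-- The coordinate with index `j` is `y + f_j`, where the weight `y` is the coordinate with index `j
+ 1`. Modulo κ, which the vertex kills, it moves from the second slot to the last. -/
theorem sixValent_coord_left {i j : Fin N} (h : Adjacent i j) (hij : i.val + 1 = j.val)
    (hj : j.val + 1 < N) (m : M) :
    sixValent (k := k) M h (tmul i 1 (coord k N (i.val + 1) • tmul j 1 (tmul i 1 m))) =
      tmul j 1 (tmul i 1 (tmul j 1 (coord k N (j.val + 1) • m))) := by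
  rw [Ind.smul_tmul, mul_one, hij, coord_eq, add_comm,
    Ind.tmul_of_weight_left (isWeight_coord hij hj), map_add, sixValent_kappa, zero_add,
    sixValent_one]

theorem sixValent_coord_right {i j : Fin N} (h : Adjacent i j) (hij : i.val + 1 = j.val)
    (hj : j.val + 1 < N) (m : M) :
    sixValent (k := k) M h (tmul i 1 (tmul j 1 (coord k N (i.val + 1) • tmul i 1 m))) =
      coord k N (j.val + 1) • tmul j 1 (tmul i 1 (tmul j 1 m)) := by
  rw [Ind.smul_tmul, mul_one, hij, coord_eq, add_comm,
    Ind.tmul_of_weight_right (isWeight_coord hij hj), map_add, sixValent_kappa, zero_add, map_smul,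
    sixValent_one]

end tracking

/-! ### The Zamolodchikov relation -/

/-! ### Reduction of natural identities to the case `M = R`. -/

section families

variable {k : Type u} [Field k] {N : ℕ}
variable {M M' : Type u} [CommRing M] [Algebra (PolyRing k N) M] [CommRing M']
  [Algebra (PolyRing k N) M']

/-- Every element of `M` is the image of 1 under a map from `R`. Joint surjectivity of such a family
survives induction, so identities that are natural in `M` need to be checked only for `M = R`. -/
theorem Ind.iSup_range_map {ι : Type*} (i : Fin N) (φ : ι → M →ₗ[PolyRing k N] M')
    (h : ⨆ a, LinearMap.range (φ a) = ⊤) : ⨆ a, LinearMap.range (Ind.map i (φ a)) = ⊤ := by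
  refine Submodule.eq_top_iff'.2 fun x => ?_
  induction x using Ind.induction with
  | zero => exact zero_mem _
  | add x y hx hy => exact add_mem hx hy
  | tmul p m =>
    have hm : m ∈ ⨆ a, LinearMap.range (φ a) := by rw [h]; trivial
    induction hm using Submodule.iSup_induction' with
    | zero => rw [Ind.tmul_zero]; exact zero_mem _
    | add x y _ _ hx hy => rw [Ind.tmul_add]; exact add_mem hx hy
    | mem a x hx =>
      obtain ⟨n, rfl⟩ := hx
      exact Submodule.mem_iSup_of_mem a ⟨Ind.tmul i p n, rfl⟩

theorem iSup_range_toSpanSingleton :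
    ⨆ m : M, LinearMap.range (LinearMap.toSpanSingleton (PolyRing k N) M m) = ⊤ := by
  rw [eq_top_iff]
  exact fun m _ => Submodule.mem_iSup_of_mem m ⟨1, one_smul _ m⟩

theorem linearMap_ext_of_iSup_range {ι P : Type*} [AddCommGroup P] [Module (PolyRing k N) P]
    {φ : ι → M →ₗ[PolyRing k N] M'} (h : ⨆ a, LinearMap.range (φ a) = ⊤)
    {f g : M' →ₗ[PolyRing k N] P} (hfg : ∀ a, f ∘ₗ φ a = g ∘ₗ φ a) : f = g := by
  have : ⨆ a, LinearMap.range (φ a) ≤ LinearMap.eqLocus f g := by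
    refine iSup_le fun a => ?_
    rintro _ ⟨x, rfl⟩
    exact LinearMap.congr_fun (hfg a) x
  exact LinearMap.ext fun x => this (h ▸ Submodule.mem_top)

end families

/-! ### A strand that crosses three consecutive strands `l j i`. -/

section zamolodchikov

open Ind (tmul kappa)

variable {k : Type u} [Field k] [NeZero (2 : k)] {N : ℕ} {i j l : Fin N}
variable (M : Type u) [CommRing M] [Algebra (PolyRing k N) M]
variable {M' : Type u} [CommRing M'] [Algebra (PolyRing k N) M']

/-- For consecutive `i`, `j`, `l`, the strand `i` crosses the strands `l`, `j`, `i` from the left. -/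
def crossLow (hij : Adjacent i j) (hil : Distant i l) :
    Ind k i (Ind k l (Ind k j (Ind k i M))) →ₗ[PolyRing k N]
      Ind k l (Ind k j (Ind k i (Ind k j M))) :=
  Ind.map l (sixValent M hij) ∘ₗ fourValent _ hil

/-- For consecutive `i`, `j`, `l`, the strand `j` crosses the strands `l`, `j`, `i` from the left. -/
def crossHigh (hjl : Adjacent j l) (hli : Distant l i) :
    Ind k j (Ind k l (Ind k j (Ind k i M))) →ₗ[PolyRing k N]
      Ind k l (Ind k j (Ind k i (Ind k l M))) :=
  Ind.map l (Ind.map j (fourValent M hli)) ∘ₗ sixValent (Ind k i M) hjl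

variable {M}

theorem crossLow_map (hij : Adjacent i j) (hil : Distant i l) {y : PolyRing k N}
    (hy : Ind.IsWeight i j y) (φ : M →ₗ[PolyRing k N] M') :
    crossLow M' hij hil ∘ₗ Ind.map i (Ind.map l (Ind.map j (Ind.map i φ))) =
      Ind.map l (Ind.map j (Ind.map i (Ind.map j φ))) ∘ₗ crossLow M hij hil := by
  rw [crossLow, LinearMap.comp_assoc, fourValent_map, ← LinearMap.comp_assoc, ← Ind.map_comp,
    sixValent_map hij hy, Ind.map_comp, crossLow, LinearMap.comp_assoc]

theorem crossHigh_map (hjl : Adjacent j l) (hli : Distant l i) {y : PolyRing k N}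
    (hy : Ind.IsWeight j l y) (φ : M →ₗ[PolyRing k N] M') :
    crossHigh M' hjl hli ∘ₗ Ind.map j (Ind.map l (Ind.map j (Ind.map i φ))) =
      Ind.map l (Ind.map j (Ind.map i (Ind.map l φ))) ∘ₗ crossHigh M hjl hli := by
  rw [crossHigh, LinearMap.comp_assoc, sixValent_map hjl hy, ← LinearMap.comp_assoc, ← Ind.map_comp,
    ← Ind.map_comp, fourValent_map, Ind.map_comp, Ind.map_comp, crossHigh, LinearMap.comp_assoc]

section adjoint

variable {t : M →ₗ[PolyRing k N] PolyRing k N} {ρ : PolyRing k N →+* M}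

theorem exists_isAdjointPair_crossLow (hij : Adjacent i j) (hil : Distant i l) {y y' : PolyRing k N}
    (hy : Ind.IsWeight i j y) (hy' : Ind.IsWeight j i y') :
    ∃ g, IsAdjointPair (traceInd i (traceInd l (traceInd j (traceInd i t))))
      ((inner k i _).comp ((inner k l _).comp ((inner k j _).comp ((inner k i M).comp ρ))))
      (traceInd l (traceInd j (traceInd i (traceInd j t))))
      ((inner k l _).comp ((inner k j _).comp ((inner k i _).comp ((inner k j M).comp ρ))))
      (crossLow M hij hil) g :=
  ⟨_, ((isAdjointPair_sixValent hij hij.swap hy hy').map l).comp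
    (isAdjointPair_fourValent (ρ := (inner k j _).comp ((inner k i M).comp ρ)) hil hil.swap)⟩

theorem exists_isAdjointPair_crossHigh (hjl : Adjacent j l) (hli : Distant l i)
    {y y' : PolyRing k N} (hy : Ind.IsWeight j l y) (hy' : Ind.IsWeight l j y') :
    ∃ g, IsAdjointPair (traceInd j (traceInd l (traceInd j (traceInd i t))))
      ((inner k j _).comp ((inner k l _).comp ((inner k j _).comp ((inner k i M).comp ρ))))
      (traceInd l (traceInd j (traceInd i (traceInd l t))))
      ((inner k l _).comp ((inner k j _).comp ((inner k i _).comp ((inner k l M).comp ρ))))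
      (crossHigh M hjl hli) g :=
  ⟨_, (((isAdjointPair_fourValent hli hli.swap).map j).map l).comp
    (isAdjointPair_sixValent (ρ := (inner k i M).comp ρ) hjl hjl.swap hy hy')⟩

end adjoint

theorem crossLow_one (hij : Adjacent i j) (hil : Distant i l) (m : M) :
    crossLow (k := k) M hij hil (tmul i 1 (tmul l 1 (tmul j 1 (tmul i 1 m)))) =
      tmul l 1 (tmul j 1 (tmul i 1 (tmul j 1 m))) := by
  rw [crossLow, LinearMap.comp_apply, fourValent_one, Ind.map_tmul, sixValent_one]

theorem crossHigh_one (hjl : Adjacent j l) (hli : Distant l i) (m : M) :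
    crossHigh (k := k) M hjl hli (tmul j 1 (tmul l 1 (tmul j 1 (tmul i 1 m)))) =
      tmul l 1 (tmul j 1 (tmul i 1 (tmul l 1 m))) := by
  rw [crossHigh, LinearMap.comp_apply, sixValent_one, Ind.map_tmul, Ind.map_tmul, fourValent_one]

section coord

variable (ij : i.val + 1 = j.val) (jl : j.val + 1 = l.val) (hl : l.val + 1 < N)
include ij jl hl

/-- The coordinate travels with its strand: it passes `l` unchanged, and its index rises from `i +
1` to `j + 1` at the six-valent vertex. -/
theorem crossLow_coord (hij : Adjacent i j) (hil : Distant i l) (m : M) :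
    crossLow (k := k) M hij hil
      (tmul i 1 (coord k N (i.val + 1) • tmul l 1 (tmul j 1 (tmul i 1 m)))) =
      tmul l 1 (tmul j 1 (tmul i 1 (tmul j 1 (coord k N (j.val + 1) • m)))) := by
  rw [crossLow, LinearMap.comp_apply, fourValent_coord hil hl, Ind.map_tmul,
    sixValent_coord_left hij ij (by omega)]

theorem crossHigh_coord (hjl : Adjacent j l) (hli : Distant l i) (m : M) :
    crossHigh (k := k) M hjl hli
      (tmul j 1 (coord k N (j.val + 1) • tmul l 1 (tmul j 1 (tmul i 1 m)))) =
      tmul l 1 (tmul j 1 (tmul i 1 (tmul l 1 (coord k N (l.val + 1) • m)))) := by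
  rw [crossHigh, LinearMap.comp_apply, sixValent_coord_left hjl jl hl, Ind.map_tmul, Ind.map_tmul,
    fourValent_coord hli (by omega)]

/-- The last strand may start with the coordinate. -/
theorem crossLow_coord_right (hij : Adjacent i j) (hil : Distant i l) (m : M) :
    crossLow (k := k) M hij hil
      (tmul i 1 (tmul l 1 (tmul j 1 (coord k N (i.val + 1) • tmul i 1 m)))) =
      tmul l 1 (coord k N (j.val + 1) • tmul j 1 (tmul i 1 (tmul j 1 m))) := by
  rw [crossLow, LinearMap.comp_apply, fourValent_one, Ind.map_tmul,
    sixValent_coord_right hij ij (by omega)]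

theorem crossHigh_coord_right (hjl : Adjacent j l) (hli : Distant l i) (m : M) :
    crossHigh (k := k) M hjl hli
      (tmul j 1 (tmul l 1 (coord k N (j.val + 1) • tmul j 1 (tmul i 1 m)))) =
      coord k N (l.val + 1) • tmul l 1 (tmul j 1 (tmul i 1 (tmul l 1 m))) := by
  rw [crossHigh, LinearMap.comp_apply, sixValent_coord_right hjl jl hl, map_smul, Ind.map_tmul,
    Ind.map_tmul, fourValent_one]

end coord

end zamolodchikov

/-! ### The two sides of the Zamolodchikov relation and their naturality. -/

section zamolodchikov

open Ind (tmul kappa)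

variable {k : Type u} [Field k] {N : ℕ} {i j l : Fin N}

/-- The right action on an induced bimodule. -/
abbrev rightInd {M : Type u} [CommRing M] [Algebra (PolyRing k N) M] (i : Fin N)
    (ρ : PolyRing k N →+* M) : PolyRing k N →+* Ind k i M := (inner k i M).comp ρ

variable (M : Type u) [CommRing M] [Algebra (PolyRing k N) M] [NeZero (2 : k)]
variable {M' : Type u} [CommRing M'] [Algebra (PolyRing k N) M']

/-- One of the two ways from `i j i l j i` to `l j i l j l`. -/
def zamLeft (hij : Adjacent i j) (hil : Distant i l) (hjl : Adjacent j l) :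
    Ind k i (Ind k j (Ind k i (Ind k l (Ind k j (Ind k i M))))) →ₗ[PolyRing k N]
      Ind k l (Ind k j (Ind k i (Ind k l (Ind k j (Ind k l M))))) :=
  Ind.map l (Ind.map j (Ind.map i (sixValent M hjl))) ∘ₗ (crossLow _ hij hil ∘ₗ
    (Ind.map i (crossHigh _ hjl hil.swap) ∘ₗ Ind.map i (Ind.map j (crossLow M hij hil))))

/-- The other way from `i j i l j i` to `l j i l j l`. -/
def zamRight (hij : Adjacent i j) (hil : Distant i l) (hjl : Adjacent j l) :
    Ind k i (Ind k j (Ind k i (Ind k l (Ind k j (Ind k i M))))) →ₗ[PolyRing k N]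
      Ind k l (Ind k j (Ind k i (Ind k l (Ind k j (Ind k l M))))) :=
  crossHigh _ hjl hil.swap ∘ₗ Ind.map j (crossLow _ hij hil) ∘ₗ
    Ind.map j (Ind.map i (crossHigh M hjl hil.swap)) ∘ₗ sixValent _ hij

variable {M}

theorem square_comp {A B C A' B' C' : Type u} [AddCommGroup A] [AddCommGroup B] [AddCommGroup C]
    [AddCommGroup A'] [AddCommGroup B'] [AddCommGroup C'] [Module (PolyRing k N) A]
    [Module (PolyRing k N) B] [Module (PolyRing k N) C] [Module (PolyRing k N) A']
    [Module (PolyRing k N) B'] [Module (PolyRing k N) C']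
    {f : A →ₗ[PolyRing k N] B} {f' : A' →ₗ[PolyRing k N] B'} {g : B →ₗ[PolyRing k N] C}
    {g' : B' →ₗ[PolyRing k N] C'} {a : A →ₗ[PolyRing k N] A'} {b : B →ₗ[PolyRing k N] B'}
    {c : C →ₗ[PolyRing k N] C'} (h : f' ∘ₗ a = b ∘ₗ f) (h' : g' ∘ₗ b = c ∘ₗ g) :
    (g' ∘ₗ f') ∘ₗ a = c ∘ₗ (g ∘ₗ f) := by
  rw [LinearMap.comp_assoc, h, ← LinearMap.comp_assoc, h', LinearMap.comp_assoc]

theorem square_map (i : Fin N) {A B A' B' : Type u} [CommRing A] [CommRing B] [CommRing A']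
    [CommRing B'] [Algebra (PolyRing k N) A] [Algebra (PolyRing k N) B]
    [Algebra (PolyRing k N) A'] [Algebra (PolyRing k N) B']
    {f : A →ₗ[PolyRing k N] B} {f' : A' →ₗ[PolyRing k N] B'} {a : A →ₗ[PolyRing k N] A'}
    {b : B →ₗ[PolyRing k N] B'} (h : f' ∘ₗ a = b ∘ₗ f) :
    Ind.map i f' ∘ₗ Ind.map i a = Ind.map i b ∘ₗ Ind.map i f := by
  rw [← Ind.map_comp, h, Ind.map_comp]

theorem zamLeft_map (hij : Adjacent i j) (hil : Distant i l) (hjl : Adjacent j l)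
    {y y' : PolyRing k N} (hy : Ind.IsWeight i j y) (hy' : Ind.IsWeight j l y')
    (φ : M →ₗ[PolyRing k N] M') :
    zamLeft M' hij hil hjl ∘ₗ
        Ind.map i (Ind.map j (Ind.map i (Ind.map l (Ind.map j (Ind.map i φ))))) =
      Ind.map l (Ind.map j (Ind.map i (Ind.map l (Ind.map j (Ind.map l φ))))) ∘ₗ
        zamLeft M hij hil hjl :=
  square_comp (square_comp (square_comp (square_map i (square_map j (crossLow_map hij hil hy φ)))
    (square_map i (crossHigh_map hjl hil.swap hy' _))) (crossLow_map hij hil hy _))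
    (square_map l (square_map j (square_map i (sixValent_map hjl hy' φ))))

theorem zamRight_map (hij : Adjacent i j) (hil : Distant i l) (hjl : Adjacent j l)
    {y y' : PolyRing k N} (hy : Ind.IsWeight i j y) (hy' : Ind.IsWeight j l y')
    (φ : M →ₗ[PolyRing k N] M') :
    zamRight M' hij hil hjl ∘ₗ
        Ind.map i (Ind.map j (Ind.map i (Ind.map l (Ind.map j (Ind.map i φ))))) =
      Ind.map l (Ind.map j (Ind.map i (Ind.map l (Ind.map j (Ind.map l φ))))) ∘ₗ
        zamRight M hij hil hjl :=
  square_comp (square_comp (square_comp (sixValent_map hij hy _)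
    (square_map j (square_map i (crossHigh_map hjl hil.swap hy' φ))))
    (square_map j (crossLow_map hij hil hy _))) (crossHigh_map hjl hil.swap hy' _)

end zamolodchikov

/-! ### Both sides map to the subbimodule generated by 1. -/

section zamolodchikov

open Ind (tmul kappa)

variable {k : Type u} [Field k] [NeZero (2 : k)] {N : ℕ} {i j l : Fin N}
variable {M : Type u} [CommRing M] [Algebra (PolyRing k N) M]

theorem rightInd_apply (i : Fin N) (ρ : PolyRing k N →+* M) (r : PolyRing k N) :
    rightInd i ρ r = tmul i 1 (ρ r) := rfl

theorem Ind.exists_eq_one {i : Fin N} {x : PolyRing k N} (hx : refl k i x = x + X i)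
    (z : Ind k i M) : ∃ m m', z = tmul i 1 m + x • tmul i 1 m' := by
  induction z using Ind.induction with
  | zero => exact ⟨0, 0, by simp only [Ind.tmul_zero, smul_zero, add_zero]⟩
  | tmul p m =>
    refine ⟨(p + x * demazure i p) • m, -(demazure i p • m), ?_⟩
    rw [Ind.tmul_generators hx p m, sub_eq_add_neg, Ind.smul_tmul, mul_one]
    congr 1
    exact (TensorProduct.tmul_neg x _).symm
  | add x y hx hy =>
    obtain ⟨a, b, rfl⟩ := hx
    obtain ⟨c, d, rfl⟩ := hy
    exact ⟨a + c, b + d, by simp only [Ind.tmul_add, smul_add]; abel⟩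

theorem Ind.coord_smul {i : Fin N} (hi : i.val + 1 < N) {c : ℕ} (h : c ≠ i.val)
    (h' : c ≠ i.val + 1) (m : M) :
    coord k N c • tmul (k := k) i 1 m = tmul i 1 (coord k N c • m) :=
  (Ind.tmul_one_smul i (refl_coord hi h h') m).symm

theorem isUnitalRight_crossLow {ρ : PolyRing k N →+* M} (hij : Adjacent i j) (hil : Distant i l)
    {y : PolyRing k N} (hy : Ind.IsWeight i j y) :
    IsUnitalRight (rightInd i (rightInd l (rightInd j (rightInd i ρ))))
      (rightInd l (rightInd j (rightInd i (rightInd j ρ)))) (crossLow M hij hil) :=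
  ((isUnitalRight_sixValent hij hy).map l).comp
    (isUnitalRight_fourValent (ρ := rightInd j (rightInd i ρ)) hil)

theorem isUnitalRight_crossHigh {ρ : PolyRing k N →+* M} (hjl : Adjacent j l) (hli : Distant l i)
    {y : PolyRing k N} (hy : Ind.IsWeight j l y) :
    IsUnitalRight (rightInd j (rightInd l (rightInd j (rightInd i ρ))))
      (rightInd l (rightInd j (rightInd i (rightInd l ρ)))) (crossHigh M hjl hli) :=
  (((isUnitalRight_fourValent hli).map j).map l).comp
    (isUnitalRight_sixValent (ρ := rightInd i ρ) hjl hy)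

variable (ij : i.val + 1 = j.val) (jl : j.val + 1 = l.val) (hl : l.val + 1 < N)
include ij jl hl
variable {ρ : PolyRing k N →+* M}
variable (hρ : Function.Surjective ρ) (hρ' : ∀ a, ρ a = a • 1)
include hρ

/-- The generators go to `1 ⊗ 1 ⊗ 1 ⊗ m` and to 0, and the former are right multiples of 1 because
`ρ` is surjective. -/
theorem sixValent_mem_oneSpan (hij : Adjacent i j)
    (m : Ind k i (Ind k j (Ind k i M))) :
    sixValent M hij m ∈
      oneSpan (rightInd j (rightInd i (rightInd j ρ))) := by
  rw [← Submodule.Quotient.mk_eq_zero]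
  refine LinearMap.congr_fun (f := Submodule.mkQ _ ∘ₗ sixValent _ hij) (g := 0)
    (Ind.ext_adjacent hij (isWeight_coord ij (by omega)) (fun m => ?_) fun m => ?_) m
  · obtain ⟨m, rfl⟩ := hρ m
    rw [LinearMap.comp_apply, sixValent_one]
    exact (Submodule.Quotient.mk_eq_zero _).2 (mem_oneSpan _ m)
  · rw [LinearMap.comp_apply, sixValent_kappa, map_zero]; rfl

include hρ'

/-- The six-valent vertex is thin, and a slot of type `l` is added on its left. The coordinate with
index `l + 1` generates that slot and is untouched by `s_j` and `s_i`, so it reaches the right end.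
-/
theorem crossLow_mem_oneSpan (hij : Adjacent i j) (hil : Distant i l)
    (m : Ind k i (Ind k l (Ind k j (Ind k i M)))) :
    crossLow M hij hil m ∈ oneSpan (rightInd l (rightInd j (rightInd i
      (rightInd j ρ)))) := by
  refine IsUnitalRight.id.map_ind_mem (x := coord k N (l.val + 1)) (x' := coord k N (l.val + 1))
    (refl_coord_succ hl) ?_ (sixValent_mem_oneSpan ij jl hl hρ hij) _
  rw [Ind.one_eq, Ind.one_eq, Ind.one_eq, Ind.coord_smul, Ind.coord_smul, Ind.coord_smul]
  · simp only [rightInd_apply, hρ', LinearMap.id_apply]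
  all_goals omega

/-- The new slot is generated by the coordinate with index `j + 1`, which the crossing raises to `l
+ 1`; as such it passes the last letter `j`. -/
theorem crossHigh_mem_oneSpan (hij : Adjacent i j) (hil : Distant i l) (hjl : Adjacent j l)
    (m : Ind k j (Ind k i (Ind k l (Ind k j (Ind k i M))))) :
    (crossHigh (Ind k j M) hjl hil.swap ∘ₗ Ind.map j (crossLow M hij hil)) m ∈
      oneSpan (rightInd l (rightInd j (rightInd i
        (rightInd l (rightInd j ρ))))) := by
  refine (isUnitalRight_crossHigh (ρ := rightInd j ρ) hjl hil.swap
    (isWeight_coord jl hl)).map_ind_mem (x := coord k N (j.val + 1)) (x' := coord k N (l.val + 1))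
    (refl_coord_succ (by omega)) ?_ (crossLow_mem_oneSpan ij jl hl hρ hρ' hij hil) _
  simp only [Ind.one_eq]
  rw [crossHigh_coord ij jl hl, Ind.coord_smul]
  · simp only [rightInd_apply, hρ']
  all_goals omega

/-- The new slot is generated by the coordinate with index `i + 1`. It becomes `j + 1` in the low
crossing and `l + 1` in the final six-valent vertex, which brings it to the last factor. -/
theorem zamLeft_mem_oneSpan (hij : Adjacent i j) (hil : Distant i l) (hjl : Adjacent j l)
    (m : Ind k i (Ind k j (Ind k i (Ind k l (Ind k j (Ind k i M)))))) :
    zamLeft M hij hil hjl m ∈ oneSpan (rightInd l (rightInd j (rightInd i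
      (rightInd l (rightInd j (rightInd l ρ)))))) := by
  have H := ((((isUnitalRight_sixValent (ρ := ρ) hjl (isWeight_coord jl hl)).map i).map j).map l
    |>.comp (isUnitalRight_crossLow (ρ := rightInd l (rightInd j ρ)) hij hil
      (isWeight_coord ij (by omega)))).map_ind_mem (x := coord k N (i.val + 1))
    (x' := coord k N (l.val + 1)) (refl_coord_succ (by omega)) ?_
    (crossHigh_mem_oneSpan ij jl hl hρ hρ' hij hil hjl) m
  · rw [zamLeft]
    rw [← Ind.map_comp]
    exact H
  · simp only [Ind.one_eq]
    rw [LinearMap.comp_apply, crossLow_coord ij jl hl, Ind.map_tmul, Ind.map_tmul, Ind.map_tmul,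
      sixValent_coord_left hjl jl hl]
    simp only [rightInd_apply, hρ']

/-- On generators the first six-valent vertex produces either 0 or 1 in all its slots. It remains to
follow the slots of `l`, `j` and `i` through the three crossings. -/
theorem zamRight_mem_oneSpan (hij : Adjacent i j) (hil : Distant i l) (hjl : Adjacent j l)
    (m : Ind k i (Ind k j (Ind k i (Ind k l (Ind k j (Ind k i M)))))) :
    zamRight M hij hil hjl m ∈ oneSpan (rightInd l (rightInd j (rightInd i
      (rightInd l (rightInd j (rightInd l ρ)))))) := by
  set W : Submodule (PolyRing k N) (Ind k l (Ind k j (Ind k i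
      (Ind k l (Ind k j (Ind k l M))))))  := oneSpan (rightInd l (rightInd j (rightInd i
      (rightInd l (rightInd j (rightInd l ρ)))))) with hW
  -- `P v` says that the last two crossings bring `v`, a possible value after the first crossing,
  -- into `W`.
  let P (v : Ind k l (Ind k j (Ind k i (Ind k l M)))) : Prop :=
    crossHigh _ hjl hil.swap (tmul j 1 (crossLow _ hij hil (tmul i 1 v))) ∈ W
  have P_add (v w) (hv : P v) (hw : P w) : P (v + w) := by
    dsimp only [P] at hv hw ⊢
    rw [Ind.tmul_add, map_add, Ind.tmul_add, map_add]
    exact add_mem hv hw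
  -- The coordinate with index `l + 1` is untouched by `s_i` and `s_j`, so it commutes with both
  -- slots in front of `v` and leaves to the left.
  have P_smul (v) (hv : P v) : P (coord k N (l.val + 1) • v) := by
    dsimp only [P] at hv ⊢
    rw [← Ind.coord_smul, map_smul, ← Ind.coord_smul, map_smul]
    · exact Submodule.smul_mem _ _ hv
    all_goals omega
  have P_one (r) : P (tmul l 1 (tmul j 1 (tmul i 1 (tmul l 1 r)))) := by
    obtain ⟨r, rfl⟩ := hρ r
    dsimp only [P]
    rw [crossLow_one, crossHigh_one]
    exact mem_oneSpan _ r
  have P_coord (r) : P (tmul l 1 (tmul j 1 (coord k N (i.val + 1) • tmul i 1 (tmul l 1 r)))) := by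
    obtain ⟨r, rfl⟩ := hρ r
    dsimp only [P]
    rw [crossLow_coord_right ij jl hl, crossHigh_coord_right ij jl hl]
    exact Submodule.smul_mem _ _ (mem_oneSpan _ r)
  have P_inner (n) : P (Ind.map l (Ind.map j (fourValent M hil.swap))
      (tmul l 1 (tmul j 1 (tmul l 1 n)))) := by
    obtain ⟨r, r', rfl⟩ := Ind.exists_eq_one (refl_coord_succ (i := i) (by omega)) n
    rw [Ind.map_tmul, Ind.map_tmul, Ind.tmul_add l 1, ← Ind.coord_smul, map_add, map_smul,
      fourValent_one, fourValent_one, Ind.tmul_add, Ind.tmul_add]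
    · exact P_add _ _ (P_one r) (P_coord r')
    all_goals omega
  have P_six (n) : P (crossHigh _ hjl hil.swap (tmul j 1 (tmul l 1 n))) := by
    obtain ⟨r, r', rfl⟩ := Ind.exists_eq_one (refl_coord_succ (i := j) (by omega)) n
    rw [crossHigh, LinearMap.comp_apply, Ind.tmul_add l 1, Ind.tmul_add j 1, map_add, sixValent_one,
      sixValent_coord_right hjl jl hl, map_add, map_smul]
    exact P_add _ _ (P_inner r) (P_smul _ (P_inner r'))
  -- The slots are emptied from the left, each being generated by 1 and one coordinate; every
  -- coordinate produced on the way is either harmless by `P_smul` or covered by `P_coord`.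
  have P_all (n) : P (crossHigh _ hjl hil.swap (tmul j 1 n)) := by
    obtain ⟨r, r', rfl⟩ := Ind.exists_eq_one (refl_coord_succ (i := l) (by omega)) n
    rw [Ind.tmul_add j 1, ← Ind.coord_smul, map_add, map_smul]
    · exact P_add _ _ (P_six r) (P_smul _ (P_six r'))
    all_goals omega
  rw [← Submodule.Quotient.mk_eq_zero]
  refine LinearMap.congr_fun (f := Submodule.mkQ W ∘ₗ zamRight _ hij hil hjl) (g := 0)
    (Ind.ext_adjacent hij (isWeight_coord ij (by omega)) (fun m => ?_) fun m => ?_) m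
  · rw [zamRight, LinearMap.comp_apply, LinearMap.comp_apply, LinearMap.comp_apply,
      LinearMap.comp_apply, sixValent_one]
    exact (Submodule.Quotient.mk_eq_zero _).2 (P_all m)
  · rw [zamRight, LinearMap.comp_apply, LinearMap.comp_apply, LinearMap.comp_apply,
      LinearMap.comp_apply, sixValent_kappa, map_zero, map_zero, map_zero, map_zero]; rfl

end zamolodchikov

/-! ### Equality of the two sides. -/

section zamolodchikov

variable {k : Type u} [Field k] [NeZero (2 : k)] {N : ℕ} {i j l : Fin N}
variable {M : Type u} [CommRing M] [Algebra (PolyRing k N) M]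
theorem isNondegenerate_id :
    IsNondegenerate (LinearMap.id : PolyRing k N →ₗ[PolyRing k N] PolyRing k N) := fun m h => by
  simpa only [LinearMap.id_apply, mul_one] using h 1

variable (ij : i.val + 1 = j.val) (jl : j.val + 1 = l.val) (hl : l.val + 1 < N)
include ij jl hl

section adjoint

variable (t : M →ₗ[PolyRing k N] PolyRing k N) (ρ : PolyRing k N →+* M)

theorem exists_isAdjointPair_zamLeft (hij : Adjacent i j) (hil : Distant i l) (hjl : Adjacent j l) :
    ∃ g, IsAdjointPair (traceInd i (traceInd j (traceInd i (traceInd l (traceInd j (traceInd i t))))))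
      (rightInd i (rightInd j (rightInd i (rightInd l (rightInd j (rightInd i ρ))))))
      (traceInd l (traceInd j (traceInd i (traceInd l (traceInd j (traceInd l t))))))
      (rightInd l (rightInd j (rightInd i (rightInd l (rightInd j (rightInd l ρ))))))
      (zamLeft M hij hil hjl) g := by
  have hi := isWeight_coord (k := k) ij (by omega)
  have hi' := isWeight_neg_coord (k := k) ij (by omega)
  have hj := isWeight_coord (k := k) jl hl
  have hj' := isWeight_neg_coord (k := k) jl hl
  obtain ⟨g1, h1⟩ := exists_isAdjointPair_crossLow (t := t) (ρ := ρ) hij hil hi hi'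
  obtain ⟨g2, h2⟩ := exists_isAdjointPair_crossHigh (t := traceInd j t) (ρ := rightInd j ρ) hjl
    hil.swap hj hj'
  obtain ⟨g3, h3⟩ := exists_isAdjointPair_crossLow (t := traceInd l (traceInd j t))
    (ρ := rightInd l (rightInd j ρ)) hij hil hi hi'
  have h4 := isAdjointPair_sixValent (t := t) (ρ := ρ) hjl hjl.swap hj hj'
  exact ⟨_, (((h4.map i).map j).map l).comp (h3.comp ((h2.map i).comp ((h1.map j).map i)))⟩

theorem exists_isAdjointPair_zamRight (hij : Adjacent i j) (hil : Distant i l)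
    (hjl : Adjacent j l) :
    ∃ g, IsAdjointPair (traceInd i (traceInd j (traceInd i (traceInd l (traceInd j (traceInd i t))))))
      (rightInd i (rightInd j (rightInd i (rightInd l (rightInd j (rightInd i ρ))))))
      (traceInd l (traceInd j (traceInd i (traceInd l (traceInd j (traceInd l t))))))
      (rightInd l (rightInd j (rightInd i (rightInd l (rightInd j (rightInd l ρ))))))
      (zamRight M hij hil hjl) g := by
  have hi := isWeight_coord (k := k) ij (by omega)
  have hi' := isWeight_neg_coord (k := k) ij (by omega)
  have hj := isWeight_coord (k := k) jl hl
  have hj' := isWeight_neg_coord (k := k) jl hl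
  have h1 := isAdjointPair_sixValent (t := traceInd l (traceInd j (traceInd i t)))
    (ρ := rightInd l (rightInd j (rightInd i ρ))) hij hij.swap hi hi'
  obtain ⟨g2, h2⟩ := exists_isAdjointPair_crossHigh (t := t) (ρ := ρ) hjl hil.swap hj hj'
  obtain ⟨g3, h3⟩ := exists_isAdjointPair_crossLow (t := traceInd l t) (ρ := rightInd l ρ) hij hil
    hi hi'
  obtain ⟨g4, h4⟩ := exists_isAdjointPair_crossHigh (t := traceInd j (traceInd l t))
    (ρ := rightInd j (rightInd l ρ)) hjl hil.swap hj hj'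
  exact ⟨_, h4.comp ((h3.map j).comp (((h2.map i).map j).comp h1))⟩

/-- Both sides have unital adjoints and are thin, so the uniqueness of thin adjoint pairs applies
and no computation of the images is needed. -/
theorem zamLeft_eq_zamRight_of_surjective (ht : IsNondegenerate t) (hρ : Function.Surjective ρ)
    (hρ' : ∀ a, ρ a = a • 1) (hij : Adjacent i j) (hil : Distant i l) (hjl : Adjacent j l) :
    zamLeft (k := k) M hij hil hjl = zamRight M hij hil hjl := by
  obtain ⟨g, h⟩ := exists_isAdjointPair_zamLeft ij jl hl t ρ hij hil hjl
  obtain ⟨g', h'⟩ := exists_isAdjointPair_zamRight ij jl hl t ρ hij hil hjl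
  exact h.ext ((((((ht.traceInd l).traceInd j).traceInd l).traceInd i).traceInd j).traceInd l) h'
    (zamLeft_mem_oneSpan ij jl hl hρ hρ' hij hil hjl)
    (zamRight_mem_oneSpan ij jl hl hρ hρ' hij hil hjl)

end adjoint

variable (M) in
/-- The two ways from `i j i l j i` to `l j i l j l` coincide. -/
theorem zamLeft_eq_zamRight (hij : Adjacent i j) (hil : Distant i l) (hjl : Adjacent j l) :
    zamLeft (k := k) M hij hil hjl = zamRight M hij hil hjl := by
  have hi := isWeight_coord (k := k) ij (by omega)
  have hj := isWeight_coord (k := k) jl hl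
  have H := zamLeft_eq_zamRight_of_surjective ij jl hl LinearMap.id (RingHom.id (PolyRing k N))
    (isNondegenerate_id (k := k) (N := N)) Function.surjective_id (fun a => (mul_one a).symm) hij hil hjl
  -- Maps from the case `M = R` jointly cover the source; naturality of both sides then transports
  -- `H`.
  have S := Ind.iSup_range_map i _ <| Ind.iSup_range_map j _ <| Ind.iSup_range_map i _ <|
    Ind.iSup_range_map l _ <| Ind.iSup_range_map j _ <| Ind.iSup_range_map i _ <|
    iSup_range_toSpanSingleton (k := k) (N := N) (M := M)
  refine linearMap_ext_of_iSup_range S fun m => ?_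
  rw [zamLeft_map hij hil hjl hi hj, zamRight_map hij hil hjl hi hj, H]

end zamolodchikov

/-! ### Bott-Samelson bimodules with one additional variable -/

section extended

variable (k : Type u) [Field k] {n : ℕ}

/-- The Bott-Samelson bimodule of a word over the polynomial ring with one additional variable. The
symmetric group permutes the elements `coord k (n + 1) c` for `c ≤ n` of this ring. -/
def BX : List (Fin n) → CommAlgCat.{u} (PolyRing k (n + 1))
  | [] => CommAlgCat.of _ (PolyRing k (n + 1))
  | i :: w => CommAlgCat.of _ (Ind k i.castSucc (BX w))

/-- Linear maps between Bott-Samelson bimodules. -/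
abbrev Hom (x y : List (Fin n)) : Type u := BX k x →ₗ[PolyRing k (n + 1)] BX k y

namespace BX

/-- The right action. -/
def right : (w : List (Fin n)) → PolyRing k (n + 1) →+* BX k w
  | [] => RingHom.id _
  | i :: w => rightInd i.castSucc (right w)

/-- The trace. -/
def trace : (w : List (Fin n)) → BX k w →ₗ[PolyRing k (n + 1)] PolyRing k (n + 1)
  | [] => LinearMap.id
  | i :: w => traceInd i.castSucc (trace w)

theorem isNondegenerate_trace [NeZero (2 : k)] (w : List (Fin n)) :
    IsNondegenerate (trace k w) := by
  induction w with
  | nil => exact isNondegenerate_id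
  | cons i w ih => exact ih.traceInd _

variable {k}

/-- The element `1 ⊗ m`. -/
def one (i : Fin n) {x : List (Fin n)} (m : BX k x) : BX k (i :: x) :=
  Ind.tmul (k := k) i.castSucc 1 m

/-- The element `1 ⊗ ⋯ ⊗ 1 ⊗ m`. -/
def ones : (u : List (Fin n)) → {x : List (Fin n)} → BX k x → BX k (u ++ x)
  | [], _, m => m
  | i :: u, _, m => one i (ones u m)

/-- Tensoring a map with the identity of `B_i` on the left. -/
def map (i : Fin n) {x y : List (Fin n)} (f : Hom k x y) : Hom k (i :: x) (i :: y) :=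
  Ind.map i.castSucc f

/-- Tensoring a map with the identity of `B_u` on the left. -/
def whisker : (u : List (Fin n)) → {x y : List (Fin n)} → Hom k x y → Hom k (u ++ x) (u ++ y)
  | [], _, _, f => f
  | i :: u, _, _, f => map i (whisker u f)

variable {i j l : Fin n} {u v x y z : List (Fin n)}

theorem map_one_apply (f : Hom k x y) (m : BX k x) : map i f (one i m) = one i (f m) := rfl

theorem map_id (i : Fin n) : map i (LinearMap.id : Hom k x x) = LinearMap.id := Ind.map_id _

theorem map_comp (i : Fin n) (f : Hom k x y) (g : Hom k y z) :
    map i (g ∘ₗ f) = map i g ∘ₗ map i f := Ind.map_comp _ _ _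

theorem whisker_comp (u : List (Fin n)) (f : Hom k x y) (g : Hom k y z) :
    whisker u (g ∘ₗ f) = whisker u g ∘ₗ whisker u f := by
  induction u with
  | nil => rfl
  | cons i u ih => rw [whisker, ih, map_comp]; rfl

theorem whisker_id (u : List (Fin n)) : whisker u (LinearMap.id : Hom k x x) = LinearMap.id := by
  induction u with
  | nil => rfl
  | cons i u ih => rw [whisker, ih, map_id]

theorem one_one : one i (1 : BX k x) = 1 := (Ind.one_eq _).symm

theorem ones_one : ones u (1 : BX k x) = 1 := by
  induction u with
  | nil => rfl
  | cons i u ih => rw [ones, ih, one_one]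

theorem right_append (r : PolyRing k (n + 1)) : right k (u ++ x) r = ones u (right k x r) := by
  induction u with
  | nil => rfl
  | cons i u ih =>
    change one i (right k (u ++ x) r) = _
    rw [ih]
    rfl

theorem right_cons (r : PolyRing k (n + 1)) : right k (i :: x) r = one i (right k x r) := rfl

variable [NeZero (2 : k)]

/-- The four-valent vertex. -/
def four (h : Distant i j) (v : List (Fin n)) : Hom k (i :: j :: v) (j :: i :: v) :=
  fourValent (i := i.castSucc) (j := j.castSucc) (BX k v) h

/-- The six-valent vertex. -/
def six (h : Adjacent i j) (v : List (Fin n)) : Hom k (i :: j :: i :: v) (j :: i :: j :: v) :=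
  sixValent (i := i.castSucc) (j := j.castSucc) (BX k v) h

/-- This is the purpose of the additional variable: no letter is the last index of the larger ring.
For `n = 2` in characteristic 3 no weight exists in the original variables. -/
theorem exists_weight (h : Adjacent i j) :
    ∃ y, Ind.IsWeight (k := k) i.castSucc j.castSucc y :=
  exists_isWeight (i := i.castSucc) (j := j.castSucc) h (by simp) (by simp)

theorem four_map (h : Distant i j) (f : Hom k x y) :
    four h y ∘ₗ map i (map j f) = map j (map i f) ∘ₗ four h x := fourValent_map _ _

theorem six_map (h : Adjacent i j) (f : Hom k x y) :
    six h y ∘ₗ map i (map j (map i f)) = map j (map i (map j f)) ∘ₗ six h x := by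
  obtain ⟨w, hw⟩ := exists_weight (k := k) h
  exact sixValent_map _ hw _

theorem four_four (h : Distant i j) (h' : Distant j i) (v : List (Fin n)) :
    four (k := k) h' v ∘ₗ four h v = LinearMap.id := fourValent_fourValent _ _

theorem hexagon (hij : Distant i j) (hil : Distant i l) (hjl : Distant j l) :
    four hjl (i :: v) ∘ₗ map j (four hil v) ∘ₗ four (k := k) hij (l :: v) =
      map l (four hij v) ∘ₗ four hil (j :: v) ∘ₗ map i (four hjl v) := fourValent_hexagon _ _ _

theorem six_pass (h : Adjacent i j) (hi : Distant i l) (hj : Distant j l) :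
    (four hj _ ∘ₗ map j (four hi _) ∘ₗ map j (map i (four hj v))) ∘ₗ six (k := k) h (l :: v) =
      map l (six h v) ∘ₗ four hi _ ∘ₗ map i (four hj _) ∘ₗ map i (map j (four hi _)) := by
  obtain ⟨w, hw⟩ := exists_weight (k := k) h
  exact sixValent_passLeft _ _ _ hw

/-- For consecutive `i`, `j`, `l`, the strand `i` crosses the strands `l`, `j`, `i` from the left. -/
def low (hij : Adjacent i j) (hil : Distant i l) (v : List (Fin n)) :
    Hom k (i :: l :: j :: i :: v) (l :: j :: i :: j :: v) :=
  map l (six hij v) ∘ₗ four hil (j :: i :: v)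

/-- For consecutive `i`, `j`, `l`, the strand `j` crosses the strands `l`, `j`, `i` from the left. -/
def high (hjl : Adjacent j l) (hli : Distant l i) (v : List (Fin n)) :
    Hom k (j :: l :: j :: i :: v) (l :: j :: i :: l :: v) :=
  map l (map j (four hli v)) ∘ₗ six hjl (i :: v)

theorem low_map (hij : Adjacent i j) (hil : Distant i l) (f : Hom k x y) :
    low hij hil y ∘ₗ map i (map l (map j (map i f))) =
      map l (map j (map i (map j f))) ∘ₗ low hij hil x := by
  obtain ⟨w, hw⟩ := exists_weight (k := k) hij
  exact crossLow_map _ _ hw _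

theorem high_map (hjl : Adjacent j l) (hli : Distant l i) (f : Hom k x y) :
    high hjl hli y ∘ₗ map j (map l (map j (map i f))) =
      map l (map j (map i (map l f))) ∘ₗ high hjl hli x := by
  obtain ⟨w, hw⟩ := exists_weight (k := k) hjl
  exact crossHigh_map _ _ hw _

theorem zam (ij : i.val + 1 = j.val) (jl : j.val + 1 = l.val) (hij : Adjacent i j)
    (hil : Distant i l) (hjl : Adjacent j l) (v : List (Fin n)) :
    map l (map j (map i (six (k := k) hjl v))) ∘ₗ (low hij hil _ ∘ₗ
      (map i (high hjl hil.swap _) ∘ₗ map i (map j (low hij hil v)))) =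
    high hjl hil.swap _ ∘ₗ map j (low hij hil _) ∘ₗ map j (map i (high hjl hil.swap v)) ∘ₗ
      six hij _ :=
  zamLeft_eq_zamRight (i := i.castSucc) (j := j.castSucc) (l := l.castSucc) (BX k v) ij jl
    (by simp) _ _ _

/-- An adjoint pair of maps between Bott-Samelson bimodules. -/
abbrev AdjointPair (f : Hom k x y) (g : Hom k y x) : Prop :=
  IsAdjointPair (trace k x) (right k x) (trace k y) (right k y) f g

theorem AdjointPair.map {f : Hom k x y} {g : Hom k y x} (h : AdjointPair f g) (i : Fin n) :
    AdjointPair (map i f) (map i g) := IsAdjointPair.map h _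

theorem AdjointPair.whisker {f : Hom k x y} {g : Hom k y x} (h : AdjointPair f g)
    (u : List (Fin n)) : AdjointPair (whisker u f) (whisker u g) := by
  induction u with
  | nil => exact h
  | cons i u ih => exact AdjointPair.map ih i

theorem adjointPair_four (h : Distant i j) (h' : Distant j i) :
    AdjointPair (four h v) (four (k := k) h' v) :=
  isAdjointPair_fourValent (t := trace k v) (ρ := right k v) h h'

theorem adjointPair_six (h : Adjacent i j) (h' : Adjacent j i) :
    AdjointPair (six h v) (six (k := k) h' v) := by
  obtain ⟨w, hw⟩ := exists_weight (k := k) h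
  obtain ⟨w', hw'⟩ := exists_weight (k := k) h'
  exact isAdjointPair_sixValent (t := trace k v) (ρ := right k v) _ _ hw hw'

theorem four_coord (h : Distant i j) (m : BX k v) :
    four h v (one i (coord k (n + 1) (i.val + 1) • one j m)) =
      one j (one i (coord k (n + 1) (i.val + 1) • m)) :=
  fourValent_coord (i := i.castSucc) (a := j.castSucc) h (by simp) m

theorem six_coord (h : Adjacent i j) (hij : i.val + 1 = j.val) (m : BX k v) :
    six h v (one i (coord k (n + 1) (i.val + 1) • one j (one i m))) =
      one j (one i (one j (coord k (n + 1) (j.val + 1) • m))) :=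
  sixValent_coord_left (i := i.castSucc) (j := j.castSucc) h hij (by simp) m

theorem coord_smul_one {c : ℕ} (h : c ≠ i.val) (h' : c ≠ i.val + 1) (m : BX k x) :
    coord k (n + 1) c • one i m = one i (coord k (n + 1) c • m) :=
  Ind.coord_smul (i := i.castSucc) (by simp) h h' m

end BX

end extended

/-! ### Path morphisms with one additional variable -/

section pathMorphisms

variable {n : ℕ}

/-- The same edge with a letter added on the left. -/
def Edge.consLeft (a : Fin n) {x y : List (Fin n)} : Edge x y → Edge (a :: x) (a :: y)
  | distant u v i j h => distant (a :: u) v i j h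
  | adjacent u v i j h => adjacent (a :: u) v i j h

theorem Edge.isOriented_consLeft (a : Fin n) {x y : List (Fin n)} (e : Edge x y) :
    (e.consLeft a).IsOriented ↔ e.IsOriented := by
  cases e <;> rfl

/-- Distant edges. -/
def Edge.IsDistant {x y : List (Fin n)} : Edge x y → Prop
  | distant _ _ _ _ _ => True
  | adjacent _ _ _ _ _ => False

namespace Path

/-- The same path with a letter added on the left. -/
def consLeft (a : Fin n) {x y : List (Fin n)} : Path x y → Path (a :: x) (a :: y)
  | nil _ => nil _
  | cons e p => cons (e.consLeft a) (p.consLeft a)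

/-- The same path with a word added on the left. -/
def appendLeft : (u : List (Fin n)) → {x y : List (Fin n)} → Path x y → Path (u ++ x) (u ++ y)
  | [], _, _, p => p
  | a :: u, _, _, p => (appendLeft u p).consLeft a

theorem IsOriented.consLeft (a : Fin n) {x y : List (Fin n)} {p : Path x y} (h : p.IsOriented) :
    (p.consLeft a).IsOriented := by
  induction p with
  | nil => trivial
  | cons e p ih => exact ⟨(e.isOriented_consLeft a).2 h.1, ih h.2⟩

theorem IsOriented.appendLeft (u : List (Fin n)) {x y : List (Fin n)} {p : Path x y}
    (h : p.IsOriented) : (p.appendLeft u).IsOriented := by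
  induction u with
  | nil => exact h
  | cons a u ih => exact ih.consLeft a

theorem IsOriented.append {x y z : List (Fin n)} {p : Path x y} {q : Path y z}
    (hp : p.IsOriented) (hq : q.IsOriented) : (p.append q).IsOriented := by
  induction p with
  | nil => exact hq
  | cons e p ih => exact ⟨hp.1, ih hp.2 hq⟩

/-- Paths that consist of distant edges. -/
def IsDistant {x y : List (Fin n)} : Path x y → Prop
  | nil _ => True
  | cons e p => e.IsDistant ∧ p.IsDistant

theorem append_assoc {w x y z : List (Fin n)} (p : Path w x) (q : Path x y) (r : Path y z) :
    (p.append q).append r = p.append (q.append r) := by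
  induction p with
  | nil => rfl
  | cons e p ih => exact congrArg _ (ih q)

theorem append_nil {x y : List (Fin n)} (p : Path x y) : p.append (nil y) = p := by
  induction p with
  | nil => rfl
  | cons e p ih => exact congrArg _ ih

theorem reverse_append {x y z : List (Fin n)} (p : Path x y) (q : Path y z) :
    (p.append q).reverse = q.reverse.append p.reverse := by
  induction p with
  | nil => exact (append_nil _).symm
  | cons e p ih =>
    change (p.append q).reverse.append _ = q.reverse.append (p.reverse.append _)
    rw [ih, append_assoc]

theorem reverse_reverse {x y : List (Fin n)} (p : Path x y) : p.reverse.reverse = p := by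
  induction p with
  | nil => rfl
  | cons e p ih =>
    change (p.reverse.append (cons e.reverse (nil _))).reverse = _
    rw [reverse_append, ih]
    have : e.reverse.reverse = e := by cases e <;> rfl
    change cons e.reverse.reverse p = _
    rw [this]

end Path

variable (k : Type u) [Field k] [NeZero (2 : k)]

/-- The morphism of an edge. -/
def Edge.hom {x y : List (Fin n)} : Edge x y → Hom k x y
  | distant u v _ _ h => BX.whisker u (BX.four h v)
  | adjacent u v _ _ h => BX.whisker u (BX.six h v)

/-- The morphism of a path. -/
def Path.hom {x y : List (Fin n)} : Path x y → Hom k x y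
  | nil _ => LinearMap.id
  | cons e p => p.hom ∘ₗ e.hom k

variable {k}
variable {x y z : List (Fin n)}

theorem Edge.hom_consLeft (a : Fin n) (e : Edge x y) :
    (e.consLeft a).hom k = BX.map a (e.hom k) := by
  cases e <;> rfl

theorem Edge.adjointPair (e : Edge x y) : BX.AdjointPair (e.hom k) (e.reverse.hom k) := by
  cases e with
  | distant u v i j h => exact (BX.adjointPair_four h h.swap).whisker u
  | adjacent u v i j h => exact (BX.adjointPair_six h h.swap).whisker u

namespace Path

theorem hom_consLeft (a : Fin n) (p : Path x y) : (p.consLeft a).hom k = BX.map a (p.hom k) := by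
  induction p with
  | nil => exact (BX.map_id a).symm
  | cons e p ih =>
    rw [hom, BX.map_comp, ← ih, ← Edge.hom_consLeft]; rfl

theorem hom_appendLeft (u : List (Fin n)) (p : Path x y) :
    (p.appendLeft u).hom k = BX.whisker u (p.hom k) := by
  induction u with
  | nil => rfl
  | cons a u ih => rw [appendLeft, hom_consLeft, ih]; rfl

theorem hom_append (p : Path x y) (q : Path y z) : (p.append q).hom k = q.hom k ∘ₗ p.hom k := by
  induction p with
  | nil => rfl
  | cons e p ih => rw [append, hom, ih, hom, LinearMap.comp_assoc]

/-- Adjoint pairs compose, with the order of the adjoints reversed, which is exactly how a path is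
reversed. -/
theorem adjointPair (p : Path x y) : BX.AdjointPair (p.hom k) (p.reverse.hom k) := by
  induction p with
  | nil => exact .id
  | cons e p ih =>
    rw [reverse, hom_append]
    exact IsAdjointPair.comp ih e.adjointPair

theorem hom_reverse_comp (p : Path x y) (hp : p.IsDistant) :
    p.reverse.hom k ∘ₗ p.hom k = LinearMap.id := by
  induction p with
  | nil => rfl
  | cons e p ih =>
    have he : e.reverse.hom k ∘ₗ e.hom k = LinearMap.id := by
      cases e with
      | distant u v i j h =>
        change BX.whisker u (BX.four h.swap v) ∘ₗ BX.whisker u (BX.four h v) = _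
        rw [← BX.whisker_comp, BX.four_four, BX.whisker_id]
      | adjacent u v i j h => exact hp.1.elim
    rw [reverse, hom_append]
    change (LinearMap.id ∘ₗ e.reverse.hom k) ∘ₗ (p.reverse.hom k ∘ₗ (p.hom k ∘ₗ e.hom k)) = _
    rw [← LinearMap.comp_assoc (e.hom k), ih hp.2, LinearMap.id_comp, LinearMap.id_comp, he]

/-- A path morphism into the subbimodule generated by `1` is determined by its ends. -/
theorem hom_eq (p q : Path x y) (hp : ∀ m, p.hom k m ∈ oneSpan (BX.right k y))
    (hq : ∀ m, q.hom k m ∈ oneSpan (BX.right k y)) : p.hom k = q.hom k :=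
  p.adjointPair.ext (BX.isNondegenerate_trace k y) q.adjointPair hp hq

end Path

end pathMorphisms

/-! ### Compatibility of vertices with several strands in motion. -/

section relations

variable {k : Type u} [Field k] {n : ℕ} {i j l a : Fin n}

namespace BX

theorem comp_assoc {w x y z : List (Fin n)} (f : Hom k w x) (g : Hom k x y) (h : Hom k y z) :
    (h ∘ₗ g) ∘ₗ f = h ∘ₗ g ∘ₗ f :=
  LinearMap.ext fun _ => rfl

theorem id_comp {x y : List (Fin n)} (f : Hom k x y) : LinearMap.id ∘ₗ f = f :=
  LinearMap.ext fun _ => rfl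

theorem comp_id {x y : List (Fin n)} (f : Hom k x y) : f ∘ₗ LinearMap.id = f :=
  LinearMap.ext fun _ => rfl

theorem square_map (i : Fin n) {x y x' y' : List (Fin n)} {f : Hom k x y} {f' : Hom k x' y'}
    {p : Hom k x x'} {q : Hom k y y'} (h : f' ∘ₗ p = q ∘ₗ f) :
    map i f' ∘ₗ map i p = map i q ∘ₗ map i f := by
  rw [← map_comp, h, map_comp]

variable [NeZero (2 : k)] {w x y z x' y' z' : List (Fin n)}

theorem four_map_assoc (h : Distant i j) (f : Hom k x y) (g : Hom k w (i :: j :: x)) :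
    four h y ∘ₗ map i (map j f) ∘ₗ g = map j (map i f) ∘ₗ four h x ∘ₗ g := by
  rw [← comp_assoc, four_map, comp_assoc]

theorem six_map_assoc (h : Adjacent i j) (f : Hom k x y) (g : Hom k w (i :: j :: i :: x)) :
    six h y ∘ₗ map i (map j (map i f)) ∘ₗ g = map j (map i (map j f)) ∘ₗ six h x ∘ₗ g := by
  rw [← comp_assoc, six_map, comp_assoc]

theorem low_map_assoc (hij : Adjacent i j) (hil : Distant i l) (f : Hom k x y)
    (g : Hom k w (i :: l :: j :: i :: x)) : low hij hil y ∘ₗ map i (map l (map j (map i f))) ∘ₗ g =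
      map l (map j (map i (map j f))) ∘ₗ low hij hil x ∘ₗ g := by
  rw [← comp_assoc, low_map, comp_assoc]

theorem high_map_assoc (hjl : Adjacent j l) (hli : Distant l i) (f : Hom k x y)
    (g : Hom k w (j :: l :: j :: i :: x)) : high hjl hli y ∘ₗ map j (map l (map j (map i f))) ∘ₗ g =
      map l (map j (map i (map l f))) ∘ₗ high hjl hli x ∘ₗ g := by
  rw [← comp_assoc, high_map, comp_assoc]

/-- Three strands that pass a distant strand. -/
theorem swap_three (hi : Distant i a) (hj : Distant j a) (f₁ : Hom k (i :: w) x)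
    (f₂ : Hom k (j :: x) y) (f₃ : Hom k (i :: y) z) :
    (map a f₃ ∘ₗ four hi y) ∘ₗ map i (map a f₂ ∘ₗ four hj x) ∘ₗ
        map i (map j (map a f₁ ∘ₗ four hi w)) =
      map a (f₃ ∘ₗ map i f₂ ∘ₗ map i (map j f₁)) ∘ₗ
        four hi _ ∘ₗ map i (four hj _) ∘ₗ map i (map j (four hi w)) := by
  have e : map i (four hj x) ∘ₗ map i (map j (map a f₁)) =
      map i (map a (map j f₁)) ∘ₗ map i (four hj (i :: w)) :=
    square_map i (four_map hj f₁)
  simp only [map_comp, comp_assoc]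
  rw [← comp_assoc _ _ (map i (four hj x)), e, comp_assoc, four_map_assoc,
    four_map_assoc]

/-- The braid relation of three strands that pass a distant strand. -/
theorem adj_swap (hij : Adjacent i j) (hi : Distant i a) (hj : Distant j a)
    {f₁ : Hom k (i :: w) x} {f₂ : Hom k (j :: x) y} {f₃ : Hom k (i :: y) z} {q : Hom k z z'}
    {g₁ : Hom k (j :: w) x'} {g₂ : Hom k (i :: x') y'} {g₃ : Hom k (j :: y') z'}
    (h : q ∘ₗ f₃ ∘ₗ map i f₂ ∘ₗ map i (map j f₁) = g₃ ∘ₗ map j g₂ ∘ₗ map j (map i g₁) ∘ₗ six hij w) :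
    map a q ∘ₗ (map a f₃ ∘ₗ four hi y) ∘ₗ map i (map a f₂ ∘ₗ four hj x) ∘ₗ
        map i (map j (map a f₁ ∘ₗ four hi w)) =
      (map a g₃ ∘ₗ four hj y') ∘ₗ map j (map a g₂ ∘ₗ four hi x') ∘ₗ
        map j (map i (map a g₁ ∘ₗ four hj w)) ∘ₗ six hij (a :: w) := by
  have e := congrArg (fun f => map a f) h
  have e1 := six_pass (k := k) (v := w) hij hi hj
  have e2 := swap_three hj hi g₁ g₂ g₃
  have e3 := congrArg (fun f => f ∘ₗ six hij (a :: w)) e2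
  rw [swap_three]
  simp only [map_comp, comp_assoc] at e e1 e3 ⊢
  rw [e3, e1]
  simp only [← comp_assoc] at e ⊢
  rw [e]

/-- The braid relation of three strands that cross three consecutive strands. -/
theorem adj_braid (ij : i.val + 1 = j.val) (jl : j.val + 1 = l.val) (hij : Adjacent i j)
    (hil : Distant i l) (hjl : Adjacent j l) (hli : Distant l i)
    {f₁ : Hom k (j :: w) x} {f₂ : Hom k (l :: x) y} {f₃ : Hom k (j :: y) z} {q : Hom k z z'}
    {g₁ : Hom k (l :: w) x'} {g₂ : Hom k (j :: x') y'} {g₃ : Hom k (l :: y') z'}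
    (h : q ∘ₗ f₃ ∘ₗ map j f₂ ∘ₗ map j (map l f₁) = g₃ ∘ₗ map l g₂ ∘ₗ map l (map j g₁) ∘ₗ six hjl w) :
    map l (map j (map i q)) ∘ₗ (map l (map j (map i f₃) ∘ₗ six hij y) ∘ₗ four hil _) ∘ₗ
        map i (map l (map j (map i f₂ ∘ₗ four hli x)) ∘ₗ six hjl _) ∘ₗ
        map i (map j (map l (map j (map i f₁) ∘ₗ six hij w) ∘ₗ four hil _)) =
      (map l (map j (map i g₃ ∘ₗ four hli y')) ∘ₗ six hjl _) ∘ₗ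
        map j (map l (map j (map i g₂) ∘ₗ six hij x') ∘ₗ four hil _) ∘ₗ
        map j (map i (map l (map j (map i g₁ ∘ₗ four hli w)) ∘ₗ six hjl _)) ∘ₗ six hij _ := by
  have low_eq {s t} (f : Hom k (j :: s) t) : map l (map j (map i f) ∘ₗ six hij s) ∘ₗ four hil _ =
      map l (map j (map i f)) ∘ₗ low hij hil s := by
    rw [low, map_comp, comp_assoc]
  have high_eq {s t} (f : Hom k (l :: s) t) : map l (map j (map i f ∘ₗ four hli s)) ∘ₗ six hjl _ =
      map l (map j (map i f)) ∘ₗ high hjl hli s := by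
    rw [high, map_comp, map_comp, comp_assoc]
  rw [low_eq, low_eq, low_eq, high_eq, high_eq, high_eq]
  -- Naturality moves the continuations `f₁`, `f₂`, `f₃` and `g₁`, `g₂`, `g₃` behind the crossings.
  -- What remains is the Zamolodchikov relation in front and the hypothesis `h` behind it.
  have z := zam (k := k) ij jl hij hil hjl w
  have e1 : map i (high hjl hli x) ∘ₗ map i (map j (map l (map j (map i f₁)))) =
      map i (map l (map j (map i (map l f₁)))) ∘ₗ map i (high hjl hli _) :=
    square_map i (high_map hjl hli f₁)
  have e2 : map j (low hij hil x') ∘ₗ map j (map i (map l (map j (map i g₁)))) =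
      map j (map l (map j (map i (map j g₁)))) ∘ₗ map j (low hij hil _) :=
    square_map j (low_map hij hil g₁)
  have e3 := congrArg (fun f => map l (map j (map i f))) h
  simp only [map_comp, comp_assoc] at e3 z ⊢
  rw [← comp_assoc _ _ (map i (high hjl hli x)), e1, comp_assoc,
    low_map_assoc, low_map_assoc, ← comp_assoc _ _ (map j (low hij hil x')), e2,
    comp_assoc, high_map_assoc, high_map_assoc, ← z]
  simp only [← comp_assoc] at e3 ⊢
  rw [e3]

/-- Two distant strands that pass a distant strand. -/
theorem dist_swap (hij : Distant i j) (hi : Distant i a) (hj : Distant j a)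
    {f₁ : Hom k (j :: w) x} {f₂ : Hom k (i :: x) y} {q : Hom k y z}
    {g₁ : Hom k (i :: w) x'} {g₂ : Hom k (j :: x') z}
    (h : q ∘ₗ f₂ ∘ₗ map i f₁ = g₂ ∘ₗ map j g₁ ∘ₗ four hij w) :
    map a q ∘ₗ (map a f₂ ∘ₗ four hi x) ∘ₗ map i (map a f₁ ∘ₗ four hj w) =
      (map a g₂ ∘ₗ four hj x') ∘ₗ map j (map a g₁ ∘ₗ four hi w) ∘ₗ four hij (a :: w) := by
  have e := congrArg (fun f => map a f) h
  have hex := hexagon (k := k) (v := w) hij hi hj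
  simp only [map_comp, comp_assoc] at e ⊢
  rw [four_map_assoc, four_map_assoc, hex]
  simp only [← comp_assoc] at e ⊢
  rw [e]

end BX

end relations

/-! ### A strand that crosses a word -/

section cross

variable {k : Type u} [Field k] [NeZero (2 : k)] {n : ℕ}

theorem Adjacent.of_succ {i j : Fin n} (h : i.val + 1 = j.val) : Adjacent i j := Or.inl h

/-- The morphism `f` moves the letter `i` from the left to the right of the word `u`, where it
becomes the letter `i'`, by distant and oriented adjacent edges. -/
inductive Cross : (i : Fin n) → (u v : List (Fin n)) → (i' : Fin n) →
    Hom k (i :: (u ++ v)) (u ++ i' :: v) → Prop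
  | nil (i : Fin n) (v : List (Fin n)) : Cross i [] v i LinearMap.id
  | swap {i a i' : Fin n} {u v : List (Fin n)} {f : Hom k (i :: (u ++ v)) (u ++ i' :: v)}
      (h : Distant i a) (hf : Cross i u v i' f) :
      Cross i (a :: u) v i' (BX.map a f ∘ₗ BX.four h (u ++ v))
  | braid {i j j' : Fin n} {u v : List (Fin n)} {f : Hom k (j :: (u ++ v)) (u ++ j' :: v)}
      (h : i.val + 1 = j.val) (hf : Cross j u v j' f) :
      Cross i (j :: i :: u) v j' (BX.map j (BX.map i f) ∘ₗ BX.six (.of_succ h) (u ++ v))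

variable {i j i' j' : Fin n} {u v : List (Fin n)}

/-- The first letter of `u` decides between passing and braiding, so the letter on exit depends only
on `i` and `u` and not on what follows. -/
theorem Cross.det {i'' : Fin n} {v' : List (Fin n)} {f : Hom k (i :: (u ++ v)) (u ++ i' :: v)}
    (hf : Cross i u v i' f) {f' : Hom k (i :: (u ++ v')) (u ++ i'' :: v')}
    (hf' : Cross i u v' i'' f') : i' = i'' := by
  induction hf with
  | nil => cases hf'; rfl
  | swap h _ ih =>
    cases hf' with
    | swap h' hf' => exact ih hf'
    | braid h' hf' => exact absurd h (by simp only [Distant]; omega)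
  | braid h _ ih =>
    cases hf' with
    | swap h' hf' => exact absurd h' (by simp only [Distant]; omega)
    | braid h' hf' => exact ih hf'

end cross

/-! ### Crossing a word commutes with the braid and commutation relations. -/

section cross

variable {k : Type u} [Field k] [NeZero (2 : k)] {n : ℕ}
variable {i j i' j' : Fin n} {u v : List (Fin n)}

theorem BX.square_comp {x y z x' y' z' : List (Fin n)} {f : Hom k x y} {f' : Hom k x' y'}
    {g : Hom k y z} {g' : Hom k y' z'} {p : Hom k x x'} {q : Hom k y y'} {r : Hom k z z'}
    (h : f' ∘ₗ p = q ∘ₗ f) (h' : g' ∘ₗ q = r ∘ₗ g) : (g' ∘ₗ f') ∘ₗ p = r ∘ₗ (g ∘ₗ f) := by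
  rw [comp_assoc, h, ← comp_assoc, h', comp_assoc]

/-- A crossing never acts on `v`: it is available for every continuation and commutes with all
morphisms between continuations, in both directions. -/
theorem Cross.natural {f : Hom k (i :: (u ++ v)) (u ++ i' :: v)} (hf : Cross i u v i' f)
    (v' : List (Fin n)) : ∃ f' : Hom k (i :: (u ++ v')) (u ++ i' :: v'), Cross i u v' i' f' ∧
      (∀ φ : Hom k v v', f' ∘ₗ BX.map i (BX.whisker u φ) = BX.whisker u (BX.map i' φ) ∘ₗ f) ∧
      ∀ φ : Hom k v' v, f ∘ₗ BX.map i (BX.whisker u φ) = BX.whisker u (BX.map i' φ) ∘ₗ f' := by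
  induction hf with
  | nil i v => exact ⟨_, .nil i v', fun φ => rfl, fun φ => rfl⟩
  | swap h hf ih =>
    obtain ⟨f', hf', h1, h2⟩ := ih
    exact ⟨_, .swap h hf', fun φ => BX.square_comp (BX.four_map h _) (BX.square_map _ (h1 φ)),
      fun φ => BX.square_comp (BX.four_map h _) (BX.square_map _ (h2 φ))⟩
  | braid h hf ih =>
    obtain ⟨f', hf', h1, h2⟩ := ih
    exact ⟨_, .braid h hf',
      fun φ => BX.square_comp (BX.six_map (.of_succ h) _) (BX.square_map _ (BX.square_map _ (h1 φ))),
      fun φ => BX.square_comp (BX.six_map (.of_succ h) _) (BX.square_map _ (BX.square_map _ (h2 φ)))⟩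

theorem Cross.adj_nil (h : i.val + 1 = j.val) {f₁ : Hom k (i :: v) (i' :: v)}
    {f₂ : Hom k (j :: (i' :: v)) (j' :: i' :: v)}
    {f₃ : Hom k (i :: (j' :: i' :: v)) (i' :: j' :: i' :: v)}
    (c₁ : Cross i [] v i' f₁) (c₂ : Cross j [] (i' :: v) j' f₂)
    (c₃ : Cross i [] (j' :: i' :: v) i' f₃) :
    ∃ (h' : i'.val + 1 = j'.val) (g₁ : Hom k (j :: v) (j' :: v))
      (g₂ : Hom k (i :: (j' :: v)) (i' :: j' :: v))
      (g₃ : Hom k (j :: (i' :: j' :: v)) (j' :: i' :: j' :: v)),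
      Cross j [] v j' g₁ ∧ Cross i [] (j' :: v) i' g₂ ∧ Cross j [] (i' :: j' :: v) j' g₃ ∧
      BX.six (.of_succ h') v ∘ₗ f₃ ∘ₗ BX.map i f₂ ∘ₗ BX.map i (BX.map j f₁) =
        g₃ ∘ₗ BX.map j g₂ ∘ₗ BX.map j (BX.map i g₁) ∘ₗ BX.six (.of_succ h) v := by
  cases c₁
  cases c₂
  cases c₃
  refine ⟨h, _, _, _, .nil _ _, .nil _ _, .nil _ _, ?_⟩
  simp only [BX.map_id, BX.id_comp, BX.comp_id]

/-- The braid relation commutes with crossing a word. -/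
theorem Cross.adj {m : ℕ} (hm : u.length ≤ m) (h : i.val + 1 = j.val) {f₁ : Hom k (i :: (u ++ v)) (u ++ i' :: v)}
    {f₂ : Hom k (j :: (u ++ i' :: v)) (u ++ j' :: i' :: v)}
    {f₃ : Hom k (i :: (u ++ j' :: i' :: v)) (u ++ i' :: j' :: i' :: v)}
    (c₁ : Cross i u v i' f₁) (c₂ : Cross j u (i' :: v) j' f₂)
    (c₃ : Cross i u (j' :: i' :: v) i' f₃) :
    ∃ (h' : i'.val + 1 = j'.val) (g₁ : Hom k (j :: (u ++ v)) (u ++ j' :: v))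
      (g₂ : Hom k (i :: (u ++ j' :: v)) (u ++ i' :: j' :: v))
      (g₃ : Hom k (j :: (u ++ i' :: j' :: v)) (u ++ j' :: i' :: j' :: v)),
      Cross j u v j' g₁ ∧ Cross i u (j' :: v) i' g₂ ∧ Cross j u (i' :: j' :: v) j' g₃ ∧
      BX.whisker u (BX.six (.of_succ h') v) ∘ₗ f₃ ∘ₗ BX.map i f₂ ∘ₗ BX.map i (BX.map j f₁) =
        g₃ ∘ₗ BX.map j g₂ ∘ₗ BX.map j (BX.map i g₁) ∘ₗ BX.six (.of_succ h) (u ++ v) := by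
  -- The induction is on a bound for the length because one step consumes one or three letters of
  -- `u`.
  induction m generalizing i j i' j' u v with
  | zero =>
    obtain rfl := List.length_eq_zero_iff.1 (Nat.le_zero.1 hm)
    exact Cross.adj_nil h c₁ c₂ c₃
  | succ m ih =>
  cases c₁ with
  | nil => exact Cross.adj_nil h (.nil _ _) c₂ c₃
  -- Impossible: `u` would start with `j`, which the strand `j` can neither pass nor braid with.
  | braid h₁ d₁ =>
    cases c₂ with
    | swap h₂ d₂ => exact absurd h₂ (by simp only [Distant]; omega)
    | braid h₂ d₂ => omega
  | swap h₁ d₁ =>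
    cases c₂ with
    | swap h₂ d₂ =>
      cases c₃ with
      | swap h₃ d₃ =>
        obtain ⟨h', g₁, g₂, g₃, e₁, e₂, e₃, e⟩ := ih (Nat.le_of_succ_le_succ hm) h d₁ d₂ d₃
        exact ⟨h', _, _, _, .swap h₂ e₁, .swap h₁ e₂, .swap h₂ e₃,
          BX.adj_swap (.of_succ h) h₁ h₂ e⟩
      | braid h₃ d₃ => exact absurd h₁ (by simp only [Distant]; omega)
    -- Here `u` must start with `l, j, i` for `l = j + 1`: the strand `i` passes `l` and braids with
    -- `j i`, while the strand `j` braids with `l j` and passes `i` as `l`. This is the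
    -- Zamolodchikov configuration.
    | braid h₂ d₂ =>
      cases c₃ with
      | braid h₃ d₃ => omega
      | swap h₃ d₃ =>
        cases d₁ with
        | swap h₄ d₁ => exact absurd h₄ (by simp only [Distant]; omega)
        | braid h₄ d₁ =>
          cases d₂ with
          | braid h₅ d₂ => omega
          | swap h₅ d₂ =>
            cases d₃ with
            | swap h₆ d₃ => exact absurd h₆ (by simp only [Distant]; omega)
            | braid h₆ d₃ =>
              obtain ⟨h', g₁, g₂, g₃, e₁, e₂, e₃, e⟩ := ih (by simp only [List.length_cons] at hm; omega) h₂ d₁ d₂ d₃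
              exact ⟨h', _, _, _, .braid h₂ (.swap h₅ e₁), .swap h₁ (.braid h e₂),
                .braid h₂ (.swap h₅ e₃),
                BX.adj_braid h h₂ (.of_succ h) h₁ (.of_succ h₂) h₅ e⟩

namespace BX

variable {a : Fin n} {w x y z x' : List (Fin n)}

theorem six_pass_right (h : Adjacent i j) (hi : Distant a i) (hj : Distant a j) :
    (map j (map i (four hj v)) ∘ₗ map j (four hi _) ∘ₗ four hj _) ∘ₗ map a (six (k := k) h v) =
      six h (a :: v) ∘ₗ map i (map j (four hi v)) ∘ₗ map i (four hj _) ∘ₗ four hi _ := by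
  obtain ⟨w, hw⟩ := exists_weight (k := k) h
  exact sixValent_passRight _ _ _ hw

/-- Two distant strands that cross two consecutive strands, only one of them by braiding. -/
theorem dist_braid_right (h : Adjacent j a) (hij : Distant i j) (hi : Distant i a)
    {f₁ : Hom k (a :: w) x} {f₂ : Hom k (i :: x) y} {q : Hom k y z}
    {g₁ : Hom k (i :: w) x'} {g₂ : Hom k (a :: x') z}
    (e : q ∘ₗ f₂ ∘ₗ map i f₁ = g₂ ∘ₗ map a g₁ ∘ₗ four hi w) :
    map a (map j q) ∘ₗ (map a (map j f₂ ∘ₗ four hij x) ∘ₗ four hi _) ∘ₗ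
        map i (map a (map j f₁) ∘ₗ six h w) =
      (map a (map j g₂) ∘ₗ six h x') ∘ₗ map j (map a (map j g₁ ∘ₗ four hij w) ∘ₗ four hi _) ∘ₗ
        four hij _ := by
  have e' := congrArg (fun f => map a (map j f)) e
  have p := six_pass_right (k := k) (v := w) h hij hi
  have e1 : map a (four hij x) ∘ₗ map a (map i (map j f₁)) =
      map a (map j (map i f₁)) ∘ₗ map a (four hij (a :: w)) := square_map a (four_map hij f₁)
  simp only [map_comp, comp_assoc] at e' p ⊢
  rw [four_map_assoc, ← comp_assoc _ _ (map a (four hij x)), e1, comp_assoc, six_map_assoc, ← p]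
  simp only [← comp_assoc] at e' ⊢
  rw [e']

/-- The mirror case of `dist_braid_right`, from the same passing relation; the strand `j` enters
from the other side, so inverse pairs of four-valent vertices are introduced and cancelled. -/
theorem dist_braid_left (h : Adjacent i a) (hij : Distant i j) (hji : Distant j i)
    (hj : Distant j a) (hj' : Distant a j)
    {f₁ : Hom k (j :: w) x} {f₂ : Hom k (a :: x) y} {q : Hom k y z}
    {g₁ : Hom k (a :: w) x'} {g₂ : Hom k (j :: x') z}
    (e : q ∘ₗ f₂ ∘ₗ map a f₁ = g₂ ∘ₗ map j g₁ ∘ₗ four hj' w) :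
    map a (map i q) ∘ₗ (map a (map i f₂) ∘ₗ six h x) ∘ₗ
        map i (map a (map i f₁ ∘ₗ four hji w) ∘ₗ four hj _) =
      (map a (map i g₂ ∘ₗ four hji x') ∘ₗ four hj _) ∘ₗ map j (map a (map i g₁) ∘ₗ six h w) ∘ₗ
        four hij _ := by
  have e' := congrArg (fun f => map a (map i f)) e
  have p := congrArg (fun f => f ∘ₗ four hij _) (six_pass_right (k := k) (v := w) h hji hj)
  have c1 := four_four (k := k) hij hji (a :: i :: w)
  have c2 : map a (map i (four (k := k) hj' w)) ∘ₗ map a (map i (four hj w)) = LinearMap.id := by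
    rw [← map_comp, ← map_comp, four_four, map_id, map_id]
  have e1 : map a (four hji x') ∘ₗ map a (map j (map i g₁)) =
      map a (map i (map j g₁)) ∘ₗ map a (four hji (a :: w)) := square_map a (four_map hji g₁)
  simp only [map_comp, comp_assoc] at e' p ⊢
  rw [c1, comp_id] at p
  rw [six_map_assoc, four_map_assoc, ← comp_assoc _ _ (map a (four hji x')), e1, comp_assoc, ← p]
  simp only [← comp_assoc] at e' ⊢
  rw [e', comp_assoc (map a (map i (four hj w))) (map a (map i (four hj' w))), c2,
    comp_id]

end BX

theorem Cross.dist_nil (h : Distant i j) {f₁ : Hom k (j :: v) (j' :: v)}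
    {f₂ : Hom k (i :: j' :: v) (i' :: j' :: v)}
    (c₁ : Cross j [] v j' f₁) (c₂ : Cross i [] (j' :: v) i' f₂) :
    ∃ (h' : Distant i' j') (g₁ : Hom k (i :: v) (i' :: v)) (g₂ : Hom k (j :: i' :: v) (j' :: i' :: v)),
      Cross i [] v i' g₁ ∧ Cross j [] (i' :: v) j' g₂ ∧
      BX.four h' v ∘ₗ f₂ ∘ₗ BX.map i f₁ = g₂ ∘ₗ BX.map j g₁ ∘ₗ BX.four h v := by
  cases c₁
  cases c₂
  refine ⟨h, _, _, .nil _ _, .nil _ _, ?_⟩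
  simp only [BX.map_id, BX.id_comp, BX.comp_id]

/-- The commutation of distant strands commutes with crossing a word. -/
theorem Cross.dist {m : ℕ} (hm : u.length ≤ m) (h : Distant i j)
    {f₁ : Hom k (j :: (u ++ v)) (u ++ j' :: v)}
    {f₂ : Hom k (i :: (u ++ j' :: v)) (u ++ i' :: j' :: v)}
    (c₁ : Cross j u v j' f₁) (c₂ : Cross i u (j' :: v) i' f₂) :
    ∃ (h' : Distant i' j') (g₁ : Hom k (i :: (u ++ v)) (u ++ i' :: v))
      (g₂ : Hom k (j :: (u ++ i' :: v)) (u ++ j' :: i' :: v)),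
      Cross i u v i' g₁ ∧ Cross j u (i' :: v) j' g₂ ∧
      BX.whisker u (BX.four h' v) ∘ₗ f₂ ∘ₗ BX.map i f₁ =
        g₂ ∘ₗ BX.map j g₁ ∘ₗ BX.four h (u ++ v) := by
  induction m generalizing i j i' j' u v with
  | zero =>
    obtain rfl := List.length_eq_zero_iff.1 (Nat.le_zero.1 hm)
    exact Cross.dist_nil h c₁ c₂
  | succ m ih =>
  cases c₁ with
  | nil => exact Cross.dist_nil h (.nil _ _) c₂
  | swap h₁ d₁ =>
    cases c₂ with
    | swap h₂ d₂ =>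
      obtain ⟨h', g₁, g₂, e₁, e₂, e⟩ := ih (Nat.le_of_succ_le_succ hm) h d₁ d₂
      exact ⟨h', _, _, .swap h₂ e₁, .swap h₁ e₂, BX.dist_swap h h₂ h₁ e⟩
    -- `u` starts with `i + 1, i`. The strand `j` is distant from both, so it passes them while `i`
    -- braids.
    | braid h₂ d₂ =>
      cases d₁ with
      | braid h₃ d₁ => exact absurd h (by simp only [Distant]; omega)
      | swap h₃ d₁ =>
        obtain ⟨h', g₁, g₂, e₁, e₂, e⟩ :=
          ih (by simp only [List.length_cons] at hm; omega) h₁.swap d₁ d₂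
        exact ⟨h', _, _, .braid h₂ e₁, .swap h₁ (.swap h₃ e₂),
          BX.dist_braid_left (.of_succ h₂) h h₃ h₁ h₁.swap e⟩
  | braid h₁ d₁ =>
    cases c₂ with
    | braid h₂ d₂ => exact absurd h (by simp only [Distant]; omega)
    | swap h₂ d₂ =>
      cases d₂ with
      | braid h₃ d₂ => exact absurd h (by simp only [Distant]; omega)
      | swap h₃ d₂ =>
        obtain ⟨h', g₁, g₂, e₁, e₂, e⟩ :=
          ih (by simp only [List.length_cons] at hm; omega) h₂ d₁ d₂
        exact ⟨h', _, _, .swap h₂ (.swap h e₁), .braid h₁ e₂,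
          BX.dist_braid_right (.of_succ h₁) h h₂ e⟩

/-- The morphism of a crossing is a path morphism. -/
theorem Cross.exists_path {f : Hom k (i :: (u ++ v)) (u ++ i' :: v)} (hf : Cross i u v i' f) :
    ∃ p : Path (i :: (u ++ v)) (u ++ i' :: v), p.IsOriented ∧ p.hom k = f := by
  induction hf with
  | nil i v => exact ⟨.nil _, trivial, rfl⟩
  | swap h hf ih =>
    obtain ⟨p, hp, rfl⟩ := ih
    exact ⟨.cons (.distant [] _ _ _ h) (p.consLeft _), ⟨trivial, hp.consLeft _⟩,
      congrArg (· ∘ₗ _) (p.hom_consLeft _)⟩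
  | braid h hf ih =>
    obtain ⟨p, hp, rfl⟩ := ih
    refine ⟨.cons (.adjacent [] _ _ _ (.of_succ h)) ((p.consLeft _).consLeft _),
      ⟨?_, (hp.consLeft _).consLeft _⟩, ?_⟩
    · exact Fin.lt_def.2 (by omega)
    · refine congrArg (· ∘ₗ _) ?_
      rw [Path.hom_consLeft, Path.hom_consLeft]

/-- The coordinate just to the right of a strand stays with it: it passes distant letters unchanged
and rises with the strand at each braiding. -/
theorem Cross.coord {f : Hom k (i :: (u ++ v)) (u ++ i' :: v)} (hf : Cross i u v i' f)
    (m : BX k v) : f (BX.one i (coord k (n + 1) (i.val + 1) • BX.ones u m)) =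
      BX.ones u (BX.one i' (coord k (n + 1) (i'.val + 1) • m)) := by
  induction hf with
  | nil i v => rfl
  | @swap i a i' u v f h hf ih =>
    have e := BX.four_coord (k := k) h (BX.ones u m)
    exact (congrArg _ e).trans ((BX.map_one_apply _ _).trans (congrArg _ (ih m)))
  | @braid i j j' u v f h hf ih =>
    have e := BX.six_coord (k := k) (.of_succ h) h (BX.ones u m)
    exact (congrArg _ e).trans ((BX.map_one_apply _ _).trans
      (congrArg _ ((BX.map_one_apply _ _).trans (congrArg _ (ih m)))))

end cross

/-! ### Insertion of letters into blocks -/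

section insertion

variable {n : ℕ}

/-- The word of a list of blocks. -/
def blockWord : List (List (Fin n)) → List (Fin n)
  | [] => []
  | u :: L => u ++ blockWord L

/-- The word `u` is of the form `c+m-1, ..., c+1, c`. -/
def IsBlock (c : ℕ) : List (Fin n) → Prop
  | [] => True
  | i :: u => i.val = c + u.length ∧ IsBlock c u

/-- The words of the list `L` are blocks that end at `c`, `c + 1`, and so on. -/
def IsBlocks : ℕ → List (List (Fin n)) → Prop
  | _, [] => True
  | c, u :: L => IsBlock c u ∧ IsBlocks (c + 1) L

variable {k : Type u} [Field k] [NeZero (2 : k)]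

/-- The morphism `g` inserts the letter `i` into the list of blocks `L`, with result `L'`. -/
inductive Ins : (c : ℕ) → (i : Fin n) → (L L' : List (List (Fin n))) →
    Hom k (i :: blockWord L) (blockWord L') → Prop
  | absorb {c : ℕ} {i : Fin n} {u : List (Fin n)} (L : List (List (Fin n)))
      (h : i.val = c + u.length) : Ins c i (u :: L) ((i :: u) :: L) LinearMap.id
  | cross {c : ℕ} {i i' : Fin n} {u : List (Fin n)} {L L' : List (List (Fin n))}
      {f : Hom k (i :: (u ++ blockWord L)) (u ++ i' :: blockWord L)}
      {g : Hom k (i' :: blockWord L) (blockWord L')} (hc : c ≤ i.val) (hi : i.val ≠ c + u.length)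
      (hf : Cross i u (blockWord L) i' f) (hg : Ins (c + 1) i' L L' g) :
      Ins c i (u :: L) (u :: L') (BX.whisker u g ∘ₗ f)

variable {c : ℕ} {i j : Fin n}

/-- A letter equal to the first letter of the block can neither pass it nor braid with it; in the
group the two would cancel. -/
theorem Cross.ne {i' : Fin n} {u v : List (Fin n)} {f : Hom k (i :: (u ++ v)) (u ++ i' :: v)}
    (hf : Cross i u v i' f) (hu : IsBlock c u) (hc : c ≤ i.val) (hi : i.val ≠ c + u.length) :
    i.val + 1 ≠ c + u.length := by
  cases hf with
  | nil => simp only [List.length_nil] at hi ⊢; omega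
  | swap h _ =>
    have := hu.1
    simp only [List.length_cons, Distant] at h ⊢
    omega
  | braid h _ =>
    have := hu.1
    simp only [List.length_cons] at this ⊢
    omega

theorem Ins.isBlocks {L L' : List (List (Fin n))} {g : Hom k (i :: blockWord L) (blockWord L')}
    (hg : Ins c i L L' g) (hL : IsBlocks c L) : IsBlocks c L' := by
  induction hg with
  | absorb L h => exact ⟨⟨h, hL.1⟩, hL.2⟩
  | cross hc hi hf hg ih => exact ⟨hL.1, ih hL.2⟩

theorem Ins.length_eq {L L' : List (List (Fin n))} {g : Hom k (i :: blockWord L) (blockWord L')}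
    (hg : Ins c i L L' g) : L'.length = L.length := by
  induction hg with
  | absorb L h => rfl
  | cross hc hi hf hg ih => exact congrArg (· + 1) ih

namespace BX

variable {i' j' : Fin n} {u w x y z x' y' z' : List (Fin n)}

/-- Insertions behind `u` commute with later crossings of `u`. So three insertions can be regrouped
as three crossings followed by three insertions, and the relation is treated separately on each
part. -/
theorem whisker_three {f₁ : Hom k (i :: (u ++ w)) (u ++ i' :: w)} {g₁ : Hom k (i' :: w) x}
    {f₂ : Hom k (j :: (u ++ x)) (u ++ j' :: x)} {g₂ : Hom k (j' :: x) y}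
    {f₃ : Hom k (i :: (u ++ y)) (u ++ i' :: y)} {g₃ : Hom k (i' :: y) z}
    {e₂ : Hom k (j :: (u ++ i' :: w)) (u ++ j' :: i' :: w)}
    {e₃ : Hom k (i :: (u ++ j' :: i' :: w)) (u ++ i' :: j' :: i' :: w)}
    (h₂ : f₂ ∘ₗ map j (whisker u g₁) = whisker u (map j' g₁) ∘ₗ e₂)
    (h₃ : f₃ ∘ₗ map i (whisker u (g₂ ∘ₗ map j' g₁)) =
      whisker u (map i' (g₂ ∘ₗ map j' g₁)) ∘ₗ e₃) :
    (whisker u g₃ ∘ₗ f₃) ∘ₗ map i (whisker u g₂ ∘ₗ f₂) ∘ₗ map i (map j (whisker u g₁ ∘ₗ f₁)) =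
      whisker u (g₃ ∘ₗ map i' g₂ ∘ₗ map i' (map j' g₁)) ∘ₗ e₃ ∘ₗ map i e₂ ∘ₗ map i (map j f₁) := by
  have h₂' := square_map i h₂
  simp only [whisker_comp, map_comp, comp_assoc] at h₃ ⊢
  rw [← comp_assoc _ _ (map i f₂), h₂']
  simp only [← comp_assoc] at h₃ ⊢
  have h₃' := congrArg (fun f => whisker u g₃ ∘ₗ f) h₃
  simp only [← comp_assoc] at h₃'
  rw [h₃']

theorem whisker_two {f₁ : Hom k (i :: (u ++ w)) (u ++ i' :: w)} {g₁ : Hom k (i' :: w) x}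
    {f₂ : Hom k (j :: (u ++ x)) (u ++ j' :: x)} {g₂ : Hom k (j' :: x) y}
    {e₂ : Hom k (j :: (u ++ i' :: w)) (u ++ j' :: i' :: w)}
    (h₂ : f₂ ∘ₗ map j (whisker u g₁) = whisker u (map j' g₁) ∘ₗ e₂) :
    (whisker u g₂ ∘ₗ f₂) ∘ₗ map j (whisker u g₁ ∘ₗ f₁) =
      whisker u (g₂ ∘ₗ map j' g₁) ∘ₗ e₂ ∘ₗ map j f₁ := by
  have h₂' := congrArg (fun f => whisker u g₂ ∘ₗ f) h₂
  simp only [whisker_comp, map_comp, ← comp_assoc] at h₂' ⊢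
  rw [h₂']

theorem insert_two (h : Distant i j) {f : Hom k w x} {g₁ : Hom k (j :: x) y}
    {g₂ : Hom k (i :: y) z} {h₁ : Hom k (i :: x) y'} {h₂ : Hom k (j :: y') z}
    (e : g₂ ∘ₗ map i g₁ = h₂ ∘ₗ map j h₁ ∘ₗ four h x) :
    g₂ ∘ₗ map i (g₁ ∘ₗ map j f) = (h₂ ∘ₗ map j (h₁ ∘ₗ map i f)) ∘ₗ four h w := by
  simp only [map_comp, comp_assoc]
  rw [← four_map]
  simp only [← comp_assoc] at e ⊢
  rw [e]

theorem insert_three (h : Adjacent i j) {f : Hom k w x} {g₁ : Hom k (i :: x) y}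
    {g₂ : Hom k (j :: y) z} {g₃ : Hom k (i :: z) z'} {h₁ : Hom k (j :: x) x'}
    {h₂ : Hom k (i :: x') y'} {h₃ : Hom k (j :: y') z'}
    (e : g₃ ∘ₗ map i g₂ ∘ₗ map i (map j g₁) = h₃ ∘ₗ map j h₂ ∘ₗ map j (map i h₁) ∘ₗ six h x) :
    g₃ ∘ₗ map i (g₂ ∘ₗ map j (g₁ ∘ₗ map i f)) =
      (h₃ ∘ₗ map j (h₂ ∘ₗ map i (h₁ ∘ₗ map j f))) ∘ₗ six h w := by
  simp only [map_comp, comp_assoc]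
  rw [← six_map]
  simp only [← comp_assoc] at e ⊢
  rw [e]

/-- When `i` and then `j` extend the block `u`, the second `i` braids with the new letters `j i` and
continues as `j`. In the other order `j` crosses `u` first, and then `i` and `j` are absorbed. -/
theorem absorb_adj (h : Adjacent i j) (f : Hom k (j :: w) x) (g : Hom k x y) :
    (map j (map i g) ∘ₗ (map j (map i f) ∘ₗ six h w)) ∘ₗ map i LinearMap.id ∘ₗ
        map i (map j LinearMap.id) =
      LinearMap.id ∘ₗ map j LinearMap.id ∘ₗ map j (map i (g ∘ₗ f)) ∘ₗ six h w := by
  simp only [map_id, id_comp, comp_id, map_comp, comp_assoc]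

theorem absorb_dist_left (h : Distant i j) (h' : Distant j i) (f : Hom k (j :: w) x)
    (g : Hom k x y) : LinearMap.id ∘ₗ map i (g ∘ₗ f) =
      (map i g ∘ₗ (map i f ∘ₗ four h' w)) ∘ₗ map j LinearMap.id ∘ₗ four h w := by
  simp only [map_id, id_comp, comp_id, map_comp, comp_assoc, four_four]

theorem absorb_dist_right (h : Distant i j) (f : Hom k (i :: w) x) (g : Hom k x y) :
    (map j g ∘ₗ (map j f ∘ₗ four h w)) ∘ₗ map i LinearMap.id =
      LinearMap.id ∘ₗ map j (g ∘ₗ f) ∘ₗ four h w := by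
  simp only [map_id, id_comp, comp_id, map_comp, comp_assoc]

end BX

/-- The braid relation commutes with insertion. -/
theorem Ins.adj {L L₁ L₂ L₃ : List (List (Fin n))} (hL : IsBlocks c L) (h : i.val + 1 = j.val)
    {g₁ : Hom k (i :: blockWord L) (blockWord L₁)} {g₂ : Hom k (j :: blockWord L₁) (blockWord L₂)}
    {g₃ : Hom k (i :: blockWord L₂) (blockWord L₃)} (c₁ : Ins c i L L₁ g₁) (c₂ : Ins c j L₁ L₂ g₂)
    (c₃ : Ins c i L₂ L₃ g₃) :
    ∃ (M₁ M₂ : List (List (Fin n))) (h₁ : Hom k (j :: blockWord L) (blockWord M₁))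
      (h₂ : Hom k (i :: blockWord M₁) (blockWord M₂)) (h₃ : Hom k (j :: blockWord M₂) (blockWord L₃)),
      Ins c j L M₁ h₁ ∧ Ins c i M₁ M₂ h₂ ∧ Ins c j M₂ L₃ h₃ ∧
      g₃ ∘ₗ BX.map i g₂ ∘ₗ BX.map i (BX.map j g₁) =
        h₃ ∘ₗ BX.map j h₂ ∘ₗ BX.map j (BX.map i h₁) ∘ₗ BX.six (.of_succ h) (blockWord L) := by
  induction L generalizing c i j L₁ L₂ L₃ with
  | nil => cases c₁
  | cons u L ih =>
    cases c₁ with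
    | absorb _ hi =>
      cases c₂ with
      | cross hc hj _ _ => simp only [List.length_cons] at hj; omega
      | absorb _ hj =>
        cases c₃ with
        | absorb _ hi' => simp only [List.length_cons] at hi'; omega
        | cross hc hi' hf hg =>
          cases hf with
          | swap hd _ => exact absurd hd (by simp only [Distant]; omega)
          | braid hb hf =>
            refine ⟨_, _, _, _, _, .cross (by omega) (by omega) hf hg, .absorb _ hi, .absorb _ hj, 
              BX.absorb_adj (.of_succ h) _ _⟩
    | cross hc hi hf₁ hg₁ =>
      have hne := hf₁.ne hL.1 hc hi
      cases c₂ with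
      | absorb _ hj => omega
      | cross hc₂ hj hf₂ hg₂ =>
        cases c₃ with
        | absorb _ hi' => omega
        | cross hc₃ hi₃ hf₃ hg₃ =>
          -- The first and the third letter leave the block as the same letter, so the exiting
          -- letters again form one side of a braid relation.
          obtain rfl := hf₁.det hf₃
          obtain ⟨e₂, he₂, -, hs₂⟩ := hf₂.natural _
          obtain ⟨e₃, he₃, -, hs₃⟩ := hf₃.natural _
          obtain ⟨h', p₁, p₂, p₃, q₁, q₂, q₃, hq⟩ := hf₁.adj le_rfl h he₂ he₃
          obtain ⟨M₁, M₂, h₁, h₂, h₃, r₁, r₂, r₃, hr⟩ := ih hL.2 h' hg₁ hg₂ hg₃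
          obtain ⟨s₂, t₂, ht₂, -⟩ := q₂.natural (blockWord M₁)
          obtain ⟨s₃, t₃, ht₃, -⟩ := q₃.natural (blockWord M₂)
          refine ⟨_, _, _, _, _, .cross hc₂ hj q₁ r₁, .cross hc hi t₂ r₂, .cross hc₂ hj t₃ r₃, ?_⟩
          have e := BX.whisker_three (f₁ := p₁) (g₃ := h₃) (ht₂ h₁) (ht₃ (h₂ ∘ₗ BX.map _ h₁))
          have e' := congrArg (fun f => f ∘ₗ BX.six (.of_succ h) _) e
          refine (BX.whisker_three (hs₂ _) (hs₃ _)).trans (Eq.trans ?_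
            (e'.symm.trans (by simp only [BX.comp_assoc]; rfl)))
          rw [hr]
          simp only [BX.whisker_comp, BX.comp_assoc, hq]

/-- The commutation of distant letters commutes with insertion. -/
theorem Ins.dist {L L₁ L₂ : List (List (Fin n))} (h : Distant i j)
    {g₁ : Hom k (j :: blockWord L) (blockWord L₁)} {g₂ : Hom k (i :: blockWord L₁) (blockWord L₂)}
    (c₁ : Ins c j L L₁ g₁) (c₂ : Ins c i L₁ L₂ g₂) :
    ∃ (M₁ : List (List (Fin n))) (h₁ : Hom k (i :: blockWord L) (blockWord M₁))
      (h₂ : Hom k (j :: blockWord M₁) (blockWord L₂)),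
      Ins c i L M₁ h₁ ∧ Ins c j M₁ L₂ h₂ ∧
      g₂ ∘ₗ BX.map i g₁ = h₂ ∘ₗ BX.map j h₁ ∘ₗ BX.four h (blockWord L) := by
  have hd := h
  simp only [Distant] at hd
  induction L generalizing c i j L₁ L₂ with
  | nil => cases c₁
  | cons u L ih =>
    cases c₁ with
    | absorb _ hj =>
      cases c₂ with
      | absorb _ hi => simp only [List.length_cons] at hi; omega
      | cross hc hi hf hg =>
        cases hf with
        | braid hb hf => omega
        | swap hs hf =>
          exact ⟨_, _, _, .cross hc (by omega) hf hg, .absorb _ hj, BX.absorb_dist_right h _ _⟩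
    | cross hc hj hf₁ hg₁ =>
      cases c₂ with
      | absorb _ hi =>
        exact ⟨_, _, _, .absorb _ hi, .cross hc (by simp only [List.length_cons]; omega)
          (.swap h.swap hf₁) hg₁, BX.absorb_dist_left h h.swap _ _⟩
      | cross hc₂ hi hf₂ hg₂ =>
        obtain ⟨e₂, he₂, -, hs₂⟩ := hf₂.natural _
        obtain ⟨h', p₁, p₂, q₁, q₂, hq⟩ := hf₁.dist le_rfl h he₂
        obtain ⟨M₁, h₁, h₂, r₁, r₂, hr⟩ := ih h' hg₁ hg₂ h'
        obtain ⟨s₂, t₂, ht₂, -⟩ := q₂.natural (blockWord M₁)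
        refine ⟨_, _, _, .cross hc₂ hi q₁ r₁, .cross hc hj t₂ r₂, ?_⟩
        have e := BX.whisker_two (f₁ := p₁) (g₂ := h₂) (ht₂ h₁)
        have e' := congrArg (fun f => f ∘ₗ BX.four h _) e
        refine (BX.whisker_two (hs₂ _)).trans (Eq.trans ?_
          (e'.symm.trans (by simp only [BX.comp_assoc]; rfl)))
        rw [hr]
        simp only [BX.whisker_comp, BX.comp_assoc, hq]

theorem Ins.exists_path {L L' : List (List (Fin n))} {g : Hom k (i :: blockWord L) (blockWord L')}
    (hg : Ins c i L L' g) :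
    ∃ p : Path (i :: blockWord L) (blockWord L'), p.IsOriented ∧ p.hom k = g := by
  induction hg with
  | absorb L h => exact ⟨.nil _, trivial, rfl⟩
  | @cross c i i' u L L' f g hc hi hf hg ih =>
    obtain ⟨p, hp, rfl⟩ := hf.exists_path
    obtain ⟨q, hq, rfl⟩ := ih
    refine ⟨p.append (q.appendLeft u), hp.append (hq.appendLeft u), ?_⟩
    exact (Path.hom_append p (q.appendLeft u)).trans (congrArg (· ∘ₗ _) (q.hom_appendLeft u))

/-- The morphism `f` inserts the letters of the word `x`, starting with the last one, into a list of
empty blocks. -/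
inductive Can (c : ℕ) : (x : List (Fin n)) → (L : List (List (Fin n))) →
    Hom k x (blockWord L) → Prop
  | nil : Can c [] [] LinearMap.id
  | empty {L : List (List (Fin n))} {f : Hom k [] (blockWord L)} (hf : Can c [] L f) :
      Can c [] ([] :: L) f
  | cons {i : Fin n} {x : List (Fin n)} {L L' : List (List (Fin n))} {f : Hom k x (blockWord L)}
      {g : Hom k (i :: blockWord L) (blockWord L')} (hf : Can c x L f) (hg : Ins c i L L' g) :
      Can c (i :: x) L' (g ∘ₗ BX.map i f)

theorem Can.exists_path {x : List (Fin n)} {L : List (List (Fin n))} {f : Hom k x (blockWord L)}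
    (hf : Can c x L f) : ∃ p : Path x (blockWord L), p.IsOriented ∧ p.hom k = f := by
  induction hf with
  | nil => exact ⟨.nil _, trivial, rfl⟩
  | empty _ ih => exact ih
  | @cons i x L L' f g hf hg ih =>
    obtain ⟨p, hp, rfl⟩ := ih
    obtain ⟨q, hq, rfl⟩ := hg.exists_path
    refine ⟨(p.consLeft i).append q, (hp.consLeft i).append hq, ?_⟩
    rw [Path.hom_append, Path.hom_consLeft]

theorem isBlocks_of_can_nil {x : List (Fin n)} {L : List (List (Fin n))}
    {f : Hom k x (blockWord L)} (hf : Can c x L f) (hx : x = []) : ∀ c, IsBlocks c L := by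
  induction hf with
  | nil => exact fun _ => trivial
  | empty _ ih => exact fun c => ⟨trivial, ih hx _⟩
  | cons => exact (List.cons_ne_nil _ _ hx).elim

theorem Can.isBlocks {x : List (Fin n)} {L : List (List (Fin n))} {f : Hom k x (blockWord L)}
    (hf : Can c x L f) : IsBlocks c L := by
  induction hf with
  | nil => trivial
  | empty hf ih => exact isBlocks_of_can_nil (hf.empty) rfl _
  | cons hf hg ih => exact hg.isBlocks ih

/-- Insertion is compatible with oriented edges. -/
theorem Can.edge {x y : List (Fin n)} (e : Edge x y) (he : e.IsOriented)
    {L : List (List (Fin n))} {f : Hom k x (blockWord L)} (hf : Can c x L f) :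
    ∃ f' : Hom k y (blockWord L), Can c y L f' ∧ f = f' ∘ₗ e.hom k := by
  cases e with
  | distant u v i j h =>
    induction u generalizing L with
    | nil =>
      cases hf with
      | cons hf c₂ =>
        cases hf with
        | cons hf c₁ =>
          obtain ⟨M₁, h₁, h₂, r₁, r₂, e⟩ := c₁.dist h c₂
          exact ⟨_, .cons (.cons hf r₁) r₂, BX.insert_two h e⟩
    | cons a u ih =>
      cases hf with
      | cons hf hg =>
        obtain ⟨f', hf', rfl⟩ := ih hf trivial
        refine ⟨_, .cons hf' hg, ?_⟩
        rw [BX.map_comp]; rfl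
  | adjacent u v i j h =>
    induction u generalizing L with
    | nil =>
      cases hf with
      | cons hf c₃ =>
        cases hf with
        | cons hf c₂ =>
          cases hf with
          | cons hf c₁ =>
            have hij : i.val + 1 = j.val := by
              rcases h with h | h
              · exact h
              · exact absurd (Fin.lt_def.1 he) (by omega)
            obtain ⟨M₁, M₂, h₁, h₂, h₃, r₁, r₂, r₃, e⟩ := c₁.adj hf.isBlocks hij c₂ c₃
            exact ⟨_, .cons (.cons (.cons hf r₁) r₂) r₃, BX.insert_three _ e⟩
    | cons a u ih =>
      cases hf with
      | cons hf hg =>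
        obtain ⟨f', hf', rfl⟩ := ih hf he
        refine ⟨_, .cons hf' hg, ?_⟩
        rw [BX.map_comp]; rfl

/-- The blocks stay fixed along the path. All oriented paths out of `x` are thus compared with a
single morphism, and thinness can be transferred between them. -/
theorem Can.path {x y : List (Fin n)} (p : Path x y) (hp : p.IsOriented)
    {L : List (List (Fin n))} {f : Hom k x (blockWord L)} (hf : Can c x L f) :
    ∃ f' : Hom k y (blockWord L), Can c y L f' ∧ f = f' ∘ₗ p.hom k := by
  induction p with
  | nil => exact ⟨f, hf, rfl⟩
  | cons e p ih =>
    obtain ⟨f', hf', rfl⟩ := hf.edge e hp.1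
    obtain ⟨f'', hf'', rfl⟩ := ih hp.2 hf'
    exact ⟨f'', hf'', BX.comp_assoc _ _ _⟩

end insertion

/-! ### Thinness of the insertion of the standard source. -/

section standard

variable {n : ℕ} {c : ℕ} {i : Fin n} {u : List (Fin n)}

theorem IsBlock.lt (hu : IsBlock c u) : ∀ a ∈ u, a.val < c + u.length := by
  induction u with
  | nil => simp
  | cons b u ih =>
    intro a ha
    rw [List.length_cons]
    rcases List.mem_cons.1 ha with rfl | ha
    · have := hu.1; omega
    · have := ih hu.2 a ha; omega

theorem IsBlock.le (hu : IsBlock c u) : ∀ a ∈ u, c ≤ a.val := by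
  induction u with
  | nil => simp
  | cons b u ih =>
    intro a ha
    rcases List.mem_cons.1 ha with rfl | ha
    · have := hu.1; omega
    · exact ih hu.2 a ha

variable {k : Type u} [Field k] [NeZero (2 : k)]

theorem Cross.exists_far (hu : IsBlock c u) (hi : c + u.length < i.val) (v : List (Fin n)) :
    ∃ f : Hom k (i :: (u ++ v)) (u ++ i :: v), Cross i u v i f := by
  induction u with
  | nil => exact ⟨_, .nil i v⟩
  | cons a u ih =>
    have h1 := hu.1
    rw [List.length_cons] at hi
    obtain ⟨f, hf⟩ := ih hu.2 (by omega)
    exact ⟨_, .swap (Or.inr (by omega)) hf⟩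

/-- The letter passes the letters above `i + 1`, braids with the consecutive pair `i + 1, i`, and,
raised by one, is distant from the rest of the block. -/
theorem Cross.exists_succ (hu : IsBlock c u) (hc : c ≤ i.val) (hi : i.val + 1 < c + u.length)
    (v : List (Fin n)) : ∃ (i' : Fin n) (f : Hom k (i :: (u ++ v)) (u ++ i' :: v)),
      i.val + 1 = i'.val ∧ Cross i u v i' f := by
  induction u with
  | nil => simp only [List.length_nil] at hi; omega
  | cons a u ih =>
    have h1 := hu.1
    rw [List.length_cons] at hi
    by_cases h : i.val + 1 = a.val
    · cases u with
      | nil => simp only [List.length_nil] at h1; omega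
      | cons b u =>
        have h2 := hu.2.1
        rw [List.length_cons] at h1
        obtain rfl : b = i := Fin.ext (by omega)
        obtain ⟨f, hf⟩ := Cross.exists_far (k := k) (i := a) hu.2.2 (by omega) v
        exact ⟨a, _, h, .braid h hf⟩
    · obtain ⟨i', f, h', hf⟩ := ih hu.2 (by omega)
      exact ⟨i', _, h', .swap (Or.inl (by omega)) hf⟩

/-- The blocks end at `c`, `c + 1`, and so on; the first `d` of them start with `e` and the others
with `e - 1`. -/
def Stage (e : ℕ) : ℕ → ℕ → List (List (Fin n)) → Prop
  | _, _, [] => True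
  | 0, c, u :: L => u.length = e - c ∧ Stage e 0 (c + 1) L
  | d + 1, c, u :: L => u.length = e + 1 - c ∧ Stage e d (c + 1) L

/-- After `e + 1 - c` letters every block that can start with `e` does so; the remaining ones are
empty for `e` and for `e + 1` alike. -/
theorem Stage.step {e c : ℕ} {L : List (List (Fin n))} (h : Stage e (e + 1 - c) c L) :
    Stage (e + 1) 0 c L := by
  induction L generalizing c with
  | nil => trivial
  | cons u L ih =>
    by_cases hc : e + 1 - c = 0
    · rw [hc] at h
      refine ⟨by rw [h.1]; omega, ih ?_⟩
      rw [show e + 1 - (c + 1) = 0 by omega]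
      exact h.2
    · obtain ⟨d, hd⟩ := Nat.exists_eq_succ_of_ne_zero hc
      rw [hd] at h
      refine ⟨h.1, ih ?_⟩
      rw [show e + 1 - (c + 1) = d by omega]
      exact h.2

theorem Stage.lt {e c : ℕ} {L : List (List (Fin n))} (h : Stage e 0 c L) (hL : IsBlocks c L) :
    ∀ a ∈ blockWord L, a.val < e := by
  induction L generalizing c with
  | nil => simp [blockWord]
  | cons u L ih =>
    intro a ha
    rcases List.mem_append.1 ha with ha | ha
    · have h1 := hL.1.lt a ha
      have h2 := hL.1.le a ha
      have := h.1
      omega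
    · exact ih h.2 hL.2 a ha

/-- No letter of `x` moves the coordinate with index `e`, so it passes all slots. -/
theorem BX.coord_smul_word {e : ℕ} {x : List (Fin n)} (hx : ∀ a ∈ x, a.val + 1 < e) :
    coord k (n + 1) e • (1 : BX k x) = BX.right k x (coord k (n + 1) e) := by
  induction x with
  | nil => exact mul_one _
  | cons i x ih =>
    have hi := hx i List.mem_cons_self
    rw [← BX.one_one, BX.coord_smul_one (by omega) (by omega),
      ih fun a ha => hx a (List.mem_cons_of_mem _ ha), BX.right_cons]

theorem BX.whisker_ones {x y : List (Fin n)} (u : List (Fin n)) (f : Hom k x y) (m : BX k x) :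
    BX.whisker u f (BX.ones u m) = BX.ones u (f m) := by
  induction u with
  | nil => rfl
  | cons i u ih => exact (BX.map_one_apply _ _).trans (congrArg _ ih)

/-- The letter `i = e - d` crosses the `d` blocks that already start with `e`, is raised by one in
each, and is absorbed as `e` by the next block. Its coordinate arrives there with index `e + 1`,
beyond the reach of all letters still ahead. -/
theorem exists_ins_stage {e d : ℕ} {L : List (List (Fin n))} (hL : IsBlocks c L)
    (hs : Stage e d c L) (hd : d < L.length) (hi : i.val + d = e) (hc : c ≤ i.val) :
    ∃ (L' : List (List (Fin n))) (g : Hom k (i :: blockWord L) (blockWord L')),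
      Ins c i L L' g ∧ Stage e (d + 1) c L' ∧
      g (BX.one i (coord k (n + 1) (i.val + 1) • 1)) =
        BX.right k (blockWord L') (coord k (n + 1) (e + 1)) := by
  induction d generalizing c i L with
  | zero =>
    cases L with
    | nil => simp at hd
    | cons u L =>
      have h1 := hs.1
      refine ⟨_, _, .absorb L (by omega), ⟨?_, hs.2⟩, ?_⟩
      · rw [List.length_cons]; omega
      · have e1 := BX.coord_smul_word (k := k) (e := i.val + 1) (x := blockWord (u :: L))
          fun a ha => by have := hs.lt hL a ha; omega
        refine (congrArg (BX.one i) e1).trans ?_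
        rw [← hi]
        rfl
  | succ d ih =>
    cases L with
    | nil => simp at hd
    | cons u L =>
      have h1 := hs.1
      obtain ⟨i', f, hi', hf⟩ := Cross.exists_succ (k := k) hL.1 hc (by omega) (blockWord L)
      obtain ⟨L', g, hg, hs', hg'⟩ := ih hL.2 hs.2 (by rw [List.length_cons] at hd; omega)
        (i := i') (by omega) (by omega)
      refine ⟨_, _, .cross hc (by omega) hf hg, ⟨h1, hs'⟩, ?_⟩
      have e1 := hf.coord (1 : BX k (blockWord L))
      rw [BX.ones_one] at e1
      refine (congrArg (BX.whisker u g) e1).trans ?_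
      rw [BX.whisker_ones, hg', ← BX.right_append]
      rfl

/-- The letters of `x` can be inserted into a list of `m` blocks, and the image is contained in the
subbimodule generated by `1`. -/
def StageWord (k : Type u) [Field k] [NeZero (2 : k)] (c e d : ℕ) (x : List (Fin n)) : Prop :=
  ∃ (L : List (List (Fin n))) (f : Hom k x (blockWord L)), Can c x L f ∧
    L.length = n ∧ Stage e d c L ∧ ∀ m, f m ∈ oneSpan (BX.right k (blockWord L))

theorem stageWord_nil : StageWord (n := n) k c c 0 [] := by
  -- For `c ≤ c'` the truncated difference `c - c'` is zero, so empty blocks have the prescribed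
  -- lengths at every later index as well.
  suffices H : ∀ m c', c ≤ c' → ∃ (L : List (List (Fin n))) (f : Hom k [] (blockWord L)), Can c [] L f ∧
      L.length = m ∧ Stage c 0 c' L ∧ ∀ m, f m ∈ oneSpan (BX.right k (blockWord L)) from
    H n c le_rfl
  intro m
  induction m with
  | zero => exact fun c' _ => ⟨[], _, .nil, rfl, trivial, fun m => mem_oneSpan _ m⟩
  | succ m ih =>
    intro c' hc'
    obtain ⟨L, f, h1, h2, h3, h4⟩ := ih (c' + 1) (by omega)
    exact ⟨[] :: L, f, .empty h1, congrArg (· + 1) h2, ⟨by simp; omega, h3⟩, h4⟩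

/-- The coordinate with index `i + 1` generates the new slot and becomes a right multiple of 1, so
thinness of the earlier insertions is inherited. -/
theorem StageWord.cons {e d : ℕ} {x : List (Fin n)} (h : StageWord k c e d x) (hd : d < n)
    (hi : i.val + d = e) (hc : c ≤ i.val) : StageWord k c e (d + 1) (i :: x) := by
  obtain ⟨L, f, h1, h2, h3, h4⟩ := h
  obtain ⟨L', g, h5, h6, h7⟩ := exists_ins_stage (k := k) h1.isBlocks h3 (by omega) hi hc
  refine ⟨L', _, .cons h1 h5, h5.length_eq.trans h2, h6, ?_⟩
  obtain ⟨p, -, rfl⟩ := h5.exists_path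
  have hr : refl k i.castSucc (coord k (n + 1) (i.val + 1)) = _ :=
    refl_coord_succ (i := i.castSucc) (by simp)
  exact IsUnitalRight.map_ind_mem (ρ := BX.right k (blockWord L)) p.adjointPair.left hr h7 h4

theorem exists_stageWord {a e : ℕ} (hae : a ≤ e) (he : e ≤ n) :
    ∃ x : List (Fin n), x.map Fin.val = (sourceWord a e).reverse ∧ StageWord k a e 0 x := by
  induction e, hae using Nat.le_induction with
  | base => exact ⟨[], by simp [sourceWord, asc], stageWord_nil⟩
  | succ e hae ih =>
    obtain ⟨x, hx, hs⟩ := ih (by omega)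
    -- One round inserts `e, e - 1, …, a` in this order; each of these letters makes one more block
    -- start with `e`.
    have H : ∀ d ≤ e + 1 - a, ∃ y : List (Fin n),
        y.map Fin.val = asc (e + 1 - d) (e + 1) ++ (sourceWord a e).reverse ∧
          StageWord k a e d y := by
      intro d
      induction d with
      | zero => exact fun _ => ⟨x, by simp [hx, asc], hs⟩
      | succ d ih =>
        intro hd
        obtain ⟨y, hy, hy'⟩ := ih (by omega)
        refine ⟨⟨e - d, by omega⟩ :: y, ?_, hy'.cons (by omega) (by dsimp only; omega)
          (by dsimp only; omega)⟩
        rw [List.map_cons, hy, asc, asc, show e + 1 - (e + 1 - (d + 1)) = d + 1 by omega,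
          show e + 1 - (e + 1 - d) = d by omega, List.range'_succ,
          show e + 1 - (d + 1) = e - d by omega, show e - d + 1 = e + 1 - d by omega]
        rfl
    obtain ⟨y, hy, L, f, h1, h2, h3, h4⟩ := H _ le_rfl
    refine ⟨y, ?_, L, f, h1, h2, h3.step, h4⟩
    rw [hy, sourceWord, sourceWord, show asc a (e + 1) = asc a e ++ [e] by
        rw [asc, asc, show e + 1 - a = e - a + 1 by omega, List.range'_concat]
        congr 2; omega,
      List.flatMap_append, List.reverse_append, show e + 1 - (e + 1 - a) = a by omega]
    simp [desc]

end standard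

/-! ### Paths between sources and sinks -/

section ends

variable {n : ℕ} {x y z : List (Fin n)}

theorem distantRel_symm (h : DistantRel x y) : DistantRel y x := by
  induction h with
  | refl => exact .refl
  | tail _ h ih =>
    obtain ⟨u, v, i, j, hij, rfl, rfl⟩ := h
    exact .head ⟨u, v, j, i, hij.swap, rfl, rfl⟩ ih

theorem Edge.isOriented_of_isDistant {e : Edge x y} (h : e.IsDistant) : e.IsOriented := by
  cases e with
  | distant => trivial
  | adjacent => exact h.elim

theorem Edge.distantRel {e : Edge x y} (h : e.IsDistant) : DistantRel x y := by
  cases e with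
  | distant u v i j hij => exact .single ⟨u, v, i, j, hij, rfl, rfl⟩
  | adjacent => exact h.elim

theorem Edge.isDistant_or_up (e : Edge x y) (he : e.IsOriented) : e.IsDistant ∨ Up x y := by
  cases e with
  | distant => exact Or.inl trivial
  | adjacent u v i j h =>
    refine Or.inr ⟨u, v, i, j, ?_, rfl, rfl⟩
    rcases h with h | h
    · exact h
    · exact absurd (Fin.lt_def.1 he) (by omega)

namespace Path

theorem IsDistant.isOriented {p : Path x y} (h : p.IsDistant) : p.IsOriented := by
  induction p with
  | nil => trivial
  | cons e p ih => exact ⟨Edge.isOriented_of_isDistant h.1, ih h.2⟩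

theorem IsDistant.append {p : Path x y} {q : Path y z} (hp : p.IsDistant) (hq : q.IsDistant) :
    (p.append q).IsDistant := by
  induction p with
  | nil => exact hq
  | cons e p ih => exact ⟨hp.1, ih hp.2 hq⟩

theorem IsDistant.reverse {p : Path x y} (h : p.IsDistant) : p.reverse.IsDistant := by
  induction p with
  | nil => trivial
  | cons e p ih =>
    refine (ih h.2).append ⟨?_, trivial⟩
    cases e with
    | distant => trivial
    | adjacent => exact h.1.elim

theorem IsDistant.distantRel {p : Path x y} (h : p.IsDistant) : DistantRel x y := by
  induction p with
  | nil => exact .refl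
  | cons e p ih => exact (Edge.distantRel h.1).trans (ih h.2)

/-- An oriented path into a source of the expression graph has no adjacent edges. -/
theorem IsOriented.isDistant_of_source {p : Path x y} (hp : p.IsOriented)
    (h : ∀ y', DistantRel y y' → ∀ z, ¬ Up z y') : p.IsDistant := by
  induction p with
  | nil => trivial
  | cons e p ih =>
    have h1 := ih hp.2 h
    refine ⟨(e.isDistant_or_up hp.1).resolve_right fun h2 => ?_, h1⟩
    exact h _ (distantRel_symm h1.distantRel) _ h2

/-- An oriented path that starts at a sink of the expression graph has no adjacent edges. -/
theorem IsOriented.isDistant_of_sink {p : Path x y} (hp : p.IsOriented)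
    (h : ∀ x', DistantRel x x' → ∀ z, ¬ Up x' z) : p.IsDistant := by
  induction p with
  | nil => trivial
  | cons e p ih =>
    have h1 := (e.isDistant_or_up hp.1).resolve_right (h _ .refl _)
    exact ⟨h1, ih hp.2 fun x' hx' => h x' ((Edge.distantRel h1).trans hx')⟩

end Path

variable {k : Type u} [Field k] [NeZero (2 : k)]

/-- The image of an oriented path from a source to a sink is contained in the subbimodule generated
by `1`. -/
theorem StageWord.hom_mem {c e d : ℕ} {s t : List (Fin n)} (hx : StageWord k c e d x)
    (p : Path x s) (hp : p.IsDistant) (q : Path s t) (hq : q.IsOriented)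
    (ht : ∀ t', DistantRel t t' → ∀ z, ¬ Up t' z) (m : BX k s) :
    q.hom k m ∈ oneSpan (BX.right k t) := by
  obtain ⟨L, f, hf, -, -, hm⟩ := hx
  obtain ⟨f', hf', e⟩ := hf.path (p.append q) (hp.isOriented.append hq)
  obtain ⟨r, hr, rfl⟩ := hf'.exists_path
  have h1 := r.hom_reverse_comp (k := k) (hr.isDistant_of_sink ht)
  have h2 := p.reverse.hom_reverse_comp (k := k) hp.reverse
  rw [Path.reverse_reverse] at h2
  have h3 := LinearMap.congr_fun e (p.reverse.hom k m)
  have h4 : f (p.reverse.hom k m) = r.hom k (q.hom k m) := by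
    rw [h3, Path.hom_append]
    exact congrArg (fun m => r.hom k (q.hom k m)) (LinearMap.congr_fun h2 m)
  have h5 := r.reverse.adjointPair.left.map_mem (hm (p.reverse.hom k m))
  rw [h4] at h5
  have h6 : r.reverse.hom k (r.hom k (q.hom k m)) = q.hom k m := LinearMap.congr_fun h1 _
  rwa [h6] at h5

namespace Path

theorem mem_append_right {p : Path x y} {q : Path y z}
    (hq : ∀ m, q.hom k m ∈ oneSpan (BX.right k z)) (m : BX k x) :
    (p.append q).hom k m ∈ oneSpan (BX.right k z) := by
  rw [hom_append]
  exact hq _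

theorem mem_append_left {p : Path x y} {q : Path y z}
    (hp : ∀ m, p.hom k m ∈ oneSpan (BX.right k y)) (m : BX k x) :
    (p.append q).hom k m ∈ oneSpan (BX.right k z) := by
  rw [hom_append]
  exact q.adjointPair.left.map_mem (hp m)

theorem mem_reverse {p : Path x y} (hp : ∀ m, p.hom k m ∈ oneSpan (BX.right k y)) (m : BX k y) :
    p.reverse.hom k m ∈ oneSpan (BX.right k x) :=
  p.adjointPair.adjoint_mem (BX.isNondegenerate_trace k x) hp m

end Path

end ends

/-! ### Adjoining a variable -/

section adjoin

variable {k : Type u} [Field k] {n : ℕ}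

/-- The inclusion of the polynomial ring in the one with an additional variable. -/
def incl (k : Type u) [Field k] (n : ℕ) : PolyRing k n →ₐ[k] PolyRing k (n + 1) :=
  rename Fin.castSucc

theorem incl_X (i : Fin n) : incl k n (X i) = X i.castSucc := rename_X _ _

theorem incl_refl (i : Fin n) (p : PolyRing k n) :
    incl k n (refl k i p) = refl k i.castSucc (incl k n p) := by
  suffices h : (incl k n).comp (refl k i) = (refl k i.castSucc).comp (incl k n) from
    congrArg (fun f => f p) h
  apply MvPolynomial.algHom_ext
  intro j
  have h1 : j.castSucc = i.castSucc ↔ j = i := Fin.castSucc_inj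
  have h2 : Adjacent i.castSucc j.castSucc ↔ Adjacent i j := Iff.rfl
  rw [AlgHom.comp_apply, AlgHom.comp_apply, incl_X, refl_X, refl_X]
  simp only [h1, h2]
  split_ifs <;> simp only [map_neg, map_add, incl_X]

theorem incl_demazure (i : Fin n) (p : PolyRing k n) :
    incl k n (demazure i p) = demazure i.castSucc (incl k n p) := by
  symm
  apply demazure_unique
  rw [← incl_X, ← map_mul, X_mul_demazure, map_sub, incl_refl]

theorem incl_halfRoot (i : Fin n) : incl k n (halfRoot k i) = halfRoot k i.castSucc := by
  rw [halfRoot, halfRoot, map_mul, incl_X]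
  exact congrArg (· * X i.castSucc) ((incl k n).commutes _)

theorem incl_average (i : Fin n) (p : PolyRing k n) :
    incl k n (average i p) = average i.castSucc (incl k n p) := by
  rw [average, average, map_mul, map_add, incl_refl]
  exact congrArg (· * _) ((incl k n).commutes _)

theorem incl_mem {i : Fin n} {p : PolyRing k n} (hp : p ∈ invariants k i) :
    incl k n p ∈ invariants k i.castSucc := by
  change refl k i.castSucc (incl k n p) = incl k n p
  rw [← incl_refl, refl_of_mem hp]

variable {M : Type u} [CommRing M] [Algebra (PolyRing k n) M]
variable {M' : Type u} [CommRing M'] [Algebra (PolyRing k (n + 1)) M']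

/-- Ring homomorphisms that are semilinear with respect to the inclusion of polynomial rings. -/
def IsSemilinear (k : Type u) [Field k] (n : ℕ) {M M' : Type u} [CommRing M]
    [Algebra (PolyRing k n) M] [CommRing M'] [Algebra (PolyRing k (n + 1)) M'] (φ : M →+* M') : Prop :=
  ∀ (p : PolyRing k n) (m : M), φ (p • m) = incl k n p • φ m

/-- The additive map `a ⊗ m ↦ a ⊗ φ m`. -/
def indAdjoinAux (i : Fin n) (φ : M →+* M') (hφ : IsSemilinear k n φ) :
    Ind k i M →+ Ind k i.castSucc M' :=
  TensorProduct.liftAddHom (R := invariants k i)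
    (AddMonoidHom.mk' (fun c : PolyRing k n => AddMonoidHom.mk'
      (fun m => Ind.tmul i.castSucc (incl k n c) (φ m)) fun m m' => by
        rw [map_add]; exact TensorProduct.tmul_add _ _ _)
      fun c c' => AddMonoidHom.ext fun m => by
        change Ind.tmul _ (incl k n (c + c')) _ = Ind.tmul _ _ _ + Ind.tmul _ _ _
        rw [map_add]; exact TensorProduct.add_tmul _ _ _)
    (fun q c m => by
      change Ind.tmul _ (incl k n (q.1 * c)) _ = Ind.tmul _ _ (φ (q.1 • m))
      rw [hφ, Ind.tmul_eq, Ind.tmul_eq, Algebra.smul_def, map_mul, map_mul, map_mul,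
        outer_mem _ _ (incl_mem q.2)]
      ring)

theorem indAdjoinAux_tmul (i : Fin n) (φ : M →+* M') (hφ : IsSemilinear k n φ)
    (c : PolyRing k n) (m : M) : indAdjoinAux i φ hφ (Ind.tmul i c m) =
      Ind.tmul i.castSucc (incl k n c) (φ m) := rfl

/-- The ring homomorphism `a ⊗ m ↦ a ⊗ φ m`. -/
def indAdjoin (i : Fin n) (φ : M →+* M') (hφ : IsSemilinear k n φ) :
    Ind k i M →+* Ind k i.castSucc M' where
  toFun := indAdjoinAux i φ hφ
  map_one' := by
    have h1 : (1 : Ind k i M) = Ind.tmul i 1 1 := rfl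
    rw [h1, indAdjoinAux_tmul, map_one, map_one]
    rfl
  map_zero' := map_zero _
  map_add' := map_add _
  map_mul' x y := by
    induction x using Ind.induction with
    | zero => rw [zero_mul, map_zero, zero_mul]
    | add x x' hx hx' => rw [add_mul, map_add, hx, hx', map_add, add_mul]
    | tmul a m =>
      induction y using Ind.induction with
      | zero => rw [mul_zero, map_zero, mul_zero]
      | add y y' hy hy' => rw [mul_add, map_add, hy, hy', map_add, mul_add]
      | tmul b m' =>
        rw [Ind.tmul_mul_tmul]
        simp only [indAdjoinAux_tmul, map_mul, Ind.tmul_mul_tmul]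

section

variable (i j : Fin n) (φ : M →+* M') (hφ : IsSemilinear k n φ)

theorem indAdjoin_tmul (c : PolyRing k n) (m : M) : indAdjoin i φ hφ (Ind.tmul i c m) =
    Ind.tmul i.castSucc (incl k n c) (φ m) := rfl

theorem indAdjoin_inner (m : M) :
    indAdjoin i φ hφ (inner k i M m) = inner k i.castSucc M' (φ m) := by
  have h := indAdjoin_tmul i φ hφ 1 m
  rw [map_one] at h
  exact h

theorem indAdjoin_outer (p : PolyRing k n) :
    indAdjoin i φ hφ (outer i M p) = outer i.castSucc M' (incl k n p) := by
  have h := indAdjoin_tmul i φ hφ p 1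
  rw [map_one] at h
  exact h

theorem isSemilinear_indAdjoin : IsSemilinear k n (indAdjoin i φ hφ) := by
  intro p m
  rw [Algebra.smul_def, Algebra.smul_def, map_mul]
  exact congrArg (· * _) (indAdjoin_outer i φ hφ p)

theorem mulInd_indAdjoin (x : Ind k i M) :
    mulInd i.castSucc M' (indAdjoin i φ hφ x) = φ (mulInd i M x) := by
  induction x using Ind.induction with
  | zero => simp only [map_zero]
  | add x y hx hy => simp only [map_add, hx, hy]
  | tmul c m => rw [indAdjoin_tmul, mulInd_tmul, mulInd_tmul, hφ]

theorem demInd_indAdjoin (x : Ind k i M) :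
    demInd i.castSucc M' (indAdjoin i φ hφ x) = φ (demInd i M x) := by
  induction x using Ind.induction with
  | zero => simp only [map_zero]
  | add x y hx hy => simp only [map_add, hx, hy]
  | tmul c m => rw [indAdjoin_tmul, demInd_tmul, demInd_tmul, hφ, incl_demazure]

theorem IsSemilinear.algebraMap {φ : M →+* M'} (hφ : IsSemilinear k n φ) (p : PolyRing k n) :
    φ (algebraMap _ M p) = algebraMap _ M' (incl k n p) := by
  have h := hφ p 1
  rw [Algebra.smul_def, Algebra.smul_def, map_one, mul_one, mul_one] at h
  exact h

variable [NeZero (2 : k)]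

theorem indAdjoin_map {N : Type u} [CommRing N] [Algebra (PolyRing k n) N]
    {N' : Type u} [CommRing N'] [Algebra (PolyRing k (n + 1)) N'] (ψ : N →+* N')
    (hψ : IsSemilinear k n ψ) (f : M →ₗ[PolyRing k n] N) (f' : M' →ₗ[PolyRing k (n + 1)] N')
    (h : ∀ m, ψ (f m) = f' (φ m)) (x : Ind k i M) :
    indAdjoin i ψ hψ (Ind.map i f x) = Ind.map i.castSucc f' (indAdjoin i φ hφ x) := by
  induction x using Ind.induction with
  | zero => simp only [map_zero]
  | add x y hx hy => simp only [map_add, hx, hy]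
  | tmul c m => rw [indAdjoin_tmul, Ind.map_tmul, Ind.map_tmul, indAdjoin_tmul, h]

theorem indAdjoin_fourValent (h : Distant i j) (h' : Distant i.castSucc j.castSucc)
    (x : Ind k i (Ind k j M)) :
    indAdjoin j _ (isSemilinear_indAdjoin i φ hφ) (fourValent M h x) =
      fourValent M' h'
        (indAdjoin i _ (isSemilinear_indAdjoin j φ hφ) x) := by
  induction x using Ind.induction with
  | zero => simp only [map_zero]
  | add x y hx hy => simp only [map_add, hx, hy]
  | tmul a y =>
    induction y using Ind.induction with
    | zero => rw [Ind.tmul_zero]; simp only [map_zero]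
    | add x y hx hy => rw [Ind.tmul_add]; simp only [map_add, hx, hy]
    | tmul b m =>
      rw [indAdjoin_tmul, indAdjoin_tmul, fourValent_tmul, fourValent_tmul,
        isSemilinear_indAdjoin, fourTerm_eq, fourTerm_eq]
      simp only [map_add, map_mul, indAdjoin_outer, indAdjoin_inner, incl_average, incl_demazure,
        hφ.algebraMap, incl_halfRoot]

theorem indAdjoin_sixValent (h : Adjacent i j) (h' : Adjacent i.castSucc j.castSucc)
    (x : Ind k i (Ind k j (Ind k i M))) :
    indAdjoin j _ (isSemilinear_indAdjoin i _ (isSemilinear_indAdjoin j φ hφ))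
        (sixValent M h x) =
      sixValent M' h'
        (indAdjoin i _ (isSemilinear_indAdjoin j _ (isSemilinear_indAdjoin i φ hφ)) x) := by
  induction x using Ind.induction with
  | zero => simp only [map_zero]
  | add x y hx hy => simp only [map_add, hx, hy]
  | tmul a y =>
    induction y using Ind.induction with
    | zero => rw [Ind.tmul_zero]; simp only [map_zero]
    | add x y hx hy => rw [Ind.tmul_add]; simp only [map_add, hx, hy]
    | tmul b z =>
      induction z using Ind.induction with
      | zero => rw [Ind.tmul_zero, Ind.tmul_zero]; simp only [map_zero]
      | add x y hx hy => rw [Ind.tmul_add, Ind.tmul_add]; simp only [map_add, hx, hy]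
      | tmul c m =>
        rw [indAdjoin_tmul, indAdjoin_tmul, indAdjoin_tmul, sixValent_tmul, sixValent_tmul,
          isSemilinear_indAdjoin]
        simp only [sixTerm, sixDelta, sixGamma, slot₀, slot₁, slot₂, slot₃, RingHom.comp_apply,
          mulInd_tmul, demInd_tmul, map_add, map_sub, map_mul, map_ofNat, indAdjoin_outer,
          indAdjoin_inner, incl_demazure, incl_refl, hφ.algebraMap, incl_halfRoot, incl_X, hφ _ _]

-- An element of `R ⊗ M` can be recovered from its images under `c ⊗ m ↦ c m` and `c ⊗ m ↦ (∂_i c)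
-- m`. Both maps are compatible with adjoining a variable, which makes injectivity pass to induced
-- modules.
omit [Algebra (PolyRing k (n + 1)) M'] in
theorem eq_inner_mulInd_add (x : Ind k i M) : x = inner k i M (mulInd i M x) +
    (outer i M (halfRoot k i) - inner k i M (algebraMap _ M (halfRoot k i))) *
      inner k i M (demInd i M x) := by
  induction x using Ind.induction with
  | zero => simp only [map_zero, mul_zero, add_zero]
  | add x y hx hy =>
    conv_lhs => rw [hx, hy]
    simp only [map_add]
    ring
  | tmul c m =>
    have h := outer_sub_inner i M c
    rw [mulInd_tmul, demInd_tmul, Ind.tmul_eq, Algebra.smul_def, Algebra.smul_def, map_mul, map_mul]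
    linear_combination h * inner k i M m

theorem indAdjoin_injective (h : Function.Injective φ) :
    Function.Injective (indAdjoin i φ hφ) := by
  rw [injective_iff_map_eq_zero]
  intro x hx
  have h1 := mulInd_indAdjoin i φ hφ x
  have h2 := demInd_indAdjoin i φ hφ x
  rw [hx, map_zero] at h1 h2
  rw [eq_inner_mulInd_add i x, (map_eq_zero_iff φ h).1 h1.symm, (map_eq_zero_iff φ h).1 h2.symm]
  simp only [map_zero, mul_zero, add_zero]

end

/-- The semilinear ring homomorphism from a Bott-Samelson bimodule to the one with an additional
variable. -/
def BS.adjoin : (w : List (Fin n)) → {φ : BS k w →+* BX k w // IsSemilinear k n φ}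
  | [] => ⟨(incl k n).toRingHom, fun p m => map_mul (incl k n) p m⟩
  | i :: w => ⟨indAdjoin i (BS.adjoin w).1 (BS.adjoin w).2, isSemilinear_indAdjoin _ _ _⟩

variable {x y : List (Fin n)}

theorem BS.adjoin_right (r : PolyRing k n) :
    (BS.adjoin x).1 (BS.right k x r) = BX.right k x (incl k n r) := by
  induction x with
  | nil => rfl
  | cons i x ih =>
    exact (indAdjoin_inner i (BS.adjoin x).1 (BS.adjoin x).2 _).trans (congrArg _ ih)

variable [NeZero (2 : k)]

theorem BS.adjoin_injective (x : List (Fin n)) : Function.Injective (BS.adjoin (k := k) x).1 := by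
  induction x with
  | nil => exact rename_injective _ (Fin.castSucc_injective n)
  | cons i x ih => exact indAdjoin_injective i _ (BS.adjoin x).2 ih

theorem BS.adjoin_whiskerLeft (u : List (Fin n)) {f : BS k x →ₗ[PolyRing k n] BS k y}
    {f' : Hom k x y} (h : ∀ m, (BS.adjoin y).1 (f m) = f' ((BS.adjoin x).1 m)) (m : BS k (u ++ x)) :
    (BS.adjoin (u ++ y)).1 (whiskerLeft f u m) = BX.whisker u f' ((BS.adjoin (u ++ x)).1 m) := by
  induction u with
  | nil => exact h m
  | cons i u ih =>
    exact indAdjoin_map i (BS.adjoin (u ++ x)).1 (BS.adjoin (u ++ x)).2 (BS.adjoin (u ++ y)).1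
      (BS.adjoin (u ++ y)).2 (whiskerLeft f u) (BX.whisker u f') ih m

theorem Edge.adjoin_mor (e : Edge x y) (m : BS k x) :
    (BS.adjoin y).1 (e.mor k m) = e.hom k ((BS.adjoin x).1 m) := by
  cases e with
  | distant u v i j h =>
    exact BS.adjoin_whiskerLeft (x := i :: j :: v) (y := j :: i :: v)
      (f := fourValent (BS k v) h) (f' := BX.four h v) u
      (indAdjoin_fourValent i j (BS.adjoin v).1 (BS.adjoin v).2 h h) m
  | adjacent u v i j h =>
    exact BS.adjoin_whiskerLeft (x := i :: j :: i :: v) (y := j :: i :: j :: v)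
      (f := sixValent (BS k v) h) (f' := BX.six h v) u
      (indAdjoin_sixValent i j (BS.adjoin v).1 (BS.adjoin v).2 h h) m

namespace Path

theorem adjoin_mor (p : Path x y) (m : BS k x) :
    (BS.adjoin y).1 (p.mor k m) = p.hom k ((BS.adjoin x).1 m) := by
  induction p with
  | nil => rfl
  | cons e p ih => exact (ih _).trans (congrArg (p.hom k) (e.adjoin_mor m))

/-- A path morphism that maps to the subbimodule generated by `1` is determined by its ends. -/
theorem mor_eq (p q : Path x y) (hp : ∀ m, p.hom k m ∈ oneSpan (BX.right k y))
    (hq : ∀ m, q.hom k m ∈ oneSpan (BX.right k y)) : p.mor k = q.mor k := by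
  refine LinearMap.ext fun m => BS.adjoin_injective y ?_
  rw [adjoin_mor, adjoin_mor, hom_eq p q hp hq]

theorem mor_mul_right (p : Path x y) (m : BS k x) (r : PolyRing k n) :
    p.mor k (m * BS.right k x r) = p.mor k m * BS.right k y r := by
  apply BS.adjoin_injective y
  rw [adjoin_mor, (BS.adjoin x).1.map_mul, (BS.adjoin y).1.map_mul, BS.adjoin_right,
    BS.adjoin_right, adjoin_mor]
  exact p.adjointPair.left.map_mul _ _

theorem mor_append {z : List (Fin n)} (p : Path x y) (q : Path y z) :
    (p.append q).mor k = q.mor k ∘ₗ p.mor k := by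
  induction p with
  | nil => rfl
  | cons e p ih => exact congrArg (· ∘ₗ e.mor k) (ih q)

end Path

end adjoin

/-! ### Reduced words -/

section words

variable {n : ℕ} {x y : List (Fin n)}

theorem wordProd_cons (i : Fin n) (x : List (Fin n)) : wordProd (i :: x) = simple i * wordProd x :=
  rfl

theorem wordProd_append (x y : List (Fin n)) : wordProd (x ++ y) = wordProd x * wordProd y := by
  rw [wordProd, List.map_append, List.prod_append]; rfl

theorem simple_mul_self (i : Fin n) : simple i * simple i = 1 := Equiv.swap_mul_self _ _

theorem simple_inv (i : Fin n) : (simple i)⁻¹ = simple i := Equiv.swap_inv _ _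

theorem wordProd_reverse (x : List (Fin n)) : wordProd x.reverse = (wordProd x)⁻¹ := by
  induction x with
  | nil => rfl
  | cons i x ih =>
    rw [List.reverse_cons, wordProd_append, ih, wordProd_cons i x, mul_inv_rev, simple_inv]; rfl

theorem simple_apply_of_ne {i : Fin n} {p : Fin (n + 1)} (h : p.val ≠ i.val)
    (h' : p.val ≠ i.val + 1) : simple i p = p :=
  Equiv.swap_apply_of_ne_of_ne (fun e => h (congrArg Fin.val e)) fun e => h' (congrArg Fin.val e)

theorem simple_apply_of_eq {i : Fin n} {p : Fin (n + 1)} (h : p.val = i.val) :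
    (simple i p).val = i.val + 1 := by
  obtain rfl : p = i.castSucc := Fin.ext h
  rw [simple, Equiv.swap_apply_left]; rfl

theorem simple_comm {i j : Fin n} (h : Distant i j) : simple i * simple j = simple j * simple i := by
  refine Equiv.Perm.Disjoint.commute fun p => ?_
  by_cases h1 : p.val = i.val ∨ p.val = i.val + 1
  · refine Or.inr (simple_apply_of_ne ?_ ?_) <;> simp only [Distant] at h <;> omega
  · exact Or.inl (simple_apply_of_ne (by omega) (by omega))

/-- Both sides are the transposition of the two outer points. -/
theorem simple_braid_of_succ {i j : Fin n} (h : i.val + 1 = j.val) :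
    simple i * simple j * simple i = simple j * simple i * simple j := by
  have e : j.castSucc = i.succ := Fin.ext h.symm
  have h1 : i.castSucc ≠ i.succ := by simp [Fin.ext_iff]
  have h2 : i.castSucc ≠ j.succ := by simp only [ne_eq, Fin.ext_iff, Fin.val_castSucc, Fin.val_succ]; omega
  have h3 : j.succ ≠ i.succ := by simp only [ne_eq, Fin.ext_iff, Fin.val_succ]; omega
  rw [simple, simple, e, Equiv.swap_mul_swap_mul_swap h1 h2, Equiv.swap_comm i.castSucc,
    Equiv.swap_comm i.succ j.succ, Equiv.swap_mul_swap_mul_swap h3 h2.symm, Equiv.swap_comm]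

theorem simple_braid {i j : Fin n} (h : Adjacent i j) :
    simple i * simple j * simple i = simple j * simple i * simple j := by
  rcases h with h | h
  · exact simple_braid_of_succ h
  · exact (simple_braid_of_succ h).symm

theorem Edge.wordProd_eq (e : Edge x y) : wordProd y = wordProd x := by
  cases e with
  | distant u v i j h =>
    simp only [wordProd_append, wordProd_cons, ← mul_assoc]
    rw [mul_assoc _ (simple j), ← simple_comm h, ← mul_assoc]
  | adjacent u v i j h =>
    have e := simple_braid h
    have e' := congrArg (fun a => wordProd u * (a * wordProd v)) e
    simpa only [wordProd_append, wordProd_cons, mul_assoc] using e'.symm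

theorem Edge.length_eq (e : Edge x y) : y.length = x.length := by
  cases e <;> simp only [List.length_append, List.length_cons]

theorem Path.wordProd_eq (p : Path x y) : wordProd y = wordProd x := by
  induction p with
  | nil => rfl
  | cons e p ih => exact ih.trans e.wordProd_eq

theorem Path.length_eq (p : Path x y) : y.length = x.length := by
  induction p with
  | nil => rfl
  | cons e p ih => exact ih.trans e.length_eq

theorem len_wordProd_le (x : List (Fin n)) : len (wordProd x) ≤ x.length :=
  Nat.sInf_le ⟨x, rfl, rfl⟩

theorem exists_isReducedExpr (x : List (Fin n)) : ∃ y, IsReducedExpr (wordProd x) y := by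
  obtain ⟨y, h1, h2⟩ := Nat.sInf_mem (s := {l | ∃ y : List (Fin n), wordProd y = wordProd x ∧
    y.length = l}) ⟨_, x, rfl, rfl⟩
  exact ⟨y, h1, h2⟩

theorem IsReducedExpr.of_path {w : Equiv.Perm (Fin (n + 1))} (hx : IsReducedExpr w x)
    (p : Path x y) : IsReducedExpr w y :=
  ⟨p.wordProd_eq.trans hx.1, p.length_eq.trans hx.2⟩

theorem wordProd_mem_closure {J : Set (Fin n)} (hx : ∀ i ∈ x, i ∈ J) :
    wordProd x ∈ Subgroup.closure (simple '' J) := by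
  induction x with
  | nil => exact one_mem _
  | cons i x ih =>
    exact mul_mem (Subgroup.subset_closure ⟨i, hx i List.mem_cons_self, rfl⟩)
      (ih fun j hj => hx j (List.mem_cons_of_mem _ hj))

theorem exists_word_of_mem_closure {J : Set (Fin n)} {w : Equiv.Perm (Fin (n + 1))}
    (hw : w ∈ Subgroup.closure (simple '' J)) :
    ∃ x : List (Fin n), (∀ i ∈ x, i ∈ J) ∧ wordProd x = w := by
  induction hw using Subgroup.closure_induction with
  | mem _ h =>
    obtain ⟨i, hi, rfl⟩ := h
    exact ⟨[i], by simpa using hi, mul_one _⟩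
  | one => exact ⟨[], by simp, rfl⟩
  | mul _ _ _ _ h h' =>
    obtain ⟨x, hx, rfl⟩ := h
    obtain ⟨y, hy, rfl⟩ := h'
    exact ⟨x ++ y, fun i hi => (List.mem_append.1 hi).elim (hx i) (hy i), wordProd_append x y⟩
  | inv _ _ h =>
    obtain ⟨x, hx, rfl⟩ := h
    exact ⟨x.reverse, fun i hi => hx i (List.mem_reverse.1 hi), wordProd_reverse x⟩

/-! ### Normal forms -/

variable {c : ℕ} {u u' : List (Fin n)} {L L' : List (List (Fin n))}

theorem wordProd_apply_of_lt (hx : ∀ i ∈ x, c ≤ i.val) {p : Fin (n + 1)} (hp : p.val < c) :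
    wordProd x p = p := by
  induction x with
  | nil => rfl
  | cons i x ih =>
    have := hx i List.mem_cons_self
    rw [wordProd_cons, Equiv.Perm.mul_apply, ih fun j hj => hx j (List.mem_cons_of_mem _ hj),
      simple_apply_of_ne (by omega) (by omega)]

theorem wordProd_apply_of_gt {e : ℕ} (hx : ∀ i ∈ x, i.val < e) {p : Fin (n + 1)} (hp : e < p.val) :
    wordProd x p = p := by
  induction x with
  | nil => rfl
  | cons i x ih =>
    have := hx i List.mem_cons_self
    rw [wordProd_cons, Equiv.Perm.mul_apply, ih fun j hj => hx j (List.mem_cons_of_mem _ hj),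
      simple_apply_of_ne (by omega) (by omega)]

theorem IsBlocks.le (hL : IsBlocks c L) : ∀ i ∈ blockWord L, c ≤ i.val := by
  induction L generalizing c with
  | nil => simp [blockWord]
  | cons u L ih =>
    intro i hi
    rcases List.mem_append.1 hi with hi | hi
    · exact hL.1.le i hi
    · exact (Nat.le_succ c).trans (ih hL.2 i hi)

/-- The letters of a block, read from the right, carry the point `c` upwards one step at a time. -/
theorem IsBlock.wordProd_apply (hu : IsBlock c u) {p : Fin (n + 1)} (hp : p.val = c) :
    (wordProd u p).val = c + u.length := by
  induction u with
  | nil => exact hp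
  | cons i u ih =>
    have h1 := ih hu.2
    rw [wordProd_cons, Equiv.Perm.mul_apply, simple_apply_of_eq (h1.trans hu.1.symm), hu.1]
    rfl

theorem IsBlocks.wordProd_apply (hL : IsBlocks c (u :: L)) {p : Fin (n + 1)} (hp : p.val = c) :
    (wordProd (blockWord (u :: L)) p).val = c + u.length := by
  have h1 : wordProd (blockWord L) p = p :=
    wordProd_apply_of_lt hL.2.le (by omega)
  rw [show blockWord (u :: L) = u ++ blockWord L from rfl, wordProd_append, Equiv.Perm.mul_apply, h1,
    hL.1.wordProd_apply hp]

theorem IsBlock.length_eq_zero (hu : IsBlock c u) (hc : n ≤ c) : u.length = 0 := by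
  cases u with
  | nil => rfl
  | cons i u => have := hu.1; omega

theorem IsBlock.ext (hu : IsBlock c u) (hu' : IsBlock c u') (h : u.length = u'.length) :
    u = u' := by
  induction u generalizing u' with
  | nil => exact (List.length_eq_zero_iff.1 h.symm).symm
  | cons i u ih =>
    cases u' with
    | nil => simp at h
    | cons i' u' =>
      obtain rfl := ih hu.2 hu'.2 (Nat.succ.inj h)
      rw [Fin.ext (hu.1.trans hu'.1.symm)]

/-- A list of blocks is determined by its product. -/
theorem IsBlocks.ext (hL : IsBlocks c L) (hL' : IsBlocks c L') (hl : L.length = L'.length)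
    (h : wordProd (blockWord L) = wordProd (blockWord L')) : L = L' := by
  induction L generalizing c L' with
  | nil => exact (List.length_eq_zero_iff.1 hl.symm).symm
  | cons u L ih =>
    cases L' with
    | nil => simp at hl
    | cons u' L' =>
      -- The length of the first block is read off from the image of the point `c`, because later
      -- blocks fix that point. Past the last point all blocks are empty.
      have h1 : u.length = u'.length := by
        by_cases hc : c < n + 1
        · have e := hL.wordProd_apply (p := ⟨c, hc⟩) rfl
          rw [h, hL'.wordProd_apply (p := ⟨c, hc⟩) rfl] at e
          omega
        · rw [hL.1.length_eq_zero (by omega), hL'.1.length_eq_zero (by omega)]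
      obtain rfl := hL.1.ext hL'.1 h1
      have h2 : wordProd u * wordProd (blockWord L) = wordProd u * wordProd (blockWord L') := by
        rw [← wordProd_append, ← wordProd_append]; exact h
      rw [ih hL.2 hL'.2 (Nat.succ.inj hl) (mul_left_cancel h2)]

variable (k : Type u) [Field k] [NeZero (2 : k)]

include k

/-- Insertion is obstructed only when the travelling letter equals the first letter of a block. Then
the two cancel in the group, and a shorter word with the same product appears. -/
theorem exists_ins (hL : IsBlocks c L) {i : Fin n} (hc : c ≤ i.val) (hn : n ≤ c + L.length) :
    (∃ (L' : List (List (Fin n))) (g : Hom k (i :: blockWord L) (blockWord L')), Ins c i L L' g) ∨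
      ∃ y, wordProd y = wordProd (i :: blockWord L) ∧ y.length < (blockWord L).length := by
  induction L generalizing c i with
  | nil => simp only [List.length_nil] at hn; omega
  | cons u L ih =>
    rw [List.length_cons] at hn
    have step (i' : Fin n) (f : Hom k (i :: (u ++ blockWord L)) (u ++ i' :: blockWord L))
        (hf : Cross i u (blockWord L) i' f) (hi : i.val ≠ c + u.length) (hi' : c + 1 ≤ i'.val) :
        (∃ (L' : List (List (Fin n))) (g : Hom k (i :: blockWord (u :: L)) (blockWord L')),
          Ins c i (u :: L) L' g) ∨
        ∃ y, wordProd y = wordProd (i :: blockWord (u :: L)) ∧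
          y.length < (blockWord (u :: L)).length := by
      rcases ih hL.2 hi' (by omega) with ⟨L', g, hg⟩ | ⟨y, hy, hy'⟩
      · exact Or.inl ⟨_, _, .cross hc hi hf hg⟩
      · obtain ⟨p, -⟩ := hf.exists_path
        refine Or.inr ⟨u ++ y, ?_, ?_⟩
        · rw [wordProd_append, hy, ← wordProd_append]
          exact p.wordProd_eq
        · rw [List.length_append, show blockWord (u :: L) = u ++ blockWord L from rfl,
            List.length_append]
          omega
    rcases lt_trichotomy i.val (c + u.length) with h | h | h
    · by_cases h' : i.val + 1 = c + u.length
      · cases u with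
        | nil => simp only [List.length_nil] at h; omega
        | cons i' u =>
          obtain rfl : i = i' := Fin.ext (by
            have := hL.1.1
            rw [List.length_cons] at h'
            omega)
          refine Or.inr ⟨u ++ blockWord L, ?_, ?_⟩
          · change _ = simple i * (simple i * wordProd (u ++ blockWord L))
            rw [← mul_assoc, simple_mul_self, one_mul]
          · exact Nat.lt_succ_self _
      · obtain ⟨i', f, hi', hf⟩ := Cross.exists_succ (k := k) hL.1 hc (by omega) (blockWord L)
        exact step i' f hf (by omega) (by omega)
    · exact Or.inl ⟨_, _, .absorb L h⟩
    · obtain ⟨f, hf⟩ := Cross.exists_far (k := k) hL.1 h (blockWord L)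
      exact step i f hf (by omega) (by omega)

theorem can_replicate (c m : ℕ) :
    ∃ (L : List (List (Fin n))) (f : Hom k [] (blockWord L)), Can c [] L f ∧ L.length = m := by
  induction m with
  | zero => exact ⟨_, _, .nil, rfl⟩
  | succ m ih =>
    obtain ⟨L, f, hf, hm⟩ := ih
    exact ⟨_, _, .empty hf, congrArg (· + 1) hm⟩

/-- For a reduced word the obstruction of `exists_ins` never occurs, since it would yield a shorter
expression. Having at least `n` blocks ensures that the list is not exhausted before a letter is
absorbed. -/
theorem exists_can {m : ℕ} (hm : n ≤ m) (hx : x.length = len (wordProd x)) :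
    ∃ (L : List (List (Fin n))) (f : Hom k x (blockWord L)), Can 0 x L f ∧ L.length = m := by
  induction x with
  | nil => exact can_replicate k 0 m
  | cons i x ih =>
    have h1 : x.length = len (wordProd x) := by
      refine le_antisymm ?_ (len_wordProd_le x)
      obtain ⟨y, hy, hy'⟩ := exists_isReducedExpr x
      have := len_wordProd_le (i :: y)
      rw [wordProd_cons, hy, ← wordProd_cons, ← hx, List.length_cons, List.length_cons] at this
      omega
    obtain ⟨L, f, hf, hL⟩ := ih h1
    rcases exists_ins k hf.isBlocks (i := i) (Nat.zero_le _) (by omega) with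
      ⟨L', g, hg⟩ | ⟨y, hy, hy'⟩
    · exact ⟨L', _, .cons hf hg, hg.length_eq.trans hL⟩
    · obtain ⟨p, -⟩ := hf.exists_path
      have := len_wordProd_le y
      rw [hy, wordProd_cons, p.wordProd_eq, ← wordProd_cons, ← hx, List.length_cons] at this
      rw [p.length_eq] at hy'
      omega

/-- Every reduced expression is connected by an oriented path to the word of a list of blocks. -/
theorem IsReducedExpr.exists_path {w : Equiv.Perm (Fin (n + 1))} (hx : IsReducedExpr w x)
    (hL : IsBlocks 0 L) (hn : n ≤ L.length) (h : wordProd (blockWord L) = w) :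
    ∃ p : Path x (blockWord L), p.IsOriented := by
  obtain ⟨rfl, hx⟩ := hx
  obtain ⟨L', f, hf, hL'⟩ := exists_can k hn hx
  obtain ⟨p, hp, -⟩ := hf.exists_path
  obtain rfl := hL.ext hf.isBlocks hL'.symm (h.trans p.wordProd_eq.symm)
  exact ⟨p, hp⟩

/-- Any reduced expression of the product is joined by a path to this block word, and paths preserve
length. -/
theorem IsBlocks.isReducedExpr (hL : IsBlocks 0 L) (hn : n ≤ L.length) :
    IsReducedExpr (wordProd (blockWord L)) (blockWord L) := by
  obtain ⟨x, hx⟩ := exists_isReducedExpr (blockWord L)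
  obtain ⟨p, -⟩ := hx.exists_path k hL hn rfl
  exact hx.of_path p

omit k

/-! ### The longest element -/

theorem blockWord_replicate (d : ℕ) (L : List (List (Fin n))) :
    blockWord (List.replicate d [] ++ L) = blockWord L := by
  induction d with
  | zero => rfl
  | succ d ih => exact ih

theorem IsBlocks.replicate {a d : ℕ} (hL : IsBlocks a L) (h : c + d = a) :
    IsBlocks c (List.replicate d [] ++ L) := by
  induction d generalizing c with
  | zero => subst h; exact hL
  | succ d ih => exact ⟨trivial, ih (by omega)⟩

theorem IsBlocks.exists_eq_replicate {a d m : ℕ} (hL : IsBlocks c L) (hl : L.length = d + m)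
    (hd : c + d = a) (h : ∀ p : Fin (n + 1), p.val < a → wordProd (blockWord L) p = p) :
    ∃ L', L = List.replicate d [] ++ L' ∧ IsBlocks a L' ∧ L'.length = m := by
  induction d generalizing c L with
  | zero => subst hd; exact ⟨L, rfl, hL, by omega⟩
  | succ d ih =>
    cases L with
    | nil => simp only [List.length_nil] at hl; omega
    | cons u L =>
      rw [List.length_cons] at hl
      have hu : u = [] := by
        rw [← List.length_eq_zero_iff]
        by_cases hc : c < n + 1
        · have e := hL.wordProd_apply (p := ⟨c, hc⟩) rfl
          rw [h ⟨c, hc⟩ (by dsimp only; omega)] at e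
          dsimp only at e
          omega
        · exact hL.1.length_eq_zero (by omega)
      subst hu
      obtain ⟨L', rfl, h1, h2⟩ := ih hL.2 (by omega) (by omega) h
      exact ⟨L', rfl, h1, h2⟩

/-- If a product fixes all points above `e`, the block that ends at `c` cannot carry `c` beyond `e`,
so its length is at most `e - c`. In the stage list all these bounds are attained. -/
theorem Stage.length_le {e : ℕ} (hL : IsBlocks c L) (hs : Stage e 0 c L) (hL' : IsBlocks c L')
    (hl : L'.length = L.length)
    (h : ∀ p : Fin (n + 1), e < p.val → wordProd (blockWord L') p = p) :
    (blockWord L').length ≤ (blockWord L).length ∧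
      ((blockWord L).length ≤ (blockWord L').length → L' = L) := by
  induction L generalizing c L' with
  | nil =>
    obtain rfl := List.length_eq_zero_iff.1 hl
    exact ⟨le_rfl, fun _ => rfl⟩
  | cons u L ih =>
    cases L' with
    | nil => simp at hl
    | cons u' L' =>
      have h1 : u'.length ≤ u.length := by
        rw [hs.1]
        by_cases hc : c < n + 1
        · have e1 := hL'.wordProd_apply (p := ⟨c, hc⟩) rfl
          by_contra hlt
          -- A block that is too long would carry `c` to a point above `e`. That point is fixed, so
          -- by injectivity it would be `c` itself.
          have e2 := h (wordProd (blockWord (u' :: L')) ⟨c, hc⟩) (by omega)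
          rw [EmbeddingLike.apply_eq_iff_eq] at e2
          rw [e2] at e1
          dsimp only at e1
          omega
        · rw [hL'.1.length_eq_zero (by omega)]; exact Nat.zero_le _
      have h2 : ∀ p : Fin (n + 1), e < p.val → wordProd (blockWord L') p = p := by
        intro p hp
        have h3 := h p hp
        rw [show blockWord (u' :: L') = u' ++ blockWord L' from rfl, wordProd_append,
          Equiv.Perm.mul_apply] at h3
        have h4 : wordProd u' p = p := by
          by_cases hu : u'.length = 0
          · rw [List.length_eq_zero_iff.1 hu]; rfl
          · refine wordProd_apply_of_gt (fun i hi => ?_) hp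
            have := hL'.1.lt i hi
            have := hs.1
            omega
        exact (wordProd u').injective (h3.trans h4.symm)
      obtain ⟨h3, h4⟩ := ih hL.2 hs.2 hL'.2 (Nat.succ.inj hl) h2
      simp only [blockWord, List.length_append]
      refine ⟨by omega, fun h5 => ?_⟩
      rw [hL'.1.ext hL.1 (by omega), h4 (by omega)]

end words

/-! ### The standard source and the standard sink -/

section standardWords

variable {n : ℕ} {w : Equiv.Perm (Fin (n + 1))} {a b : Fin n} {x y : List (Fin n)}

theorem Stage.mem_Icc {a b : Fin n} {L : List (List (Fin n))} (hL : IsBlocks a.val L)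
    (hs : Stage (b.val + 1) 0 a.val L) : ∀ i ∈ blockWord L, i ∈ Set.Icc a b := by
  intro i hi
  exact ⟨Fin.le_def.2 (hL.le i hi), Fin.le_def.2 (Nat.lt_succ_iff.1 (hs.lt hL i hi))⟩

/-- The longest element is the product of blocks of maximal length, and all reduced expressions are
connected to this word by oriented paths. -/
theorem IsLongest.exists_path_sink (k : Type u) [Field k] [NeZero (2 : k)]
    (hw : IsLongest (Set.Icc a b) w) {L : List (List (Fin n))} (hL : IsBlocks a.val L)
    (hs : Stage (b.val + 1) 0 a.val L) (hn : L.length = n) :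
    IsReducedExpr w (blockWord L) ∧
      ∀ x, IsReducedExpr w x → ∃ p : Path x (blockWord L), p.IsOriented := by
  -- Normal forms start with the block that ends at 0; the first `a` blocks are empty.
  have hL0 : IsBlocks 0 (List.replicate a.val [] ++ L) := hL.replicate (Nat.zero_add _)
  have hn0 : n ≤ (List.replicate a.val [] ++ L).length := by
    rw [List.length_append]; omega
  have hT := hL0.isReducedExpr k hn0
  rw [blockWord_replicate] at hT
  obtain ⟨x, hx, rfl⟩ := exists_word_of_mem_closure hw.1
  have hxa : ∀ i ∈ x, a.val ≤ i.val := fun i hi => Fin.le_def.1 (hx i hi).1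
  have hxb : ∀ i ∈ x, i.val < b.val + 1 := fun i hi => Nat.lt_succ_iff.2 (Fin.le_def.1 (hx i hi).2)
  obtain ⟨y, hy⟩ := exists_isReducedExpr x
  obtain ⟨L', f, hf, hl⟩ := exists_can k (x := y) (m := a.val + n) (by omega)
    (by rw [hy.1]; exact hy.2)
  obtain ⟨p, -⟩ := hf.exists_path
  have hw' : wordProd (blockWord L') = wordProd x := p.wordProd_eq.trans hy.1
  obtain ⟨L'', rfl, h1, h2⟩ := hf.isBlocks.exists_eq_replicate hl (Nat.zero_add _)
    fun q hq => by rw [hw']; exact wordProd_apply_of_lt hxa hq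
  rw [blockWord_replicate] at hw'
  obtain ⟨h3, h4⟩ := Stage.length_le hL hs h1 (h2.trans hn.symm)
    fun q hq => by rw [hw']; exact wordProd_apply_of_gt hxb hq
  -- Maximality of `w` bounds the length of the stage word by that of the normal form of `w`; then
  -- `h4` identifies the two.
  have h5 := hw.2 _ (wordProd_mem_closure (Stage.mem_Icc hL hs))
  have h6 := p.length_eq
  rw [blockWord_replicate] at h6
  have h7 := hT.2
  have h8 := hy.2
  obtain rfl := h4 (by omega)
  have hT' : IsReducedExpr (wordProd x) (blockWord L'') := ⟨hw', by omega⟩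
  refine ⟨hT', fun z hz => ?_⟩
  have := hz.exists_path k hL0 hn0 (by rw [blockWord_replicate]; exact hw')
  rwa [blockWord_replicate] at this

/-! ### The automorphism of the Dynkin diagram -/

theorem simple_rev (i : Fin n) : simple i.rev = Fin.revPerm * simple i * Fin.revPerm⁻¹ := by
  rw [simple, ← Fin.rev_succ, ← Fin.rev_castSucc, Equiv.swap_comm]
  exact Equiv.swap_apply_apply Fin.revPerm _ _

theorem wordProd_map_rev (x : List (Fin n)) :
    wordProd (x.map Fin.rev) = Fin.revPerm * wordProd x * Fin.revPerm⁻¹ := by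
  induction x with
  | nil => exact (mul_inv_cancel _).symm
  | cons i x ih =>
    rw [List.map_cons, wordProd_cons, ih, simple_rev, wordProd_cons]
    group

theorem map_rev_map_rev (x : List (Fin n)) : (x.map Fin.rev).map Fin.rev = x := by
  simp [Function.comp_def]

theorem len_conj_rev (w : Equiv.Perm (Fin (n + 1))) :
    len (Fin.revPerm * w * Fin.revPerm⁻¹) = len w := by
  have hr : (Fin.revPerm : Equiv.Perm (Fin (n + 1))) * Fin.revPerm = 1 :=
    Equiv.ext fun i => Fin.rev_rev i
  have hr' : (Fin.revPerm : Equiv.Perm (Fin (n + 1)))⁻¹ = Fin.revPerm := inv_eq_of_mul_eq_one_left hr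
  refine congrArg sInf (Set.ext fun l => ⟨?_, ?_⟩)
  · rintro ⟨x, hx, rfl⟩
    refine ⟨x.map Fin.rev, ?_, List.length_map _⟩
    rw [wordProd_map_rev, hx, hr', mul_assoc, mul_assoc, hr, mul_one, ← mul_assoc, hr, one_mul]
  · rintro ⟨x, rfl, rfl⟩
    exact ⟨x.map Fin.rev, wordProd_map_rev x, List.length_map _⟩

theorem isReducedExpr_map_rev (hx : IsReducedExpr w x) :
    IsReducedExpr (Fin.revPerm * w * Fin.revPerm⁻¹) (x.map Fin.rev) :=
  ⟨by rw [wordProd_map_rev, hx.1], by rw [List.length_map, len_conj_rev, hx.2]⟩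

theorem IsLongest.conj_rev (hw : IsLongest (Set.Icc a b) w) :
    IsLongest (Set.Icc b.rev a.rev) (Fin.revPerm * w * Fin.revPerm⁻¹) := by
  refine ⟨?_, fun v hv => ?_⟩
  · obtain ⟨x, hx, rfl⟩ := exists_word_of_mem_closure hw.1
    rw [← wordProd_map_rev]
    refine wordProd_mem_closure fun i hi => ?_
    obtain ⟨j, hj, rfl⟩ := List.mem_map.1 hi
    exact ⟨Fin.rev_le_rev.2 (hx j hj).2, Fin.rev_le_rev.2 (hx j hj).1⟩
  · obtain ⟨x, hx, rfl⟩ := exists_word_of_mem_closure hv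
    rw [len_conj_rev, ← len_conj_rev (wordProd x), ← wordProd_map_rev]
    refine hw.2 _ (wordProd_mem_closure fun i hi => ?_)
    obtain ⟨j, hj, rfl⟩ := List.mem_map.1 hi
    refine ⟨Fin.rev_le_rev.1 ?_, Fin.rev_le_rev.1 ?_⟩
    · rw [Fin.rev_rev]; exact (hx j hj).2
    · rw [Fin.rev_rev]; exact (hx j hj).1

theorem Distant.rev {i j : Fin n} (h : Distant i j) : Distant i.rev j.rev := by
  simp only [Distant, Fin.val_rev] at h ⊢; omega

theorem Adjacent.rev {i j : Fin n} (h : Adjacent i j) : Adjacent i.rev j.rev := by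
  simp only [Adjacent, Fin.val_rev] at h ⊢; omega

/-- The diagram automorphism interchanges `i (i+1) i` and `(i+1) i (i+1)`, so the image of an
oriented edge is oriented when followed backwards. -/
theorem Edge.exists_rev (e : Edge x y) (he : e.IsOriented) :
    ∃ e' : Edge (y.map Fin.rev) (x.map Fin.rev), e'.IsOriented := by
  cases e with
  | distant u v i j h =>
    rw [List.map_append, List.map_append]
    exact ⟨.distant _ _ _ _ h.rev.swap, trivial⟩
  | adjacent u v i j h =>
    rw [List.map_append, List.map_append]
    exact ⟨.adjacent _ _ _ _ h.rev.swap, Fin.rev_lt_rev.2 he⟩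

theorem Path.exists_rev (p : Path x y) (hp : p.IsOriented) :
    ∃ p' : Path (y.map Fin.rev) (x.map Fin.rev), p'.IsOriented := by
  induction p with
  | nil => exact ⟨.nil _, trivial⟩
  | cons e p ih =>
    obtain ⟨q, hq⟩ := ih hp.2
    obtain ⟨e', he'⟩ := e.exists_rev hp.1
    exact ⟨q.append (.cons e' (.nil _)), hq.append ⟨he', trivial⟩⟩

/-- A block of maximal length is a full descending run from `e - 1`, and these runs spell the sink
word from right to left. The bound on `e` guarantees that no run is missing. -/
theorem Stage.blockWord_map_val {c e : ℕ} {L : List (List (Fin n))} (hL : IsBlocks c L)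
    (hs : Stage e 0 c L) (h : e ≤ c + L.length) :
    (blockWord L).map Fin.val = (sinkWord c e).reverse := by
  have block {c : ℕ} {u : List (Fin n)} (hu : IsBlock c u) :
      u.map Fin.val = desc c (c + u.length) := by
    induction u with
    | nil => simp [desc, asc]
    | cons i u ih =>
      rw [List.map_cons, ih hu.2, hu.1, desc, desc, asc, asc, List.length_cons,
        show c + (u.length + 1) - c = c + u.length - c + 1 by omega, List.range'_concat,
        List.reverse_append]
      simp
  have hr : (sinkWord c e).reverse = (asc c e).flatMap fun c => desc c e := by
    simp [sinkWord, desc, List.reverse_flatMap, Function.comp_def]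
  rw [hr]
  clear hr
  induction L generalizing c with
  | nil =>
    rw [List.length_nil] at h
    simp [blockWord, asc, show e - c = 0 by omega]
  | cons u L ih =>
    rw [List.length_cons] at h
    have h1 := hs.1
    by_cases hc : c < e
    · rw [show blockWord (u :: L) = u ++ blockWord L from rfl, List.map_append, block hL.1,
        ih hL.2 hs.2 (by omega), asc, asc, show e - c = e - (c + 1) + 1 by omega, List.range'_succ,
        List.flatMap_cons, show c + u.length = e by omega]
    · rw [show blockWord (u :: L) = u ++ blockWord L from rfl, List.map_append,
        ih hL.2 hs.2 (by omega), List.length_eq_zero_iff.1 (show u.length = 0 by omega)]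
      simp [asc, show e - c = 0 by omega, show e - (c + 1) = 0 by omega]

theorem map_asc_sub {a e m : ℕ} (h : e ≤ m) :
    (asc (m - e) (m - a)).map (fun i => m - 1 - i) = desc a e := by
  apply List.ext_getElem
  · simp [asc, desc]; omega
  · intro i h1 h2
    simp only [List.length_map, asc, List.length_range'] at h1
    simp [asc, desc]
    omega

theorem map_sinkWord_sub {a e m : ℕ} (h : e ≤ m) :
    (sinkWord (m - e) (m - a)).map (fun i => m - 1 - i) = sourceWord a e := by
  have h1 : (desc (m - e) (m - a)).map (fun i => m - 1 - i) = asc a e := by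
    rw [desc, List.map_reverse, map_asc_sub h, desc, List.reverse_reverse]
  rw [sinkWord, sourceWord, ← h1, List.map_flatMap, List.flatMap_map]
  refine List.flatMap_congr fun i hi => ?_
  simp only [desc, asc, List.mem_reverse, List.mem_range'_1] at hi
  rw [← map_asc_sub (m := m) (by omega), show m - (m - 1 - i + 1) = i by omega]

/-- All reduced expressions of the longest element lie on oriented paths from the standard source to
the standard sink. -/
theorem IsLongest.exists_standard (k : Type u) [Field k] [NeZero (2 : k)] (hab : a ≤ b)
    (hw : IsLongest (Set.Icc a b) w) : ∃ s t : List (Fin n),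
      s.map Fin.val = (sourceWord a.val (b.val + 1)).reverse ∧
      t.map Fin.val = (sinkWord a.val (b.val + 1)).reverse ∧
      IsReducedExpr w s ∧ IsReducedExpr w t ∧ StageWord k a.val (b.val + 1) 0 s ∧
      ∀ x, IsReducedExpr w x →
        (∃ p : Path s x, p.IsOriented) ∧ ∃ p : Path x t, p.IsOriented := by
  have hab' := Fin.le_def.1 hab
  obtain ⟨s, hs, hS⟩ := exists_stageWord (k := k) (n := n) (a := a.val) (e := b.val + 1)
    (by omega) (by omega)
  obtain ⟨L, f, hf, hl, hst, -⟩ := id hS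
  obtain ⟨hT, hp⟩ := hw.exists_path_sink k hf.isBlocks hst hl
  have ha : a.rev.val + 1 = n - a.val := by rw [Fin.val_rev]; omega
  have hb : b.rev.val = n - (b.val + 1) := Fin.val_rev b
  -- The same construction for the reflected interval gives paths into its sink. The automorphism
  -- turns them into paths out of a source for the original interval, identified with `s` in `e1`.
  obtain ⟨s', -, L', f', hf', hl', hst', -⟩ := exists_stageWord (k := k) (n := n) (a := b.rev.val)
    (e := a.rev.val + 1) (by omega) (by omega)
  obtain ⟨hT', hp'⟩ := hw.conj_rev.exists_path_sink k hf'.isBlocks hst' hl'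
  have e1 : (blockWord L').map Fin.rev = s := by
    apply List.map_injective_iff.2 Fin.val_injective
    rw [hs, ← map_sinkWord_sub (m := n) (by omega), ← List.map_reverse, ← ha, ← hb,
      ← Stage.blockWord_map_val hf'.isBlocks hst' (by omega), List.map_map, List.map_map]
    refine List.map_congr_left fun i _ => ?_
    simp only [Function.comp_apply, Fin.val_rev]
    omega
  have hrev : ∀ x, IsReducedExpr w x → ∃ p : Path s x, p.IsOriented := by
    intro x hx
    obtain ⟨p, hp⟩ := hp' _ (isReducedExpr_map_rev hx)
    have := p.exists_rev hp
    rwa [map_rev_map_rev, e1] at this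
  refine ⟨s, blockWord L, hs, Stage.blockWord_map_val hf.isBlocks hst (by omega), ?_, hT, hS,
    fun x hx => ⟨hrev x hx, hp x hx⟩⟩
  obtain ⟨p, -⟩ := hrev _ hT
  exact ⟨p.wordProd_eq.symm.trans hT.1, p.length_eq.symm.trans hT.2⟩

end standardWords

/-! ### Sources and sinks -/

section sources

variable {n : ℕ} {w : Equiv.Perm (Fin (n + 1))} {a b : Fin n} {x y z : List (Fin n)}

theorem DistantRel.exists_path (h : DistantRel x y) : ∃ p : Path x y, p.IsDistant := by
  induction h with
  | refl => exact ⟨.nil _, trivial⟩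
  | tail _ h ih =>
    obtain ⟨u, v, i, j, hij, rfl, rfl⟩ := h
    obtain ⟨p, hp⟩ := ih
    exact ⟨p.append (.cons (.distant u v i j hij) (.nil _)), hp.append ⟨trivial, trivial⟩⟩

theorem Up.exists_edge (h : Up x y) : Nonempty (Edge x y) := by
  obtain ⟨u, v, i, j, hij, rfl, rfl⟩ := h
  exact ⟨.adjacent u v i j (.of_succ hij)⟩

/-- The sum of the letters of a word. -/
def letterSum (x : List (Fin n)) : ℕ := (x.map Fin.val).sum

theorem Up.letterSum_lt (h : Up x y) : letterSum x < letterSum y := by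
  obtain ⟨u, v, i, j, hij, rfl, rfl⟩ := h
  simp only [letterSum, List.map_append, List.map_cons, List.sum_append, List.sum_cons]
  omega

theorem Edge.letterSum_eq (e : Edge x y) (he : e.IsDistant) : letterSum x = letterSum y := by
  cases e with
  | distant u v i j h =>
    simp only [letterSum, List.map_append, List.map_cons, List.sum_append, List.sum_cons]
    omega
  | adjacent => exact he.elim

theorem Path.letterSum_le (p : Path x y) (hp : p.IsOriented) : letterSum x ≤ letterSum y := by
  induction p with
  | nil => exact le_rfl
  | cons e p ih =>
    refine le_trans ?_ (ih hp.2)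
    rcases e.isDistant_or_up hp.1 with he | he
    · exact (e.letterSum_eq he).le
    · exact he.letterSum_lt.le

theorem DistantRel.letterSum_le (h : DistantRel x y) : letterSum x ≤ letterSum y := by
  obtain ⟨p, hp⟩ := h.exists_path
  exact p.letterSum_le hp.isOriented

/-- The letter sum is constant along distant edges and grows along oriented adjacent ones. An
incoming adjacent edge at the class of `x` would start at a word with a smaller sum, yet that word
is reached from `x` by an oriented path. -/
theorem isSource_of_exists_path (hx : IsReducedExpr w x)
    (h : ∀ y, IsReducedExpr w y → ∃ p : Path x y, p.IsOriented) : IsSource w x := by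
  refine ⟨hx, fun y hy z hz => ?_⟩
  obtain ⟨p, -⟩ := hy.exists_path
  obtain ⟨e⟩ := hz.exists_edge
  obtain ⟨q, hq⟩ := h z ((hx.of_path p).of_path (.cons e.reverse (.nil _)))
  have h1 := q.letterSum_le hq
  have h2 := hz.letterSum_lt
  have h3 := (distantRel_symm hy).letterSum_le
  omega

theorem isSink_of_exists_path (hx : IsReducedExpr w x)
    (h : ∀ y, IsReducedExpr w y → ∃ p : Path y x, p.IsOriented) : IsSink w x := by
  refine ⟨hx, fun y hy z hz => ?_⟩
  obtain ⟨p, -⟩ := hy.exists_path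
  obtain ⟨e⟩ := hz.exists_edge
  obtain ⟨q, hq⟩ := h z ((hx.of_path p).of_path (.cons e (.nil _)))
  have h1 := q.letterSum_le hq
  have h2 := hz.letterSum_lt
  have h3 := hy.letterSum_le
  omega

/-! ### Reversal of words -/

theorem len_inv (w : Equiv.Perm (Fin (n + 1))) : len w⁻¹ = len w := by
  refine congrArg sInf (Set.ext fun l => ⟨?_, ?_⟩)
  · rintro ⟨x, hx, rfl⟩
    exact ⟨x.reverse, by rw [wordProd_reverse, hx, inv_inv], List.length_reverse⟩
  · rintro ⟨x, rfl, rfl⟩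
    exact ⟨x.reverse, wordProd_reverse x, List.length_reverse⟩

theorem IsReducedExpr.reverse (hx : IsReducedExpr w x) : IsReducedExpr w⁻¹ x.reverse :=
  ⟨by rw [wordProd_reverse, hx.1], by rw [List.length_reverse, len_inv, hx.2]⟩

theorem DistantRel.reverse (h : DistantRel x y) : DistantRel x.reverse y.reverse := by
  induction h with
  | refl => exact .refl
  | tail _ h ih =>
    obtain ⟨u, v, i, j, hij, rfl, rfl⟩ := h
    exact ih.tail ⟨v.reverse, u.reverse, j, i, hij.swap, by simp, by simp⟩

theorem Up.reverse (h : Up x y) : Up x.reverse y.reverse := by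
  obtain ⟨u, v, i, j, hij, rfl, rfl⟩ := h
  exact ⟨v.reverse, u.reverse, i, j, hij, by simp, by simp⟩

theorem IsSource.reverse (h : IsSource w x) : IsSource w⁻¹ x.reverse := by
  refine ⟨h.1.reverse, fun y hy z hz => h.2 y.reverse ?_ _ hz.reverse⟩
  simpa using hy.reverse

theorem IsSink.reverse (h : IsSink w x) : IsSink w⁻¹ x.reverse := by
  refine ⟨h.1.reverse, fun y hy z hz => h.2 y.reverse ?_ _ hz.reverse⟩
  simpa using hy.reverse

theorem IsLongest.inv {J : Set (Fin n)} (hw : IsLongest J w) : IsLongest J w⁻¹ :=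
  ⟨inv_mem hw.1, fun v hv => by rw [len_inv]; exact hw.2 v hv⟩

/-- The inverse is longest as well, and both elements are the product of the same standard sink
word. -/
theorem IsLongest.inv_eq (k : Type u) [Field k] [NeZero (2 : k)] (hab : a ≤ b)
    (hw : IsLongest (Set.Icc a b) w) : w⁻¹ = w := by
  obtain ⟨-, t, -, ht, -, h, -⟩ := hw.exists_standard k hab
  obtain ⟨-, t', -, ht', -, h', -⟩ := hw.inv.exists_standard k hab
  obtain rfl := List.map_injective_iff.2 Fin.val_injective (ht.trans ht'.symm)
  exact h'.1.symm.trans h.1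

/-! ### The common summand -/

/-- The idempotent `φ s s` has the summand as its image; `φ s x` and `φ x s` identify it with the
corresponding summand of `B_x`. -/
theorem isCommonSummand_of_comp {k : Type u} [Field k] {S : Set (List (Fin n))} {s : List (Fin n)}
    (hs : s ∈ S) {φ : ∀ x y : List (Fin n), BS k x →ₗ[PolyRing k n] BS k y}
    (hr : ∀ x ∈ S, ∀ y ∈ S, ∀ m r, φ x y (m * BS.right k x r) = φ x y m * BS.right k y r)
    (hc : ∀ x ∈ S, ∀ y ∈ S, ∀ z ∈ S, φ y z ∘ₗ φ x y = φ x z) : IsCommonSummand S φ := by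
  have hc' (x) (hx : x ∈ S) (y) (hy : y ∈ S) (z) (hz : z ∈ S) (m : BS k x) :
      φ y z (φ x y m) = φ x z m := LinearMap.congr_fun (hc x hx y hy z hz) m
  let ρ : PolyRing k n →+* Module.End (PolyRing k n) (LinearMap.range (φ s s)) :=
    { toFun := fun r => (LinearMap.mulRight (PolyRing k n) (BS.right k s r)).restrict (by
        rintro _ ⟨m, rfl⟩
        exact ⟨m * BS.right k s r, hr s hs s hs m r⟩)
      map_one' := by
        ext m
        change m.1 * BS.right k s 1 = m.1
        rw [map_one, mul_one]
      map_mul' := fun r r' => by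
        ext m
        change m.1 * BS.right k s (r * r') = m.1 * BS.right k s r' * BS.right k s r
        rw [map_mul, mul_assoc, mul_comm (BS.right k s r)]
      map_zero' := by
        ext m
        change m.1 * BS.right k s 0 = 0
        rw [map_zero, mul_zero]
      map_add' := fun r r' => by
        ext m
        change m.1 * BS.right k s (r + r') = m.1 * BS.right k s r + m.1 * BS.right k s r'
        rw [map_add, mul_add] }
  refine ⟨LinearMap.range (φ s s), inferInstance, inferInstance, ρ,
    fun x => φ s x ∘ₗ (LinearMap.range (φ s s)).subtype,
    fun x => (φ s s).rangeRestrict ∘ₗ φ x s, ?_, ?_, ?_, ?_⟩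
  · exact fun x hx r c => hr s hs x hx c.1 r
  · intro x hx r m
    refine Subtype.ext ?_
    change φ s s (φ x s (m * BS.right k x r)) = φ s s (φ x s m) * BS.right k s r
    rw [hr x hx s hs, hr s hs s hs]
  · intro x hx
    ext ⟨_, m, rfl⟩
    change φ s s (φ x s (φ s x (φ s s m))) = φ s s m
    rw [hc' s hs s hs x hx, hc' s hs x hx s hs, hc' s hs s hs s hs]
  · intro x hx y hy
    ext m
    change φ s y (φ s s (φ x s m)) = φ x y m
    rw [hc' x hx s hs s hs, hc' x hx s hs y hy]

/-! ### Paths that contain a path from the source to the sink -/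

variable {k : Type u} [Field k] [NeZero (2 : k)]

/-- Paths whose morphism maps to the subbimodule generated by `1`. -/
def Path.IsThin (k : Type u) [Field k] [NeZero (2 : k)] (p : Path x y) : Prop :=
  ∀ m, p.hom k m ∈ oneSpan (BX.right k y)

theorem exists_downMor_eq (h : ∃ p : Path x y, p.IsOriented) :
    ∃ p : Path x y, p.IsOriented ∧ downMor k x y = p.mor k :=
  ⟨h.choose, h.choose_spec, dif_pos h⟩

theorem exists_upMor_eq (h : ∃ p : Path x y, p.IsOriented) :
    ∃ p : Path x y, p.IsOriented ∧ upMor k y x = p.reverse.mor k :=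
  ⟨h.choose, h.choose_spec, dif_pos h⟩

/-- All oriented paths from a source to a sink are thin, and all reduced expressions lie on such a
path. -/
theorem IsLongest.exists_path (k : Type u) [Field k] [NeZero (2 : k)] (hab : a ≤ b)
    (hw : IsLongest (Set.Icc a b) w) {s t : List (Fin n)} (hs : IsSource w s) (ht : IsSink w t) :
    (∀ x, IsReducedExpr w x →
      (∃ p : Path s x, p.IsOriented) ∧ ∃ p : Path x t, p.IsOriented) ∧
    ∀ q : Path s t, q.IsOriented → q.IsThin k := by
  obtain ⟨s', t', -, -, -, -, hS, hp⟩ := hw.exists_standard k hab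
  obtain ⟨d, hd⟩ := (hp s hs.1).1
  obtain ⟨d', hd'⟩ := (hp t ht.1).2
  -- An arbitrary source is joined to the standard one by distant edges only, since an oriented path
  -- into a source has no adjacent edge; sinks are treated in the same way.
  have h1 := hd.isDistant_of_source hs.2
  have h2 := hd'.isDistant_of_sink ht.2
  refine ⟨fun x hx => ⟨?_, ?_⟩, fun q hq => hS.hom_mem d h1 q hq ht.2⟩
  · obtain ⟨p, hp⟩ := (hp x hx).1
    exact ⟨d.reverse.append p, h1.reverse.isOriented.append hp⟩
  · obtain ⟨p, hp⟩ := (hp x hx).2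
    exact ⟨p.append d'.reverse, hp.append h2.reverse.isOriented⟩

end sources

end Soergel

end

/-! ### The main theorem, by uniqueness of thin path morphisms. -/

theorem mainTheorem1 {k : Type*} [Field k] [NeZero (2 : k)] {n : ℕ} (a b : Fin n) (hab : a ≤ b)
    (w : Equiv.Perm (Fin (n + 1))) (hw : Soergel.IsLongest (Set.Icc a b) w) :
    (∃ s : List (Fin n), s.map Fin.val = Soergel.sourceWord a.val (b.val + 1) ∧
      Soergel.IsSource w s) ∧
    (∃ t : List (Fin n), t.map Fin.val = Soergel.sinkWord a.val (b.val + 1) ∧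
      Soergel.IsSink w t) ∧
    ∀ s t : List (Fin n), Soergel.IsSource w s → Soergel.IsSink w t →
      -- the paths in the definition of `φ` and `ψ` exist
      (∀ x, Soergel.IsReducedExpr w x →
        (∃ p : Soergel.Path s x, p.IsOriented) ∧ ∃ p : Soergel.Path x t, p.IsOriented) ∧
      -- `φ`, `ψ`, `z` and the flip of `z` do not depend on the choice of the paths
      (∀ x y, Soergel.IsReducedExpr w x → Soergel.IsReducedExpr w y →
        ∀ (p : Soergel.Path x t) (q : Soergel.Path s t) (r : Soergel.Path s y),
          p.IsOriented → q.IsOriented → r.IsOriented →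
          (p.append (q.reverse.append r)).mor k = Soergel.phi k s t x y) ∧
      (∀ x y, Soergel.IsReducedExpr w x → Soergel.IsReducedExpr w y →
        ∀ (p : Soergel.Path s x) (q : Soergel.Path s t) (r : Soergel.Path y t),
          p.IsOriented → q.IsOriented → r.IsOriented →
          (p.reverse.append (q.append r.reverse)).mor k = Soergel.psi k s t x y) ∧
      (∀ q : Soergel.Path s t, q.IsOriented →
        q.mor k = Soergel.zMor k s t ∧ q.reverse.mor k = Soergel.zBar k s t) ∧
      Soergel.psi k s t s t = Soergel.zMor k s t ∧
      Soergel.phi k s t t s = Soergel.zBar k s t ∧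
      -- the three identities
      Soergel.zMor k s t ∘ₗ Soergel.zBar k s t ∘ₗ Soergel.zMor k s t = Soergel.zMor k s t ∧
      (∀ x y, Soergel.IsReducedExpr w x → Soergel.IsReducedExpr w y →
        Soergel.OnV a b x → Soergel.OnV a b y →
        Soergel.phi k s t x y = Soergel.psi k s t x y) ∧
      (∀ x y z, Soergel.IsReducedExpr w x → Soergel.IsReducedExpr w y →
        Soergel.IsReducedExpr w z →
        Soergel.phi k s t y z ∘ₗ Soergel.phi k s t x y = Soergel.phi k s t x z) ∧
      -- the common summand
      Soergel.IsCommonSummand {x | Soergel.IsReducedExpr w x} (Soergel.phi k s t) := by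
  refine ⟨?_, ?_, fun s t hs ht => ?_⟩
  · obtain ⟨s, _, hs, -, h, -, -, hp⟩ := hw.exists_standard k hab
    -- The insertion argument produces the reversed word. Reversal passes to `w⁻¹`, which is `w`.
    refine ⟨s.reverse, by rw [List.map_reverse, hs, List.reverse_reverse], ?_⟩
    rw [← hw.inv_eq k hab]
    exact (Soergel.isSource_of_exists_path h fun y hy => (hp y hy).1).reverse
  · obtain ⟨_, t, -, ht, -, h, -, hp⟩ := hw.exists_standard k hab
    refine ⟨t.reverse, by rw [List.map_reverse, ht, List.reverse_reverse], ?_⟩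
    rw [← hw.inv_eq k hab]
    exact (Soergel.isSink_of_exists_path h fun y hy => (hp y hy).2).reverse
  obtain ⟨hex, hthin⟩ := hw.exists_path k hab hs ht
  obtain ⟨q, hq, hz⟩ := Soergel.exists_downMor_eq (k := k) (hex t ht.1).1
  obtain ⟨q', hq', hz'⟩ := Soergel.exists_upMor_eq (k := k) (hex t ht.1).1
  have rthin {q : Soergel.Path s t} (hq : q.IsOriented) : q.reverse.IsThin k :=
    Soergel.Path.mem_reverse (hthin q hq)
  -- It is enough to know each φ as the morphism of some thin path; the particular path plays no
  -- role afterwards.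
  have hphi (x y) (hx : Soergel.IsReducedExpr w x) (hy : Soergel.IsReducedExpr w y) :
      ∃ P : Soergel.Path x y, P.IsThin k ∧ Soergel.phi k s t x y = P.mor k := by
    obtain ⟨p, -, hp⟩ := Soergel.exists_downMor_eq (k := k) (hex x hx).2
    obtain ⟨r, -, hr⟩ := Soergel.exists_downMor_eq (k := k) (hex y hy).1
    refine ⟨p.append (q'.reverse.append r), Soergel.Path.mem_append_right
      (Soergel.Path.mem_append_left (rthin hq')), ?_⟩
    rw [Soergel.phi, hp, hr, hz', Soergel.Path.mor_append, Soergel.Path.mor_append]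
    rfl
  have hpsi (x y) (hx : Soergel.IsReducedExpr w x) (hy : Soergel.IsReducedExpr w y) :
      ∃ P : Soergel.Path x y, P.IsThin k ∧ Soergel.psi k s t x y = P.mor k := by
    obtain ⟨p, -, hp⟩ := Soergel.exists_upMor_eq (k := k) (hex x hx).1
    obtain ⟨r, -, hr⟩ := Soergel.exists_upMor_eq (k := k) (hex y hy).2
    refine ⟨p.reverse.append (q.append r.reverse), Soergel.Path.mem_append_right
      (Soergel.Path.mem_append_left (hthin q hq)), ?_⟩
    rw [Soergel.psi, hp, hr, hz, Soergel.Path.mor_append, Soergel.Path.mor_append]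
    rfl
  have hcomp (x y z) (hx : Soergel.IsReducedExpr w x) (hy : Soergel.IsReducedExpr w y)
      (hz : Soergel.IsReducedExpr w z) :
      Soergel.phi k s t y z ∘ₗ Soergel.phi k s t x y = Soergel.phi k s t x z := by
    obtain ⟨P, hP, e⟩ := hphi x y hx hy
    obtain ⟨Q, hQ, e'⟩ := hphi y z hy hz
    obtain ⟨R, hR, e''⟩ := hphi x z hx hz
    rw [e, e', e'', ← Soergel.Path.mor_append]
    exact Soergel.Path.mor_eq _ _ (Soergel.Path.mem_append_right hQ) hR
  -- Each remaining equality of morphisms compares two thin paths with common ends.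
  refine ⟨hex, fun x y hx hy p q r _ hq _ => ?_, fun x y hx hy p q r _ hq _ => ?_,
    fun q₀ hq₀ => ⟨?_, ?_⟩, ?_, ?_, ?_, fun x y hx hy _ _ => ?_, hcomp, ?_⟩
  · obtain ⟨P, hP, e⟩ := hphi x y hx hy
    rw [e]
    exact Soergel.Path.mor_eq _ _ (Soergel.Path.mem_append_right
      (Soergel.Path.mem_append_left (rthin hq))) hP
  · obtain ⟨P, hP, e⟩ := hpsi x y hx hy
    rw [e]
    exact Soergel.Path.mor_eq _ _ (Soergel.Path.mem_append_right
      (Soergel.Path.mem_append_left (hthin q hq))) hP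
  · exact (Soergel.Path.mor_eq _ _ (hthin q₀ hq₀) (hthin q hq)).trans hz.symm
  · exact (Soergel.Path.mor_eq _ _ (rthin hq₀) (rthin hq')).trans hz'.symm
  · obtain ⟨P, hP, e⟩ := hpsi s t hs.1 ht.1
    rw [e]
    exact (Soergel.Path.mor_eq _ _ hP (hthin q hq)).trans hz.symm
  · obtain ⟨P, hP, e⟩ := hphi t s ht.1 hs.1
    rw [e]
    exact (Soergel.Path.mor_eq _ _ hP (rthin hq')).trans hz'.symm
  · rw [Soergel.zMor, Soergel.zBar, hz, hz', ← Soergel.Path.mor_append, ← Soergel.Path.mor_append]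
    exact Soergel.Path.mor_eq _ _ (Soergel.Path.mem_append_right (hthin q hq)) (hthin q hq)
  · obtain ⟨P, hP, e⟩ := hphi x y hx hy
    obtain ⟨Q, hQ, e'⟩ := hpsi x y hx hy
    rw [e, e']
    exact Soergel.Path.mor_eq _ _ hP hQ
  · refine Soergel.isCommonSummand_of_comp (s := s) hs.1 (fun x hx y hy m r => ?_)
      fun x hx y hy z hz => hcomp x y z hx hy hz
    obtain ⟨P, -, e⟩ := hphi x y hx hy
    rw [e]
    exact P.mor_mul_right m r
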